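/- **Setting.** Use units in which the speed of light and the rest mass equal $1$. For $\vec p\in\mathbb R^3$ put $p^0=\sqrt{1+|\vec p|^2}$, $(p^\alpha)=(p^0,\vec p)$, and lower indices with the metric $\mathrm{diag}(1,-1,-1,-1)$. For $\vec u\in\mathbb R^3$ with $|\vec u|<1$ let $U=(\gamma,\gamma\vec u)$, $\gamma=(1-|\vec u|^2)^{-1/2}$, $E=U_\alpha p^\alpha$, and for $i=1,2,3$ let $n_i^0=U^i$, $n_i^j=\frac{U^iU^j}{U^0+1}+\delta_{ij}$. Define $y\in[-1,1]$ and $\phi$ by $$\sqrt{E^2-1}\,\bigl(\sqrt{1-y^2}\cos\phi,\ \sqrt{1-y^2}\sin\phi,\ y\bigr)=-(n_1^\alpha p_\alpha,n_2^\alpha p_\alpha,n_3^\alpha p_\alpha).$$ For $\theta>0$ and $\zeta=1/\theta$ let $g_{[\vec u,\theta]}=\frac{\zeta}{4\pi K_2(\zeta)}e^{-E/\theta}$, where $K_\nu$ is the modified Bessel function of the second kind, and $$\langle f,h\rangle=\int_{\mathbb R^3}\frac{f\,h}{g_{[\vec u,\theta]}}\,\frac{d^3\vec p}{p^0}.$$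 Let $P_k^{(\ell)}(x;\zeta)$ be the orthonormal polynomials (degree $k$, leading coefficient $c_k^{(\ell)}>0$) on $[1,\infty)$ for the weight $\frac{\zeta(x^2-1)^{\ell+1/2}}{(2\ell+1)K_2(\zeta)}e^{-\zeta x}$. Let $$Y_{\ell,m}(y,\phi)=\sqrt2\,\check P_\ell^{|m|}(y)\sin(|m|\phi),\quad \check P_\ell^0(y),\quad \sqrt2\,\check P_\ell^m(y)\cos(m\phi)\qquad\text{for } m<0,\ m=0,\ m>0,$$ where, for $0\le m\le\ell$, $$\check P_\ell^m(y)=\sqrt{\tfrac{(\ell-m)!}{(\ell+m)!}}\;\frac{(-1)^m(1-y^2)^{m/2}}{2^\ell\,\ell!}\,\frac{d^{\ell+m}}{dy^{\ell+m}}(y^2-1)^\ell .$$ Put $\tilde P_{k,m}^{(\ell)}[\vec u,\theta]=g_{[\vec u,\theta]}\,P_k^{(\ell)}(E;\theta^{-1})\,(E^2-1)^{\ell/2}\,Y_{\ell,m}(y,\phi)$. Fix an integer $M\ge1$. Order the $N_M$ functions $\tilde P^{(\ell)}_{k,m}$ with $k+\ell\le M$, $|m|\le\ell$, by $k+\ell$,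 then $\ell$, then $m$, and define the projection $\Pi_M=\Pi_M[\vec u,\theta]$ by $\Pi_Mh=\sum\langle h,\tilde P^{(\ell)}_{k,m}\rangle\tilde P^{(\ell)}_{k,m}$. **State vector.** The vector of unknowns is $$W=(n,\vec u,\theta,\Pi,\tilde f_{-1},\tilde f_0,\tilde f_1,f^{(2)}_{0,-2},\dots,f^{(2)}_{0,2},\dots,f^{(M)}_{0,M})\in\mathbb R^{N_M}$$ (only $(n,\vec u,\theta)$ if $M=1$; then $\Pi$ and $\tilde f_m$ below are $0$). After the ninth entry, $W$ consists of the coefficients $f^{(\ell)}_{k,m}$ with $k+\ell\ge 3$ or $\ell=k+\ell=2$, in the above order. The state determines the projected distribution $F_W=\sum f_{k,m}^{(\ell)}\tilde P_{k,m}^{(\ell)}[\vec u,\theta]$, where the coefficients that are not entries of $W$ are $$f^{(0)}_{0,0}=\frac{n}{c_0^{(0)}}-3\Pi P_0^{(0)}(0;\zeta),\qquad f_{k,0}^{(0)}=-3\Pi P_k^{(0)}(0;\zeta)\ (k=1,2),\qquad f_{k,m}^{(1)}=\tilde f_mP_k^{(1)}(0;\zeta)\ (k=0,1).$$ (For $M\ge2$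 these relations express that $n$, $\vec u$, $\theta$, $\Pi$ are the Landau-Lifshitz density, velocity, temperature and bulk viscous pressure of $F_W$, and that $\tilde f_m=f^{(1)}_{0,m}/c_0^{(1)}$.) Call $W$ *admissible* if $n>0$, $|\vec u|<1$, $\theta>0$ and the energy-momentum tensor $T^{\alpha\beta}=\int p^\alpha p^\beta F_W\,d^3\vec p/p^0$ is a positive definite matrix. **Moment system.** For $\alpha=0,1,2,3$ let $B_M^\alpha(W)$ be the $N_M\times N_M$ matrix whose $j$-th column is the vector of inner products of $p^\alpha\,\Pi_M(\partial F_W/\partial W_j)$ with the functions $\tilde P^{(\ell)}_{k,m}[\vec u,\theta]$. For an operator $Q$ that maps a function of $\vec p$ to a function of $\vec p$ (the collision term), let $S(W)$ be the vector of the inner products of $Q(F_W)$ with these functions. **Theorem (Hyperbolicity).** Let $M\ge1$. 1. Let $W$ be a field of states over space-time, differentiable at $x=(x^0,\dots,x^3)$ and with $W(x)$ admissible. Then at $x$, for every $Q$, the projected kinetic equation $$\Pi_M\Bigl(\sum_{\alpha=0}^{3}p^\alpha\,\Pi_M\frac{\partial F_W}{\partial x^\alpha}\Bigr)=\Pi_M\,Q(F_W)$$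 (projections at $\vec u,\theta$ of $W(x)$) is equivalent to the moment system $$\sum_{\alpha=0}^3B_M^\alpha(W)\,\frac{\partial W}{\partial x^\alpha}=S(W).$$ 2. The moment system is hyperbolic at every admissible $W$: $B_M^0(W)$ is invertible, and for every unit vector $\tilde n\in\mathbb R^3$ the matrix $B_M=(B_M^0)^{-1}\sum_{i=1}^3\tilde n_iB_M^i$ is diagonalizable over $\mathbb R$, and its spectral radius is strictly less than $1$. -/

import Mathlib

open MeasureTheory Polynomial

namespace RelMoment

noncomputable section

/-! Units are chosen so that the speed of light and the rest mass equal one. -/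

/-- The momentum space `ℝ³`. -/
abbrev Momentum : Type := EuclideanSpace ℝ (Fin 3)

/-! ### Orthogonal polynomials on `[1, ∞)` -/

/-- The modified Bessel function of the second kind `K_ν(ζ)`. -/
def besselK (ν : ℕ) (ζ : ℝ) : ℝ :=
  ∫ t in Set.Ioi (0 : ℝ), Real.cosh (ν * t) * Real.exp (-ζ * Real.cosh t)

/-- The weight `ω^{(ℓ)}(x; ζ)`. -/
def polyWeight (ℓ : ℕ) (ζ x : ℝ) : ℝ :=
  ζ * (x ^ 2 - 1) ^ ((ℓ : ℝ) + 1 / 2) / ((2 * ℓ + 1) * besselK 2 ζ) * Real.exp (-ζ * x)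

/-- The inner product of two polynomials with respect to `ω^{(ℓ)}(·; ζ)` on `[1, ∞)`. -/
def polyInner (ℓ : ℕ) (ζ : ℝ) (P Q : ℝ[X]) : ℝ :=
  ∫ x in Set.Ioi (1 : ℝ), P.eval x * Q.eval x * polyWeight ℓ ζ x

/-- The monic orthogonal polynomials, by the Gram-Schmidt process applied to `1, X, X², …`. -/
def monicOrthPoly (ℓ : ℕ) (ζ : ℝ) (k : ℕ) : ℝ[X] :=
  X ^ k - ∑ j : Fin k,
    C (polyInner ℓ ζ (X ^ k) (monicOrthPoly ℓ ζ j)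
      / polyInner ℓ ζ (monicOrthPoly ℓ ζ j) (monicOrthPoly ℓ ζ j)) * monicOrthPoly ℓ ζ j
termination_by k
decreasing_by all_goals exact j.isLt

/-- `P_k^{(ℓ)}(·; ζ)`: the orthonormal polynomial of degree `k` with positive leading
coefficient. -/
def orthPoly (ℓ : ℕ) (ζ : ℝ) (k : ℕ) : ℝ[X] :=
  C (1 / √(polyInner ℓ ζ (monicOrthPoly ℓ ζ k) (monicOrthPoly ℓ ζ k))) * monicOrthPoly ℓ ζ k

/-! ### Real spherical harmonics -/

/-- The associated Legendre function of degree `ℓ` and order `m ≥ 0` (with the phase `(-1)^m`). -/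
def assocLegendre (ℓ m : ℕ) (y : ℝ) : ℝ :=
  (-1) ^ m * √(1 - y ^ 2) ^ m * (1 / (2 ^ ℓ * (ℓ.factorial : ℝ)))
    * (derivative^[ℓ + m] ((X ^ 2 - 1 : ℝ[X]) ^ ℓ)).eval y

/-- The associated Legendre function normalised by `√((ℓ - m)! / (ℓ + m)!)`; used for `m ≤ ℓ`. -/
def normLegendre (ℓ m : ℕ) (y : ℝ) : ℝ :=
  √(((ℓ - m).factorial : ℝ) / ((ℓ + m).factorial : ℝ)) * assocLegendre ℓ m y

/-- The real spherical harmonic `Y_{ℓ,m}(y, φ)`, `|m| ≤ ℓ`, where `y` is the cosine of the polar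
angle and `φ` is the azimuth. -/
def realSphericalHarmonic (ℓ : ℕ) (m : ℤ) (y φ : ℝ) : ℝ :=
  if m < 0 then √2 * normLegendre ℓ m.natAbs y * Real.sin (m.natAbs * φ)
  else if m = 0 then normLegendre ℓ 0 y
  else √2 * normLegendre ℓ m.natAbs y * Real.cos (m.natAbs * φ)

/-! ### Relativistic kinematics -/

/-- The Minkowski product `a_α b^α`, of signature `(+,-,-,-)`, of two contravariant vectors. -/
def minkowski (a b : Fin 4 → ℝ) : ℝ :=
  a 0 * b 0 - ∑ i : Fin 3, a i.succ * b i.succ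

/-- The on-shell momentum four-vector `(p⁰, p)` with `p⁰ = √(1 + |p|²)`. -/
def fourMomentum (p : Momentum) : Fin 4 → ℝ :=
  Fin.cons (√(1 + ‖p‖ ^ 2)) (fun i => p i)

/-- The velocity four-vector `U = (γ, γ u)` with `γ = (1 - |u|²)^{-1/2}`. -/
def fourVelocity (u : EuclideanSpace ℝ (Fin 3)) : Fin 4 → ℝ :=
  Fin.cons (1 / √(1 - ‖u‖ ^ 2)) (fun i => 1 / √(1 - ‖u‖ ^ 2) * u i)

/-- The spacelike tetrad vector `n_i` orthogonal to `U`: `n_i^0 = U^i` and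
`n_i^j = U^i U^j (U^0 - 1) / ((U^0)² - 1) + δ_{ij}`. The quotient is written as `1 / (U^0 + 1)`,
which also covers `u = 0`. -/
def tetrad (u : EuclideanSpace ℝ (Fin 3)) (i : Fin 3) : Fin 4 → ℝ :=
  Fin.cons (fourVelocity u i.succ) (fun j =>
    fourVelocity u i.succ * fourVelocity u j.succ / (fourVelocity u 0 + 1)
      + if i = j then 1 else 0)

/-- The energy in the frame of the fluid, `E = U_α p^α`. -/
def fluidEnergy (u : EuclideanSpace ℝ (Fin 3)) (p : Momentum) : ℝ :=
  minkowski (fourVelocity u) (fourMomentum p)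

/-- The spatial momentum in the frame of the fluid, `q_i = - n_i^α p_α`; its length is
`√(E² - 1)`. -/
def fluidMomentum (u : EuclideanSpace ℝ (Fin 3)) (p : Momentum) (i : Fin 3) : ℝ :=
  -minkowski (tetrad u i) (fourMomentum p)

/-- `(E² - 1)^{ℓ/2} Y_{ℓ,m}(y, φ)`, where
`√(E² - 1) (√(1 - y²) cos φ, √(1 - y²) sin φ, y) = (q_1, q_2, q_3)`. -/
def solidHarmonic (ℓ : ℕ) (m : ℤ) (u : EuclideanSpace ℝ (Fin 3)) (p : Momentum) : ℝ :=
  √(fluidEnergy u p ^ 2 - 1) ^ ℓ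
    * realSphericalHarmonic ℓ m (fluidMomentum u p 2 / √(fluidEnergy u p ^ 2 - 1))
        (Complex.arg ⟨fluidMomentum u p 0, fluidMomentum u p 1⟩)

/-! ### The weighted polynomial space, its basis and the projection -/

/-- The Maxwell-Jüttner weight `g_{[u,θ]}`, with `ζ = 1/θ`. -/
def juttner (u : EuclideanSpace ℝ (Fin 3)) (θ : ℝ) (p : Momentum) : ℝ :=
  θ⁻¹ / (4 * Real.pi * besselK 2 θ⁻¹) * Real.exp (-(fluidEnergy u p / θ))

/-- The inner product `⟨f, h⟩_{g_{[u,θ]}} = ∫ f h / g_{[u,θ]} d³p / p⁰`. -/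
def weightedInner (u : EuclideanSpace ℝ (Fin 3)) (θ : ℝ) (f h : Momentum → ℝ) : ℝ :=
  ∫ p : Momentum, 1 / juttner u θ p * f p * h p / fourMomentum p 0

/-- The indices of the basis of order `M`: a degree `d = k + ℓ ≤ M`, then `ℓ ≤ d`, then
`j = m + ℓ ∈ {0, …, 2ℓ}`. The lexicographic order is the order of the components of the basis
vector, and a component of the vector `W` of unknowns carries the index of the basis function
in the same position. -/
abbrev MomentIndex (M : ℕ) : Type :=
  Σ d : Fin (M + 1), Σ ℓ : Fin ((d : ℕ) + 1), Fin (2 * (ℓ : ℕ) + 1)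

/-- The basis function `g_{[u,θ]} P_k^{(ℓ)}(E; 1/θ) (E² - 1)^{ℓ/2} Y_{ℓ,m}(y, φ)`, where
`k = d - ℓ` and `m = j - ℓ`. -/
def basisFun {M : ℕ} (u : EuclideanSpace ℝ (Fin 3)) (θ : ℝ) (i : MomentIndex M)
    (p : Momentum) : ℝ :=
  juttner u θ p
    * (orthPoly (i.2.1 : ℕ) θ⁻¹ ((i.1 : ℕ) - (i.2.1 : ℕ))).eval (fluidEnergy u p)
    * solidHarmonic (i.2.1 : ℕ) (((i.2.2 : ℕ) : ℤ) - ((i.2.1 : ℕ) : ℤ)) u p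

/-- The projection `Π_M[u,θ]` onto the span of the basis of order `M`. -/
def momentProj (M : ℕ) (u : EuclideanSpace ℝ (Fin 3)) (θ : ℝ) (f : Momentum → ℝ)
    (p : Momentum) : ℝ :=
  ∑ i : MomentIndex M, weightedInner u θ f (basisFun u θ i) * basisFun u θ i p

/-! ### The unknowns -/

/-- The component of `W` with index `(d, ℓ, j)`, and zero if there is no such index. -/
def coord {M : ℕ} (W : MomentIndex M → ℝ) (d ℓ j : ℕ) : ℝ :=
  if h : d < M + 1 ∧ ℓ < d + 1 ∧ j < 2 * ℓ + 1 then
    W ⟨⟨d, h.1⟩, ⟨ℓ, h.2.1⟩, ⟨j, h.2.2⟩⟩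
  else 0

/-- `n`: the first component of `W`. -/
def density {M : ℕ} (W : MomentIndex M → ℝ) : ℝ := coord W 0 0 0

/-- `u`: the second, third and fourth components of `W`. -/
def velocity {M : ℕ} (W : MomentIndex M → ℝ) : EuclideanSpace ℝ (Fin 3) :=
  !₂[coord W 1 0 0, coord W 1 1 0, coord W 1 1 1]

/-- `θ`: the fifth component of `W`. -/
def temperature {M : ℕ} (W : MomentIndex M → ℝ) : ℝ := coord W 1 1 2

/-- The bulk viscous pressure `Π`: the sixth component of `W` (absent, that is zero, if `M = 1`). -/
def bulkPressure {M : ℕ} (W : MomentIndex M → ℝ) : ℝ := coord W 2 0 0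

/-- The coefficients of the particle diffusion, `f_{0,m}^{(1)} / c_0^{(1)}` with `m = j - 1`: the
seventh to ninth components of `W` (absent, that is zero, if `M = 1`). -/
def diffusion {M : ℕ} (W : MomentIndex M → ℝ) (j : ℕ) : ℝ := coord W 2 1 j

/-- The vector `f_M` of the expansion coefficients as a function of `W`. The conditions
`∫ E f = n`, `∫ E² f = ε₀(n, θ)`, `∫ f = ε₀ - 3 (P₀ + Π)` and `∫ E p^{<α>} f = 0` (with respect to
`d³p / p⁰`) determine the coefficients of `P_0^{(0)}, P_1^{(0)}, P_2^{(0)}` and of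
`P_0^{(1)}, P_1^{(1)}`. The other coefficients are themselves components of `W`. Here
`1 / c_0^{(0)} = 1 / P_0^{(0)}(0)`, and `P_k^{(ℓ)}(0)` is `c_k^{(ℓ)}` times the product of the
negated zeros. -/
def expansionCoeff {M : ℕ} (W : MomentIndex M → ℝ) (i : MomentIndex M) : ℝ :=
  let ζ := (temperature W)⁻¹
  let d : ℕ := i.1
  let ℓ : ℕ := i.2.1
  let j : ℕ := i.2.2
  if d = 0 then
    density W / (orthPoly 0 ζ 0).leadingCoeff - 3 * bulkPressure W * (orthPoly 0 ζ 0).eval 0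
  else if d ≤ 2 ∧ ℓ = 0 then -3 * bulkPressure W * (orthPoly 0 ζ d).eval 0
  else if d ≤ 2 ∧ ℓ = 1 then diffusion W j * (orthPoly 1 ζ (d - 1)).eval 0
  else W i

/-- The projected distribution function `Π_M[u,θ] f` of the state `W`. -/
def distribution {M : ℕ} (W : MomentIndex M → ℝ) (p : Momentum) : ℝ :=
  ∑ i : MomentIndex M, expansionCoeff W i * basisFun (velocity W) (temperature W) i p

/-- The energy-momentum tensor `T^{αβ} = ∫ p^α p^β (Π_M[u,θ] f) d³p / p⁰` of the state `W`. -/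
def energyMomentum {M : ℕ} (W : MomentIndex M → ℝ) : Matrix (Fin 4) (Fin 4) ℝ :=
  Matrix.of fun α β =>
    ∫ p : Momentum, fourMomentum p α * fourMomentum p β * distribution W p / fourMomentum p 0

/-- Physically admissible states: `n > 0`, `|u| < 1`, `θ > 0` and a positive definite
energy-momentum tensor. -/
structure Admissible {M : ℕ} (W : MomentIndex M → ℝ) : Prop where
  density_pos : 0 < density W
  velocity_lt : ‖velocity W‖ < 1
  temperature_pos : 0 < temperature W
  energyMomentum_posDef : (energyMomentum W).PosDef

/-! ### The moment system -/

/-- The derivative of the projected distribution with respect to the component `W_j`. -/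
def distributionDeriv {M : ℕ} (W : MomentIndex M → ℝ) (j : MomentIndex M) (p : Momentum) : ℝ :=
  deriv (fun t => distribution (Function.update W j t) p) (W j)

/-- The matrix `B_M^α(W)`: its column `j` holds the coefficients of
`Π_M (p^α Π_M (∂ (Π_M f) / ∂ W_j))` in the basis, where all projections are taken at the velocity
and the temperature of `W`. -/
def momentMatrix {M : ℕ} (α : Fin 4) (W : MomentIndex M → ℝ) :
    Matrix (MomentIndex M) (MomentIndex M) ℝ :=
  Matrix.of fun i j =>
    weightedInner (velocity W) (temperature W)
      (fun p => fourMomentum p α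
        * momentProj M (velocity W) (temperature W) (distributionDeriv W j) p)
      (basisFun (velocity W) (temperature W) i)

/-- The source term `S(W)` of a collision operator `Q`: the coefficients of `Π_M Q(Π_M f)`. -/
def momentSource {M : ℕ} (Q : (Momentum → ℝ) → Momentum → ℝ) (W : MomentIndex M → ℝ)
    (i : MomentIndex M) : ℝ :=
  weightedInner (velocity W) (temperature W) (Q (distribution W))
    (basisFun (velocity W) (temperature W) i)

/-- The projected kinetic equation
`Π_M (p^α Π_M (∂ (Π_M f) / ∂ x^α)) = Π_M Q(Π_M f)` at the space-time point `x = (x⁰, …, x³)`, for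
a field `W` of states. -/
def ProjectedEquationAt {M : ℕ} (Q : (Momentum → ℝ) → Momentum → ℝ)
    (W : (Fin 4 → ℝ) → MomentIndex M → ℝ) (x : Fin 4 → ℝ) : Prop :=
  momentProj M (velocity (W x)) (temperature (W x))
      (fun p => ∑ α : Fin 4, fourMomentum p α
        * momentProj M (velocity (W x)) (temperature (W x))
            (fun p' => fderiv ℝ (fun y => distribution (W y) p') x (Pi.single α 1)) p)
    = momentProj M (velocity (W x)) (temperature (W x)) (Q (distribution (W x)))

/-- The moment system `B_M^α(W) ∂W/∂x^α = S(W)` at the space-time point `x`. -/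
def MomentSystemAt {M : ℕ} (Q : (Momentum → ℝ) → Momentum → ℝ)
    (W : (Fin 4 → ℝ) → MomentIndex M → ℝ) (x : Fin 4 → ℝ) : Prop :=
  ∑ α : Fin 4, (momentMatrix α (W x)).mulVec (fderiv ℝ W x (Pi.single α 1))
    = momentSource Q (W x)

/-- A real square matrix is real diagonalizable. -/
def RealDiagonalizable {ι : Type} [Fintype ι] [DecidableEq ι] (A : Matrix ι ι ℝ) : Prop :=
  ∃ (R : Matrix ι ι ℝ) (ev : ι → ℝ), IsUnit R ∧ A = R * Matrix.diagonal ev * R⁻¹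

/-- `B_M(W) = (B_M^0)⁻¹ ∑ ν_i B_M^i` for a direction `ν`. -/
def directionalMatrix {M : ℕ} (ν : EuclideanSpace ℝ (Fin 3)) (W : MomentIndex M → ℝ) :
    Matrix (MomentIndex M) (MomentIndex M) ℝ :=
  (momentMatrix 0 W)⁻¹ * ∑ i : Fin 3, ν i • momentMatrix i.succ W

end

end RelMoment

/-!
The functions `g P_k^{(ℓ)}(E) (E² - 1)^{ℓ/2} Y_{ℓ,m}` are orthogonal: the boost to the rest frame
of the fluid leaves `d³p / p⁰` invariant (`integral_comp_boost`), and in the rest frame spherical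
coordinates separate the integral into the orthogonality relations of the polynomials `P_k^{(ℓ)}`
and of the spherical harmonics (`integral_solidHarmonic_mul`, `integral_basisFun_mul_basisPoly`).
Moreover `(E² - 1)^{ℓ/2} Y_{ℓ,m}` is a polynomial in the components of the four-momentum
(`solidHarmonic_eq_poly`). Every function in the argument is therefore an exponential `e^{-β p}`
times a polynomial in `p^α`, whose coefficients depend differentiably on the state, and its
moments may be differentiated under the integral sign (`distribution_hasFDerivAt`).

Equivalence of the two systems. Two functions have the same projection if and only if their inner
products with the basis agree, since the basis is linearly independent (`momentProj_eq_iff`). With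
the chain rule for `F_W`, this is `projectedEquationAt_iff`.

Hyperbolicity. One has `B^α = A^α D` (`momentMatrix_eq`), where `A^α` is the Gram matrix of the
basis for the inner product weighted by `p^α` (`fluxMatrix`), and `D` consists of the coefficients
in the basis of the projected derivatives of `F_W` (`transitionMatrix`). The matrices `A^α` are
symmetric, and `A⁰ ± ν · A` is positive definite for each unit vector `ν`, because `|ν · p| < p⁰`.
Hence `(A⁰)⁻¹ (ν · A)` is diagonalizable over the reals with eigenvalues in `(-1, 1)`
(`realDiagonalizable_and_spectralRadius_lt_one`). The matrix `(B⁰)⁻¹ (ν · B)` is conjugate to it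
by `D`, so it remains to show that `D` is invertible (`isUnit_transitionMatrix`).

Let the direction `c` be in the kernel of `D`, and write `′` for the derivative of a quantity at
`W` in the direction `c`. The derivative `F′` of `F_W` is then orthogonal to all basis functions,
so its integrals against the test functions `E` and `E p^α` of the Landau conditions vanish
(`integral_landau_mul_distributionVariation_eq_zero`; for `M = 1` the functions `E p^α` are not in
the span, but `F′` itself vanishes). The Landau conditions say that `T^{αβ} U_β = e U^α` and that
the particle density and the energy density `e` are those of the local equilibrium.
Differentiating them gives `T^{αβ} U′_β = e′ U^α + e U′^α`. Since `U′` is orthogonal to `U`,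
contraction with `U′` shows that the quadratic form of `T` at `U′_β` is `e` times the Minkowski
square of `U′`, which is nonpositive as `U′` is spacelike. Positive definiteness of `T` makes
`U′` vanish, and then neither density varies. The two densities determine `n` and `θ` locally, by
the strict Cauchy-Schwarz inequality `weightIntegral_sq_lt`, hence `n′ = θ′ = 0`
(`equilibrium_variation_eq_zero`). What is left of the derivative of `F_W` is a combination of
basis functions whose coefficients vanish only if the remaining entries of `c` do, and linear
independence of the basis gives `c = 0`.
-/

namespace RelMoment
noncomputable section

/-! ### Symmetric definite pencils -/

section Pencil

variable {ι : Type} [Fintype ι] [DecidableEq ι]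

/-- A matrix that is diagonalized by `R` with eigenvalues in `(-1, 1)` has complex spectral radius
less than one. -/
lemma spectralRadius_lt_one_of_diagonalized {R : Matrix ι ι ℝ} (hR : IsUnit R) {ev : ι → ℝ}
    (hev : ∀ i, |ev i| < 1) :
    spectralRadius ℂ ((R * Matrix.diagonal ev * R⁻¹).map Complex.ofReal) < 1 := by
  have hdet := (Matrix.isUnit_iff_isUnit_det R).1 hR
  set RC : Matrix ι ι ℂ := R.map Complex.ofReal with hRC
  set RI : Matrix ι ι ℂ := (R⁻¹).map Complex.ofReal with hRI
  have h1 : RC * RI = 1 := by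
    have := congrArg (fun X : Matrix ι ι ℝ => X.map Complex.ofRealHom)
      (Matrix.mul_nonsing_inv R hdet)
    simp only [Matrix.map_mul, Matrix.map_one Complex.ofRealHom (map_zero _) (map_one _)] at this
    exact this
  have h2 : RI * RC = 1 := by
    have := congrArg (fun X : Matrix ι ι ℝ => X.map Complex.ofRealHom)
      (Matrix.nonsing_inv_mul R hdet)
    simp only [Matrix.map_mul, Matrix.map_one Complex.ofRealHom (map_zero _) (map_one _)] at this
    exact this
  let u : (Matrix ι ι ℂ)ˣ := ⟨RC, RI, h1, h2⟩
  have h3 : (R * Matrix.diagonal ev * R⁻¹).map Complex.ofReal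
      = (u : Matrix ι ι ℂ) * Matrix.diagonal (fun i => (ev i : ℂ))
        * ((u⁻¹ : (Matrix ι ι ℂ)ˣ) : Matrix ι ι ℂ) := by
    have e1 : (R * Matrix.diagonal ev * R⁻¹).map Complex.ofReal
      = (R * Matrix.diagonal ev * R⁻¹).map Complex.ofRealHom := rfl
    rw [e1, Matrix.map_mul, Matrix.map_mul, Matrix.diagonal_map (map_zero _)]
    rfl
  have hspec : spectrum ℂ ((R * Matrix.diagonal ev * R⁻¹).map Complex.ofReal)
      = Set.range (fun i => (ev i : ℂ)) := by
    rw [h3, spectrum.units_conjugate, spectrum_diagonal]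
  unfold spectralRadius
  rw [hspec]
  rw [iSup_range]
  have h4 : ∀ i, (‖(ev i : ℂ)‖₊ : ENNReal) < 1 := by
    intro i
    rw [← ENNReal.coe_one, ENNReal.coe_lt_coe, ← NNReal.coe_lt_coe]
    simpa using hev i
  by_cases hne : Nonempty ι
  · obtain ⟨i, hi⟩ := Finite.exists_max (fun i => (‖(ev i : ℂ)‖₊ : ENNReal))
    exact lt_of_le_of_lt (iSup_le hi) (h4 i)
  · rw [not_nonempty_iff] at hne
    simp

open scoped MatrixOrder Matrix.Norms.L2Operator in
/-- For a positive definite `A` and a symmetric `S` with `-A < S < A`, the matrix `A⁻¹ S` and all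
matrices similar to it are real diagonalizable, with eigenvalues of modulus less than one. -/
lemma realDiagonalizable_and_spectralRadius_lt_one {A S D : Matrix ι ι ℝ} (hA : A.PosDef)
    (hS : S.IsHermitian) (hadd : (A + S).PosDef) (hsub : (A - S).PosDef) (hD : IsUnit D) :
    RealDiagonalizable ((A * D)⁻¹ * (S * D)) ∧
      spectralRadius ℂ (((A * D)⁻¹ * (S * D)).map Complex.ofReal) < 1 := by
  obtain ⟨T, hAT⟩ := CStarAlgebra.nonneg_iff_eq_star_mul_self.mp hA.posSemidef.nonneg
  rw [Matrix.star_eq_conjTranspose] at hAT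
  have hT : IsUnit T := by
    have := hA.isUnit
    rw [hAT, Matrix.isUnit_iff_isUnit_det, Matrix.det_mul] at this
    exact (Matrix.isUnit_iff_isUnit_det T).2 (isUnit_of_mul_isUnit_right this)
  have hTd := (Matrix.isUnit_iff_isUnit_det T).1 hT
  have hDd := (Matrix.isUnit_iff_isUnit_det D).1 hD
  have hTTi : T * T⁻¹ = 1 := Matrix.mul_nonsing_inv T hTd
  have hTiT : T⁻¹ * T = 1 := Matrix.nonsing_inv_mul T hTd
  have hTinj : Function.Injective (T⁻¹).mulVec := by
    apply Matrix.mulVec_injective_iff_isUnit.2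
    exact (Matrix.isUnit_nonsing_inv_iff).2 hT
  have hTh : (T⁻¹).conjTranspose * T.conjTranspose = 1 := by
    rw [← Matrix.conjTranspose_mul, hTTi, Matrix.conjTranspose_one]
  have hTh' : T.conjTranspose * (T⁻¹).conjTranspose = 1 := by
    rw [← Matrix.conjTranspose_mul, hTiT, Matrix.conjTranspose_one]
  set C := (T⁻¹).conjTranspose * S * T⁻¹ with hC
  have hCh : C.IsHermitian := Matrix.isHermitian_conjTranspose_mul_mul _ hS
  have hAC : (T⁻¹).conjTranspose * A * T⁻¹ = 1 := by
    rw [hAT, ← Matrix.mul_assoc, hTh, Matrix.one_mul, hTTi]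
  have hp1 : (1 + C).PosDef := by
    have := hadd.conjTranspose_mul_mul_same hTinj
    rwa [Matrix.mul_add, Matrix.add_mul, hAC] at this
  have hp2 : (1 - C).PosDef := by
    have := hsub.conjTranspose_mul_mul_same hTinj
    rwa [Matrix.mul_sub, Matrix.sub_mul, hAC] at this
  set V : Matrix ι ι ℝ := (hCh.eigenvectorUnitary : Matrix ι ι ℝ) with hV
  have hVV : V * star V = 1 := Unitary.mul_star_self_of_mem hCh.eigenvectorUnitary.2
  have hVV' : star V * V = 1 := Unitary.star_mul_self_of_mem hCh.eigenvectorUnitary.2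
  have hspec : C = V * Matrix.diagonal hCh.eigenvalues * star V := by
    have := hCh.spectral_theorem
    rw [Unitary.conjStarAlgAut_apply] at this
    exact this
  have hev : ∀ i, |hCh.eigenvalues i| < 1 := by
    intro i
    set v : ι → ℝ := (hCh.eigenvectorBasis i : EuclideanSpace ℝ ι).ofLp with hv
    have hmul : C.mulVec v = hCh.eigenvalues i • v := hCh.mulVec_eigenvectorBasis i
    have hv0 : v ≠ 0 := by
      intro h0
      have h1 := hCh.eigenvectorBasis.orthonormal.ne_zero i
      apply h1
      ext j
      exact congrFun h0 j
    have hvv : 0 < dotProduct v v := by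
      have := Matrix.dotProduct_star_self_pos_iff.2 hv0
      simpa using this
    have q1 := hp1.dotProduct_mulVec_pos hv0
    have q2 := hp2.dotProduct_mulVec_pos hv0
    simp only [Matrix.add_mulVec, Matrix.sub_mulVec, Matrix.one_mulVec, hmul, dotProduct_add,
      dotProduct_sub, dotProduct_smul, star_trivial, smul_eq_mul] at q1 q2
    rw [abs_lt]
    constructor <;> nlinarith
  have hRu : IsUnit (D⁻¹ * T⁻¹ * V) := by
    apply IsUnit.mul
    · exact ((Matrix.isUnit_nonsing_inv_iff).2 hD).mul ((Matrix.isUnit_nonsing_inv_iff).2 hT)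
    · exact (Matrix.isUnit_iff_isUnit_det V).2 (Matrix.isUnit_det_of_left_inverse hVV')
  have hRinv : (D⁻¹ * T⁻¹ * V)⁻¹ = star V * T * D := by
    apply Matrix.inv_eq_left_inv
    calc star V * T * D * (D⁻¹ * T⁻¹ * V) = star V * (T * (D * D⁻¹) * T⁻¹) * V := by
          simp only [Matrix.mul_assoc]
      _ = 1 := by rw [Matrix.mul_nonsing_inv D hDd, Matrix.mul_one, hTTi, Matrix.mul_one, hVV']
  have hAinv : A⁻¹ = T⁻¹ * (T⁻¹).conjTranspose := by
    apply Matrix.inv_eq_left_inv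
    rw [hAT, Matrix.mul_assoc, ← Matrix.mul_assoc _ _ T, hTh, Matrix.one_mul, hTiT]
  have hmain : (A * D)⁻¹ * (S * D)
      = (D⁻¹ * T⁻¹ * V) * Matrix.diagonal hCh.eigenvalues * (D⁻¹ * T⁻¹ * V)⁻¹ := by
    rw [hRinv, Matrix.mul_inv_rev, hAinv]
    calc D⁻¹ * (T⁻¹ * (T⁻¹).conjTranspose) * (S * D)
        = D⁻¹ * T⁻¹ * ((T⁻¹).conjTranspose * S * (T⁻¹ * T)) * D := by
          rw [hTiT]; simp only [Matrix.mul_assoc, Matrix.mul_one]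
      _ = D⁻¹ * T⁻¹ * C * T * D := by rw [hC]; simp only [Matrix.mul_assoc]
      _ = D⁻¹ * T⁻¹ * (V * Matrix.diagonal hCh.eigenvalues * star V) * T * D := by rw [← hspec]
      _ = _ := by simp only [Matrix.mul_assoc]
  rw [hmain]
  exact ⟨⟨_, _, hRu, rfl⟩, spectralRadius_lt_one_of_diagonalized hRu hev⟩

end Pencil

/-! ### Differentiation under the integral sign for exponential integrals -/

section ExpIntegral

variable {α V : Type*} [MeasurableSpace α] [NormedAddCommGroup V] [NormedSpace ℝ V]

lemma le_inv_mul_exp {c : ℝ} (hc : 0 < c) (x : ℝ) : x ≤ c⁻¹ * Real.exp (c * x) := by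
  have h := Real.add_one_le_exp (c * x)
  rw [inv_mul_eq_div, le_div_iff₀ hc]
  linarith

/-- Integrals `∫ f e^{-L β}` of exponentials with linear exponent are differentiable with respect
to `β`, if the exponent dominates a function `X` that controls the size of `L`. -/
lemma hasFDerivAt_integral_mul_exp_neg {ν : Measure α} {f X : α → ℝ} {L : α → V →L[ℝ] ℝ} {β : V}
    {c : ℝ} (hc : 0 < c) (hf : AEStronglyMeasurable f ν) (hL : AEStronglyMeasurable L ν)
    (hX : ∀ᵐ a ∂ν, 0 ≤ X a) (hLX : ∀ᵐ a ∂ν, ‖L a‖ ≤ X a) (hβ : ∀ᵐ a ∂ν, c * X a ≤ L a β)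
    (hint : ∀ ε : ℝ, 0 < ε → Integrable (fun a => f a * Real.exp (-(ε * X a))) ν) :
    HasFDerivAt (fun b => ∫ a, f a * Real.exp (-(L a b)) ∂ν)
      (∫ a, (-(f a * Real.exp (-(L a β)))) • L a ∂ν) β := by
  have hLb : ∀ b : V, AEStronglyMeasurable (fun a => L a b) ν := fun b =>
    (ContinuousLinearMap.apply ℝ ℝ b).continuous.comp_aestronglyMeasurable hL
  have hFm : ∀ b : V, AEStronglyMeasurable (fun a => f a * Real.exp (-(L a b))) ν := fun b =>
    hf.mul (Real.continuous_exp.comp_aestronglyMeasurable (hLb b).neg)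
  refine hasFDerivAt_integral_of_dominated_of_fderiv_le (s := Metric.ball β (c / 2))
    (bound := fun a => (c / 4)⁻¹ * ‖f a * Real.exp (-(c / 4 * X a))‖)
    (F' := fun b a => (-(f a * Real.exp (-(L a b)))) • L a)
    (Metric.ball_mem_nhds β (by positivity)) (Filter.Eventually.of_forall hFm) ?_
    ((hFm β).neg.smul hL) ?_ ?_ ?_
  · refine (hint c hc).mono (hFm β) ?_
    filter_upwards [hβ] with a ha
    rw [norm_mul, norm_mul]
    gcongr
    rw [Real.norm_of_nonneg (Real.exp_pos _).le, Real.norm_of_nonneg (Real.exp_pos _).le]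
    gcongr
  · filter_upwards [hβ, hLX, hX] with a ha hla hxa b hb
    have h1 : L a b ≥ c / 2 * X a := by
      have h2 : ‖L a (β - b)‖ ≤ X a * (c / 2) := by
        refine ((L a).le_opNorm _).trans ?_
        gcongr
        rw [← dist_eq_norm, dist_comm]
        exact (Metric.mem_ball.1 hb).le
      rw [map_sub, Real.norm_eq_abs] at h2
      have := (abs_le.1 h2).2
      linarith
    have h3 := le_inv_mul_exp (c := c / 4) (by positivity) (X a)
    rw [norm_smul, norm_neg, norm_mul, norm_mul, Real.norm_of_nonneg (Real.exp_pos _).le,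
      Real.norm_of_nonneg (Real.exp_pos _).le]
    calc ‖f a‖ * Real.exp (-(L a b)) * ‖L a‖
        ≤ ‖f a‖ * Real.exp (-(c / 2 * X a)) * ((c / 4)⁻¹ * Real.exp (c / 4 * X a)) := by
          gcongr
          exact hla.trans h3
      _ = (c / 4)⁻¹ * (‖f a‖ * (Real.exp (-(c / 2 * X a)) * Real.exp (c / 4 * X a))) := by ring
      _ = (c / 4)⁻¹ * (‖f a‖ * Real.exp (-(c / 4 * X a))) := by
          rw [← Real.exp_add]; congr 3; ring_nf
  · exact (hint (c / 4) (by positivity)).norm.const_mul _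
  · filter_upwards with a b _
    have h1 : HasFDerivAt (fun b => -(L a b)) (-(L a)) b := (L a).hasFDerivAt.neg
    have h2 := (h1.exp).const_mul (f a)
    refine h2.congr_fderiv ?_
    ext v
    simp [mul_assoc]

/-- One-parameter version of `hasFDerivAt_integral_mul_exp_neg`. -/
lemma hasDerivAt_integral_mul_exp_neg {ν : Measure α} {f X : α → ℝ} {ζ : ℝ} (hζ : 0 < ζ)
    (hf : AEStronglyMeasurable f ν) (hXm : AEStronglyMeasurable X ν) (hX : ∀ᵐ a ∂ν, 0 ≤ X a)
    (hint : ∀ ε : ℝ, 0 < ε → Integrable (fun a => f a * Real.exp (-(ε * X a))) ν) :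
    HasDerivAt (fun z => ∫ a, f a * Real.exp (-(z * X a)) ∂ν)
      (-∫ a, X a * f a * Real.exp (-(ζ * X a)) ∂ν) ζ := by
  have hL : AEStronglyMeasurable (fun a => X a • ContinuousLinearMap.id ℝ ℝ) ν :=
    hXm.smul_const _
  have h := hasFDerivAt_integral_mul_exp_neg (L := fun a => X a • ContinuousLinearMap.id ℝ ℝ)
    (β := ζ) hζ hf hL hX (by
      filter_upwards [hX] with a ha
      rw [norm_smul, Real.norm_of_nonneg ha]
      simp) (by
      filter_upwards with a
      simp [mul_comm]) hint
  have h2 := h.hasDerivAt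
  have e1 : ∀ z a, ((X a • ContinuousLinearMap.id ℝ ℝ) z : ℝ) = z * X a := by
    intro z a; simp [mul_comm]
  simp only [e1] at h2
  convert h2 using 1
  have e2 : (∫ a, (-(f a * Real.exp (-(ζ * X a)))) • X a • ContinuousLinearMap.id ℝ ℝ ∂ν)
      = (∫ a, -(X a * f a * Real.exp (-(ζ * X a))) ∂ν) • ContinuousLinearMap.id ℝ ℝ := by
    refine Eq.trans (integral_congr_ae (Filter.Eventually.of_forall fun a => ?_))
      (integral_smul_const (fun a => -(X a * f a * Real.exp (-(ζ * X a))))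
        (ContinuousLinearMap.id ℝ ℝ))
    ext
    simp
    ring
  rw [e2, integral_neg]
  simp

end ExpIntegral

/-! ### The Bessel function and the moments of the weights -/

lemma integrableOn_cosh_mul_exp {ν : ℕ} {ζ : ℝ} (hζ : 0 < ζ) :
    IntegrableOn (fun t => Real.cosh (ν * t) * Real.exp (-(ζ * Real.cosh t))) (Set.Ioi 0) := by
  have h1 : Integrable
      (fun t : ℝ => Real.exp (2 * (ν : ℝ) ^ 2 / ζ) * Real.exp (-(ζ / 8) * t ^ 2)) :=
    (integrable_exp_neg_mul_sq (by positivity)).const_mul _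
  refine h1.integrableOn.mono' (by fun_prop) ?_
  refine (ae_restrict_iff' measurableSet_Ioi).2 (Filter.Eventually.of_forall fun t ht => ?_)
  have ht : 0 < t := ht
  rw [Real.norm_of_nonneg (by positivity), ← Real.exp_add]
  have h2 : Real.cosh (ν * t) ≤ Real.exp (ν * t) := by
    rw [Real.cosh_eq]
    have : Real.exp (-(ν * t)) ≤ Real.exp (ν * t) := by
      apply Real.exp_le_exp.2
      have : 0 ≤ (ν : ℝ) * t := by positivity
      linarith
    linarith
  have h3 : t ^ 2 / 4 ≤ Real.cosh t := by
    rw [Real.cosh_eq]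
    linarith [Real.quadratic_le_exp_of_nonneg ht.le, Real.exp_pos (-t)]
  calc Real.cosh (ν * t) * Real.exp (-(ζ * Real.cosh t))
      ≤ Real.exp (ν * t) * Real.exp (-(ζ * Real.cosh t)) := by gcongr
    _ = Real.exp (ν * t - ζ * Real.cosh t) := by rw [← Real.exp_add]; ring_nf
    _ ≤ _ := by
      apply Real.exp_le_exp.2
      have h4 : (ν : ℝ) * t ≤ 2 * ν ^ 2 / ζ + ζ / 8 * t ^ 2 := by
        have h5 : 0 ≤ 2 * (ν - ζ * t / 4) ^ 2 / ζ := by positivity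
        have h6 : 2 * (ν - ζ * t / 4) ^ 2 / ζ = 2 * ν ^ 2 / ζ + ζ / 8 * t ^ 2 - ν * t := by
          field_simp
          ring
        linarith
      nlinarith [mul_le_mul_of_nonneg_left h3 hζ.le]

lemma besselK_pos (ν : ℕ) {ζ : ℝ} (hζ : 0 < ζ) : 0 < besselK ν ζ := by
  unfold besselK
  rw [setIntegral_pos_iff_support_of_nonneg_ae]
  · have : Function.support (fun t => Real.cosh (ν * t) * Real.exp (-ζ * Real.cosh t))
        = Set.univ := by
      ext t
      simp [Real.cosh_pos _ |>.ne']
    rw [this]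
    simp
  · exact Filter.Eventually.of_forall fun t => by simp only [Pi.zero_apply]; positivity
  · simpa only [neg_mul] using integrableOn_cosh_mul_exp hζ

lemma differentiableAt_besselK (ν : ℕ) {ζ : ℝ} (hζ : 0 < ζ) :
    DifferentiableAt ℝ (besselK ν) ζ := by
  have := hasDerivAt_integral_mul_exp_neg (ν := volume.restrict (Set.Ioi (0 : ℝ)))
    (f := fun t => Real.cosh (ν * t)) (X := Real.cosh) hζ (by fun_prop) (by fun_prop)
    (Filter.Eventually.of_forall fun t => (Real.cosh_pos t).le)
    (fun ε hε => integrableOn_cosh_mul_exp hε)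
  have h2 : besselK ν = fun z => ∫ t in Set.Ioi (0 : ℝ), Real.cosh (ν * t)
      * Real.exp (-(z * Real.cosh t)) := by
    ext z
    simp only [besselK, neg_mul]
  rw [h2]
  exact this.differentiableAt

/-- The integral of a polynomial over `[1, ∞)` against the weight `(x² - 1)^{ℓ + 1/2} e^{-ζ x}`,
that is, against `polyWeight` without its normalisation. -/
def weightIntegral (ℓ : ℕ) (ζ : ℝ) (P : ℝ[X]) : ℝ :=
  ∫ x in Set.Ioi (1 : ℝ), P.eval x * (x ^ 2 - 1) ^ ((ℓ : ℝ) + 1 / 2) * Real.exp (-(ζ * x))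

lemma integrableOn_pow_mul_weight (ℓ n : ℕ) {ζ : ℝ} (hζ : 0 < ζ) :
    IntegrableOn (fun x : ℝ => x ^ n * (x ^ 2 - 1) ^ ((ℓ : ℝ) + 1 / 2) * Real.exp (-(ζ * x)))
      (Set.Ioi 1) := by
  have h1 : IntegrableOn (fun x : ℝ => x ^ ((n + 2 * ℓ + 1 : ℕ) : ℝ) * Real.exp (-ζ * x))
      (Set.Ioi 0) := by
    have := integrableOn_rpow_mul_exp_neg_mul_rpow (p := 1)
      (s := ((n + 2 * ℓ + 1 : ℕ) : ℝ)) (b := ζ)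
      (by have : (0 : ℝ) ≤ ((n + 2 * ℓ + 1 : ℕ) : ℝ) := by positivity
          linarith) zero_lt_one hζ
    simpa only [Real.rpow_one] using this
  refine (h1.mono_set (Set.Ioi_subset_Ioi zero_le_one)).mono' (by fun_prop) ?_
  refine (ae_restrict_iff' measurableSet_Ioi).2 (Filter.Eventually.of_forall fun x hx => ?_)
  have hx : 1 < x := hx
  have h0 : 0 ≤ x ^ 2 - 1 := by nlinarith
  rw [Real.norm_of_nonneg (by positivity), neg_mul, Real.rpow_natCast]
  gcongr
  have h2 : (x ^ 2 - 1) ^ ((ℓ : ℝ) + 1 / 2) ≤ x ^ (2 * ℓ + 1) := by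
    calc (x ^ 2 - 1) ^ ((ℓ : ℝ) + 1 / 2) ≤ (x ^ 2) ^ ((ℓ : ℝ) + 1 / 2) := by
          apply Real.rpow_le_rpow h0 (by linarith) (by positivity)
      _ = x ^ (2 * ℓ + 1) := by
          rw [← Real.rpow_natCast x 2, ← Real.rpow_mul (by positivity), ← Real.rpow_natCast]
          congr 1
          push_cast
          ring
  calc x ^ n * (x ^ 2 - 1) ^ ((ℓ : ℝ) + 1 / 2) ≤ x ^ n * x ^ (2 * ℓ + 1) := by gcongr
    _ = x ^ (n + 2 * ℓ + 1) := by ring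

lemma integrableOn_eval_mul_weight (ℓ : ℕ) {ζ : ℝ} (hζ : 0 < ζ) (P : ℝ[X]) :
    IntegrableOn (fun x : ℝ => P.eval x * (x ^ 2 - 1) ^ ((ℓ : ℝ) + 1 / 2) * Real.exp (-(ζ * x)))
      (Set.Ioi 1) := by
  induction P using Polynomial.induction_on' with
  | add P Q hP hQ =>
    refine (hP.add hQ).congr (Filter.Eventually.of_forall fun x => ?_)
    simp
    ring
  | monomial n a =>
    refine ((integrableOn_pow_mul_weight ℓ n hζ).const_mul a).congr
      (Filter.Eventually.of_forall fun x => ?_)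
    simp
    ring

lemma weightIntegral_add (ℓ : ℕ) {ζ : ℝ} (hζ : 0 < ζ) (P Q : ℝ[X]) :
    weightIntegral ℓ ζ (P + Q) = weightIntegral ℓ ζ P + weightIntegral ℓ ζ Q := by
  unfold weightIntegral
  rw [← integral_add (integrableOn_eval_mul_weight ℓ hζ P) (integrableOn_eval_mul_weight ℓ hζ Q)]
  congr 1
  ext x
  simp
  ring

lemma weightIntegral_C_mul (ℓ : ℕ) (ζ a : ℝ) (P : ℝ[X]) :
    weightIntegral ℓ ζ (C a * P) = a * weightIntegral ℓ ζ P := by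
  unfold weightIntegral
  rw [← integral_const_mul]
  congr 1
  ext x
  simp
  ring

lemma weightIntegral_sum (ℓ : ℕ) {ζ : ℝ} (hζ : 0 < ζ) {ι : Type*} (s : Finset ι) (P : ι → ℝ[X]) :
    weightIntegral ℓ ζ (∑ i ∈ s, P i) = ∑ i ∈ s, weightIntegral ℓ ζ (P i) := by
  classical
  induction s using Finset.induction_on with
  | empty => simp [weightIntegral]
  | insert i s his ih => rw [Finset.sum_insert his, Finset.sum_insert his,
      weightIntegral_add ℓ hζ, ih]

lemma weightIntegral_pos (ℓ : ℕ) {ζ : ℝ} (hζ : 0 < ζ) {P : ℝ[X]} (hP : P ≠ 0)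
    (hP0 : ∀ x, 1 < x → 0 ≤ P.eval x) : 0 < weightIntegral ℓ ζ P := by
  unfold weightIntegral
  rw [setIntegral_pos_iff_support_of_nonneg_ae]
  · have hsub : Set.Ioi (1 : ℝ) \ (P.roots.toFinset : Set ℝ) ⊆ Function.support (fun x : ℝ =>
        P.eval x * (x ^ 2 - 1) ^ ((ℓ : ℝ) + 1 / 2) * Real.exp (-(ζ * x))) ∩ Set.Ioi 1 := by
      rintro x ⟨hx, hxr⟩
      have hx : 1 < x := hx
      refine ⟨?_, hx⟩
      have h1 : P.eval x ≠ 0 := by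
        intro h
        apply hxr
        simp [hP, h]
      have h2 : 0 < (x ^ 2 - 1) ^ ((ℓ : ℝ) + 1 / 2) := by
        apply Real.rpow_pos_of_pos
        nlinarith
      exact mul_ne_zero (mul_ne_zero h1 h2.ne') (Real.exp_pos _).ne'
    refine lt_of_lt_of_le ?_ (measure_mono hsub)
    rw [measure_sdiff_null (Finset.measure_zero _ _)]
    simp
  · refine (ae_restrict_iff' measurableSet_Ioi).2 (Filter.Eventually.of_forall fun x hx => ?_)
    have hx : 1 < x := hx
    have h1 := hP0 x hx
    have h0 : 0 ≤ x ^ 2 - 1 := by nlinarith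
    simp only [Pi.zero_apply]
    positivity
  · exact integrableOn_eval_mul_weight ℓ hζ P

lemma hasDerivAt_weightIntegral_X_pow (ℓ n : ℕ) {ζ : ℝ} (hζ : 0 < ζ) :
    HasDerivAt (fun z => weightIntegral ℓ z (X ^ n)) (-weightIntegral ℓ ζ (X ^ (n + 1))) ζ := by
  have := hasDerivAt_integral_mul_exp_neg (ν := volume.restrict (Set.Ioi (1 : ℝ)))
    (f := fun x => x ^ n * (x ^ 2 - 1) ^ ((ℓ : ℝ) + 1 / 2)) (X := id) hζ (by fun_prop)
    (by fun_prop)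
    ((ae_restrict_iff' measurableSet_Ioi).2 (Filter.Eventually.of_forall fun t ht =>
      zero_le_one.trans (le_of_lt ht)))
    (fun ε hε => integrableOn_pow_mul_weight ℓ n hε)
  convert this using 1
  · ext z
    simp [weightIntegral]
  · simp only [weightIntegral, eval_pow, eval_X, id]
    congr 2
    ext x
    ring

/-- The strict Cauchy-Schwarz inequality for the moments of orders one, two and three: it makes the
energy per particle a strictly monotone function of the temperature. -/
lemma weightIntegral_sq_lt {ζ : ℝ} (hζ : 0 < ζ) :
    weightIntegral 0 ζ (X ^ 2) ^ 2 < weightIntegral 0 ζ (X ^ 1) * weightIntegral 0 ζ (X ^ 3) := by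
  set a := weightIntegral 0 ζ (X ^ 1) with ha
  set b := weightIntegral 0 ζ (X ^ 2) with hb
  have ha0 : 0 < a := weightIntegral_pos 0 hζ (pow_ne_zero _ X_ne_zero) (by
    intro x hx; simp; linarith)
  have h1 : 0 < weightIntegral 0 ζ (X * (C a * X - C b) ^ 2) := by
    apply weightIntegral_pos 0 hζ
    · refine mul_ne_zero X_ne_zero (pow_ne_zero _ ?_)
      intro h
      have := congrArg (fun P : ℝ[X] => P.coeff 1) h
      simp [coeff_C] at this
      exact ha0.ne' this
    · intro x hx
      simp only [eval_mul, eval_X, eval_pow]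
      positivity
  have h2 : X * (C a * X - C b) ^ 2
      = C (a ^ 2) * X ^ 3 + (C (-(2 * a * b)) * X ^ 2 + C (b ^ 2) * X ^ 1 : ℝ[X]) := by
    simp only [map_mul, map_neg, map_pow]
    have : (C 2 : ℝ[X]) = 2 := rfl
    rw [this]
    ring
  rw [h2, weightIntegral_add 0 hζ, weightIntegral_add 0 hζ, weightIntegral_C_mul,
    weightIntegral_C_mul, weightIntegral_C_mul, ← ha, ← hb] at h1
  have h3 : 0 < a * (a * weightIntegral 0 ζ (X ^ 3) - b ^ 2) := by nlinarith
  have h4 := pos_of_mul_pos_right h3 ha0.le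
  linarith

/-! ### Orthonormal polynomials -/

/-- The normalisation `ζ / ((2ℓ + 1) K_2(ζ))` of the weights. -/
def weightConst (ℓ : ℕ) (ζ : ℝ) : ℝ := ζ / ((2 * ℓ + 1) * besselK 2 ζ)

lemma weightConst_pos (ℓ : ℕ) {ζ : ℝ} (hζ : 0 < ζ) : 0 < weightConst ℓ ζ := by
  have := besselK_pos 2 hζ
  unfold weightConst
  positivity

lemma differentiableAt_weightConst (ℓ : ℕ) {ζ : ℝ} (hζ : 0 < ζ) :
    DifferentiableAt ℝ (weightConst ℓ) ζ := by
  have := besselK_pos 2 hζ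
  have h2 := differentiableAt_besselK 2 hζ
  unfold weightConst
  exact differentiableAt_id.div (h2.const_mul _) (by positivity)

lemma polyInner_eq (ℓ : ℕ) (ζ : ℝ) (P Q : ℝ[X]) :
    polyInner ℓ ζ P Q = weightConst ℓ ζ * weightIntegral ℓ ζ (P * Q) := by
  unfold polyInner weightConst weightIntegral polyWeight
  rw [← integral_const_mul]
  congr 1
  ext x
  rw [eval_mul, neg_mul]
  ring

lemma polyInner_comm (ℓ : ℕ) (ζ : ℝ) (P Q : ℝ[X]) : polyInner ℓ ζ P Q = polyInner ℓ ζ Q P := by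
  rw [polyInner_eq, polyInner_eq, mul_comm P]

lemma polyInner_add_left (ℓ : ℕ) {ζ : ℝ} (hζ : 0 < ζ) (P Q R : ℝ[X]) :
    polyInner ℓ ζ (P + Q) R = polyInner ℓ ζ P R + polyInner ℓ ζ Q R := by
  simp only [polyInner_eq, add_mul, weightIntegral_add ℓ hζ, mul_add]

lemma polyInner_C_mul_left (ℓ : ℕ) (ζ a : ℝ) (P R : ℝ[X]) :
    polyInner ℓ ζ (C a * P) R = a * polyInner ℓ ζ P R := by
  simp only [polyInner_eq, mul_assoc, weightIntegral_C_mul]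
  ring

lemma polyInner_C_mul_right (ℓ : ℕ) (ζ a : ℝ) (P R : ℝ[X]) :
    polyInner ℓ ζ P (C a * R) = a * polyInner ℓ ζ P R := by
  rw [polyInner_comm, polyInner_C_mul_left, polyInner_comm]

lemma polyInner_sum_left (ℓ : ℕ) {ζ : ℝ} (hζ : 0 < ζ) {ι : Type*} (s : Finset ι) (P : ι → ℝ[X])
    (R : ℝ[X]) : polyInner ℓ ζ (∑ i ∈ s, P i) R = ∑ i ∈ s, polyInner ℓ ζ (P i) R := by
  simp only [polyInner_eq, Finset.sum_mul, weightIntegral_sum ℓ hζ, Finset.mul_sum]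

lemma polyInner_self_pos (ℓ : ℕ) {ζ : ℝ} (hζ : 0 < ζ) {P : ℝ[X]} (hP : P ≠ 0) :
    0 < polyInner ℓ ζ P P := by
  rw [polyInner_eq]
  refine mul_pos (weightConst_pos ℓ hζ) (weightIntegral_pos ℓ hζ (mul_ne_zero hP hP) ?_)
  intro x _
  rw [eval_mul]
  exact mul_self_nonneg _

lemma monicOrthPoly_monic_natDegree (ℓ : ℕ) (ζ : ℝ) (k : ℕ) :
    (monicOrthPoly ℓ ζ k).Monic ∧ (monicOrthPoly ℓ ζ k).natDegree = k := by
  induction k using Nat.strong_induction_on with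
  | _ k ih =>
    rw [monicOrthPoly]
    set S := ∑ j : Fin k, C (polyInner ℓ ζ (X ^ k) (monicOrthPoly ℓ ζ j)
      / polyInner ℓ ζ (monicOrthPoly ℓ ζ j) (monicOrthPoly ℓ ζ j)) * monicOrthPoly ℓ ζ j with hS
    have hdeg : S.degree < k := by
      refine lt_of_le_of_lt (degree_sum_le _ _) ?_
      refine (Finset.sup_lt_iff (WithBot.bot_lt_coe k)).2 ?_
      intro j _
      refine lt_of_le_of_lt degree_le_natDegree ?_
      refine lt_of_le_of_lt (Nat.cast_le.2 (natDegree_C_mul_le _ _)) ?_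
      rw [(ih j j.2).2]
      exact WithBot.coe_lt_coe.2 j.2
    have h1 : (X ^ k - S).Monic := monic_X_pow_sub hdeg
    refine ⟨h1, ?_⟩
    rw [natDegree_eq_of_degree_eq_some]
    rw [degree_sub_eq_left_of_degree_lt] <;> simp [hdeg]

lemma monicOrthPoly_ne_zero (ℓ : ℕ) (ζ : ℝ) (k : ℕ) : monicOrthPoly ℓ ζ k ≠ 0 :=
  (monicOrthPoly_monic_natDegree ℓ ζ k).1.ne_zero

lemma polyInner_monicOrthPoly_of_lt (ℓ : ℕ) {ζ : ℝ} (hζ : 0 < ζ) {j k : ℕ} (hjk : j < k) :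
    polyInner ℓ ζ (monicOrthPoly ℓ ζ k) (monicOrthPoly ℓ ζ j) = 0 := by
  induction k using Nat.strong_induction_on generalizing j with
  | _ k ih =>
    rw [monicOrthPoly, sub_eq_add_neg, polyInner_add_left ℓ hζ, neg_eq_neg_one_mul,
      show (-1 : ℝ[X]) = C (-1) by simp, polyInner_C_mul_left, polyInner_sum_left ℓ hζ,
      Finset.sum_eq_single (⟨j, hjk⟩ : Fin k)]
    · rw [polyInner_C_mul_left]
      have := (polyInner_self_pos ℓ hζ (monicOrthPoly_ne_zero ℓ ζ j)).ne'
      field_simp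
      ring
    · intro i _ hij
      rw [polyInner_C_mul_left]
      have hne : (i : ℕ) ≠ j := fun h => hij (Fin.ext h)
      rcases lt_or_gt_of_ne hne with h | h
      · rw [polyInner_comm ℓ ζ (monicOrthPoly ℓ ζ i) (monicOrthPoly ℓ ζ j), ih j hjk h, mul_zero]
      · rw [ih i i.2 h, mul_zero]
    · simp

lemma orthPoly_const_pos (ℓ : ℕ) {ζ : ℝ} (hζ : 0 < ζ) (k : ℕ) :
    0 < 1 / √(polyInner ℓ ζ (monicOrthPoly ℓ ζ k) (monicOrthPoly ℓ ζ k)) := by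
  have := polyInner_self_pos ℓ hζ (monicOrthPoly_ne_zero ℓ ζ k)
  positivity

lemma orthPoly_natDegree (ℓ : ℕ) {ζ : ℝ} (hζ : 0 < ζ) (k : ℕ) :
    (orthPoly ℓ ζ k).natDegree = k := by
  unfold orthPoly
  rw [natDegree_C_mul (orthPoly_const_pos ℓ hζ k).ne', (monicOrthPoly_monic_natDegree ℓ ζ k).2]

lemma orthPoly_natDegree_le (ℓ : ℕ) (ζ : ℝ) (k : ℕ) : (orthPoly ℓ ζ k).natDegree ≤ k := by
  unfold orthPoly
  exact (natDegree_C_mul_le _ _).trans (monicOrthPoly_monic_natDegree ℓ ζ k).2.le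

lemma orthPoly_leadingCoeff_pos (ℓ : ℕ) {ζ : ℝ} (hζ : 0 < ζ) (k : ℕ) :
    0 < (orthPoly ℓ ζ k).leadingCoeff := by
  unfold orthPoly
  rw [leadingCoeff_mul, leadingCoeff_C, (monicOrthPoly_monic_natDegree ℓ ζ k).1.leadingCoeff,
    mul_one]
  exact orthPoly_const_pos ℓ hζ k

lemma orthPoly_zero_eq (ℓ : ℕ) {ζ : ℝ} (hζ : 0 < ζ) :
    orthPoly ℓ ζ 0 = C (orthPoly ℓ ζ 0).leadingCoeff := by
  have h := eq_C_of_natDegree_eq_zero (orthPoly_natDegree ℓ hζ 0)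
  conv_lhs => rw [h]
  rw [leadingCoeff, orthPoly_natDegree ℓ hζ 0]

lemma polyInner_orthPoly (ℓ : ℕ) {ζ : ℝ} (hζ : 0 < ζ) (j k : ℕ) :
    polyInner ℓ ζ (orthPoly ℓ ζ j) (orthPoly ℓ ζ k) = if j = k then 1 else 0 := by
  unfold orthPoly
  rw [polyInner_C_mul_left, polyInner_C_mul_right]
  split_ifs with h
  · subst h
    have h1 := polyInner_self_pos ℓ hζ (monicOrthPoly_ne_zero ℓ ζ j)
    have h2 := Real.mul_self_sqrt h1.le
    have h3 : √(polyInner ℓ ζ (monicOrthPoly ℓ ζ j) (monicOrthPoly ℓ ζ j)) ≠ 0 := by positivity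
    field_simp
    rw [sq, h2]
  · rcases lt_or_gt_of_ne h with h | h
    · rw [polyInner_comm ℓ ζ (monicOrthPoly ℓ ζ j) (monicOrthPoly ℓ ζ k),
        polyInner_monicOrthPoly_of_lt ℓ hζ h]; simp
    · rw [polyInner_monicOrthPoly_of_lt ℓ hζ h]; simp

/-- Expansion of a polynomial of degree less than `n` in the orthonormal polynomials. Evaluated at a
point, it is the reproducing property of the Christoffel-Darboux kernel. -/
lemma sum_polyInner_mul_orthPoly (ℓ : ℕ) {ζ : ℝ} (hζ : 0 < ζ) (n : ℕ) (P : ℝ[X])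
    (hP : P.natDegree < n) :
    ∑ k ∈ Finset.range n, C (polyInner ℓ ζ P (orthPoly ℓ ζ k)) * orthPoly ℓ ζ k = P := by
  have key : ∀ m, m ≤ n → ∀ P : ℝ[X], P.natDegree < m →
      ∑ k ∈ Finset.range n, C (polyInner ℓ ζ P (orthPoly ℓ ζ k)) * orthPoly ℓ ζ k = P := by
    intro m
    induction m with
    | zero => intro _ P hP; omega
    | succ m ih =>
      intro hm P hP
      set c := P.coeff m / (orthPoly ℓ ζ m).leadingCoeff with hc
      set Q := P - C c * orthPoly ℓ ζ m with hQ
      have hPQ : P = Q + C c * orthPoly ℓ ζ m := by rw [hQ]; ring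
      have hQs : ∑ k ∈ Finset.range n,
          C (polyInner ℓ ζ Q (orthPoly ℓ ζ k)) * orthPoly ℓ ζ k = Q := by
        have hlc := (orthPoly_leadingCoeff_pos ℓ hζ m).ne'
        have hcm : (orthPoly ℓ ζ m).coeff m = (orthPoly ℓ ζ m).leadingCoeff := by
          rw [leadingCoeff, orthPoly_natDegree ℓ hζ]
        have hcoeff : Q.coeff m = 0 := by
          rw [hQ, coeff_sub, coeff_C_mul, hcm, hc]
          field_simp
          ring
        have hdeg : Q.natDegree ≤ m := by
          rw [hQ]
          refine (natDegree_sub_le _ _).trans (max_le (by omega) ?_)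
          exact (natDegree_C_mul_le _ _).trans (orthPoly_natDegree_le ℓ ζ m)
        by_cases h0 : Q = 0
        · simp [h0, polyInner_eq, weightIntegral]
        · apply ih (by omega)
          refine lt_of_le_of_ne hdeg ?_
          intro h
          apply h0
          rw [← leadingCoeff_eq_zero, leadingCoeff, h, hcoeff]
      rw [hPQ]
      simp only [polyInner_add_left ℓ hζ, polyInner_C_mul_left, polyInner_orthPoly ℓ hζ, map_add,
        add_mul, Finset.sum_add_distrib, hQs]
      congr 1
      rw [Finset.sum_eq_single m]
      · simp
      · intro k _ hk
        simp [Ne.symm hk]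
      · intro h
        exact absurd (Finset.mem_range.2 (by omega)) h
  exact key n le_rfl P hP

lemma polyInner_X_pow_orthPoly_of_lt (ℓ : ℕ) {ζ : ℝ} (hζ : 0 < ζ) {a k : ℕ} (h : a < k) :
    polyInner ℓ ζ (X ^ a) (orthPoly ℓ ζ k) = 0 := by
  rw [← sum_polyInner_mul_orthPoly ℓ hζ (a + 1) (X ^ a) (by simp), polyInner_sum_left ℓ hζ]
  apply Finset.sum_eq_zero
  intro j hj
  rw [polyInner_C_mul_left, polyInner_orthPoly ℓ hζ, if_neg, mul_zero]
  rw [Finset.mem_range] at hj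
  omega

/-! ### Dependence of the orthonormal polynomials on the parameter -/

lemma differentiableAt_weightIntegral (ℓ : ℕ) {ζ : ℝ} (hζ : 0 < ζ) {P : ℝ → ℝ[X]} {N : ℕ}
    (hN : ∀ z, (P z).natDegree ≤ N)
    (hP : ∀ n, DifferentiableAt ℝ (fun z => (P z).coeff n) ζ) :
    DifferentiableAt ℝ (fun z => weightIntegral ℓ z (P z)) ζ := by
  have h1 : (fun z => weightIntegral ℓ z (P z)) =ᶠ[nhds ζ]
      fun z => ∑ n ∈ Finset.range (N + 1), (P z).coeff n * weightIntegral ℓ z (X ^ n) := by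
    filter_upwards [lt_mem_nhds hζ] with z hz
    conv_lhs => rw [(P z).as_sum_range_C_mul_X_pow' (Nat.lt_succ_of_le (hN z)),
      weightIntegral_sum ℓ hz]
    simp only [weightIntegral_C_mul]
  refine DifferentiableAt.congr_of_eventuallyEq ?_ h1
  exact DifferentiableAt.fun_sum fun n _ =>
    (hP n).mul (hasDerivAt_weightIntegral_X_pow ℓ n hζ).differentiableAt

lemma differentiableAt_polyInner (ℓ : ℕ) {ζ : ℝ} (hζ : 0 < ζ) {P Q : ℝ → ℝ[X]} {N N' : ℕ}
    (hN : ∀ z, (P z).natDegree ≤ N) (hN' : ∀ z, (Q z).natDegree ≤ N')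
    (hP : ∀ n, DifferentiableAt ℝ (fun z => (P z).coeff n) ζ)
    (hQ : ∀ n, DifferentiableAt ℝ (fun z => (Q z).coeff n) ζ) :
    DifferentiableAt ℝ (fun z => polyInner ℓ z (P z) (Q z)) ζ := by
  simp only [polyInner_eq]
  refine (differentiableAt_weightConst ℓ hζ).mul
    (differentiableAt_weightIntegral ℓ hζ (N := N + N') (fun z => ?_) fun n => ?_)
  · exact natDegree_mul_le.trans (add_le_add (hN z) (hN' z))
  · simp only [coeff_mul]
    exact DifferentiableAt.fun_sum fun x _ => (hP _).mul (hQ _)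

lemma differentiableAt_monicOrthPoly_coeff (ℓ : ℕ) {ζ : ℝ} (hζ : 0 < ζ) (k n : ℕ) :
    DifferentiableAt ℝ (fun z => (monicOrthPoly ℓ z k).coeff n) ζ := by
  induction k using Nat.strong_induction_on generalizing n with
  | _ k ih =>
    have h1 : (fun z => (monicOrthPoly ℓ z k).coeff n) = fun z => (X ^ k : ℝ[X]).coeff n
        - ∑ j : Fin k, polyInner ℓ z (X ^ k) (monicOrthPoly ℓ z j)
          / polyInner ℓ z (monicOrthPoly ℓ z j) (monicOrthPoly ℓ z j)
          * (monicOrthPoly ℓ z j).coeff n := by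
      ext z
      rw [monicOrthPoly]
      simp only [coeff_sub, finsetSum_coeff, coeff_C_mul]
    rw [h1]
    have hd : ∀ (j : ℕ) z, (monicOrthPoly ℓ z j).natDegree ≤ j := fun j z =>
      (monicOrthPoly_monic_natDegree ℓ z j).2.le
    refine (differentiableAt_const _).sub (DifferentiableAt.fun_sum fun j _ => ?_)
    refine DifferentiableAt.mul (DifferentiableAt.div ?_ ?_ ?_) (ih j j.2 n)
    · exact differentiableAt_polyInner ℓ hζ (P := fun _ => X ^ k) (N := k) (by simp) (hd j)
        (by simp) (ih j j.2)
    · exact differentiableAt_polyInner ℓ hζ (hd j) (hd j) (ih j j.2) (ih j j.2)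
    · exact (polyInner_self_pos ℓ hζ (monicOrthPoly_ne_zero ℓ ζ j)).ne'

lemma differentiableAt_orthPoly_coeff (ℓ : ℕ) {ζ : ℝ} (hζ : 0 < ζ) (k n : ℕ) :
    DifferentiableAt ℝ (fun z => (orthPoly ℓ z k).coeff n) ζ := by
  simp only [orthPoly, coeff_C_mul]
  have hd : ∀ (j : ℕ) z, (monicOrthPoly ℓ z j).natDegree ≤ j := fun j z =>
    (monicOrthPoly_monic_natDegree ℓ z j).2.le
  have hpos := polyInner_self_pos ℓ hζ (monicOrthPoly_ne_zero ℓ ζ k)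
  refine DifferentiableAt.mul (DifferentiableAt.div (differentiableAt_const _) ?_ ?_)
    (differentiableAt_monicOrthPoly_coeff ℓ hζ k n)
  · exact (differentiableAt_polyInner ℓ hζ (hd k) (hd k)
      (differentiableAt_monicOrthPoly_coeff ℓ hζ k)
      (differentiableAt_monicOrthPoly_coeff ℓ hζ k)).sqrt hpos.ne'
  · positivity

lemma differentiableAt_orthPoly_eval (ℓ : ℕ) {ζ : ℝ} (hζ : 0 < ζ) (k : ℕ) (x : ℝ) :
    DifferentiableAt ℝ (fun z => (orthPoly ℓ z k).eval x) ζ := by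
  have h : (fun z => (orthPoly ℓ z k).eval x)
      = fun z => ∑ n ∈ Finset.range (k + 1), (orthPoly ℓ z k).coeff n * x ^ n := by
    ext z
    rw [eval_eq_sum_range' (Nat.lt_succ_of_le (orthPoly_natDegree_le ℓ z k))]
  rw [h]
  exact DifferentiableAt.fun_sum fun n _ =>
    (differentiableAt_orthPoly_coeff ℓ hζ k n).mul_const _

/-! ### Orthogonality of the spherical harmonics -/

/-- The factor of `realSphericalHarmonic` that depends on the azimuth. -/
def azimuthal (m : ℤ) (φ : ℝ) : ℝ :=
  if m < 0 then √2 * Real.sin (m.natAbs * φ)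
  else if m = 0 then 1
  else √2 * Real.cos (m.natAbs * φ)

lemma realSphericalHarmonic_eq (ℓ : ℕ) (m : ℤ) (y φ : ℝ) :
    realSphericalHarmonic ℓ m y φ = normLegendre ℓ m.natAbs y * azimuthal m φ := by
  unfold realSphericalHarmonic azimuthal
  split_ifs with h1 h2
  · ring
  · simp [h2]
  · ring

lemma continuous_azimuthal (m : ℤ) : Continuous (azimuthal m) := by
  unfold azimuthal
  split_ifs <;> fun_prop

lemma integral_cos_int_mul_sub (n : ℤ) (s : ℝ) :
    ∫ φ in (-Real.pi)..Real.pi, Real.cos (n * φ - s)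
      = if n = 0 then 2 * Real.pi * Real.cos s else 0 := by
  split_ifs with h
  · subst h
    simp [two_mul]
  · have hn : (n : ℝ) ≠ 0 := Int.cast_ne_zero.2 h
    rw [intervalIntegral.integral_comp_mul_sub (fun x => Real.cos x) hn, integral_cos]
    simp [Real.sin_sub, Real.sin_int_mul_pi]

/-- Every azimuthal factor is a multiple of a shifted cosine. -/
lemma azimuthal_eq_cos (m : ℤ) (φ : ℝ) : azimuthal m φ
    = (if m = 0 then 1 else √2)
      * Real.cos (m.natAbs * φ - if m < 0 then Real.pi / 2 else 0) := by
  unfold azimuthal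
  split_ifs with h1 h2 h3
  · omega
  · rw [Real.cos_sub_pi_div_two]
  · subst h3; simp
  · simp

lemma integral_azimuthal_mul (m m' : ℤ) :
    ∫ φ in Set.Ioo (-Real.pi) Real.pi, azimuthal m φ * azimuthal m' φ
      = if m = m' then 2 * Real.pi else 0 := by
  rw [← integral_Ioc_eq_integral_Ioo, ← intervalIntegral.integral_of_le (by linarith [Real.pi_pos])]
  set a : ℝ := if m = 0 then 1 else √2 with ha
  set a' : ℝ := if m' = 0 then 1 else √2 with ha'
  set s : ℝ := if m < 0 then Real.pi / 2 else 0 with hs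
  set s' : ℝ := if m' < 0 then Real.pi / 2 else 0 with hs'
  have h1 : ∀ φ, azimuthal m φ * azimuthal m' φ = a * a' / 2
      * (Real.cos ((((m.natAbs : ℤ) - (m'.natAbs : ℤ) : ℤ) : ℝ) * φ - (s - s'))
        + Real.cos ((((m.natAbs : ℤ) + (m'.natAbs : ℤ) : ℤ) : ℝ) * φ - (s + s'))) := by
    intro φ
    rw [azimuthal_eq_cos, azimuthal_eq_cos, ← ha, ← ha', ← hs, ← hs']
    have e1 : (((m.natAbs : ℤ) - (m'.natAbs : ℤ) : ℤ) : ℝ) * φ - (s - s')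
        = ((m.natAbs : ℝ) * φ - s) - ((m'.natAbs : ℝ) * φ - s') := by
      simp only [Int.cast_sub, Int.cast_natCast]; ring
    have e2 : (((m.natAbs : ℤ) + (m'.natAbs : ℤ) : ℤ) : ℝ) * φ - (s + s')
        = ((m.natAbs : ℝ) * φ - s) + ((m'.natAbs : ℝ) * φ - s') := by
      simp only [Int.cast_add, Int.cast_natCast]; ring
    rw [e1, e2, Real.cos_sub ((m.natAbs : ℝ) * φ - s), Real.cos_add ((m.natAbs : ℝ) * φ - s)]
    ring
  simp only [h1]
  rw [intervalIntegral.integral_const_mul, intervalIntegral.integral_add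
    (Continuous.intervalIntegrable (by fun_prop) _ _)
    (Continuous.intervalIntegrable (by fun_prop) _ _),
    integral_cos_int_mul_sub, integral_cos_int_mul_sub]
  by_cases h : m = m'
  · subst h
    rw [if_pos rfl, if_pos (by simp), sub_self, Real.cos_zero]
    by_cases h0 : m = 0
    · subst h0
      simp [ha, ha', hs, hs']
      ring
    · rw [if_neg (by omega), ha, ha', if_neg h0]
      simp
  · rw [if_neg h]
    by_cases hk : m.natAbs = m'.natAbs
    · have hmm : m' = -m := by omega
      rw [if_pos (by omega), if_neg (by omega)]
      have : Real.cos (s - s') = 0 := by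
        rcases lt_or_gt_of_ne (show m ≠ 0 by omega) with h2 | h2
        · rw [hs, hs', if_pos h2, if_neg (by omega)]; simp
        · rw [hs, hs', if_neg (by omega), if_pos (by omega)]; simp
      rw [this]; simp
    · rw [if_neg (by omega), if_neg (by omega)]; simp

lemma integral_derivative_mul {A B : ℝ[X]} (h1 : (A * B).eval 1 = 0) (h2 : (A * B).eval (-1) = 0) :
    ∫ y in (-1 : ℝ)..1, (derivative A * B).eval y
      = -∫ y in (-1 : ℝ)..1, (A * derivative B).eval y := by
  have h3 : ∫ y in (-1 : ℝ)..1, (derivative (A * B)).eval y = 0 := by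
    rw [intervalIntegral.integral_eq_sub_of_hasDerivAt (fun y _ => (A * B).hasDerivAt y)
      ((Polynomial.continuous _).intervalIntegrable _ _), h1, h2, sub_zero]
  rw [derivative_mul] at h3
  simp only [eval_add] at h3
  rw [intervalIntegral.integral_add ((Polynomial.continuous _).intervalIntegrable _ _)
    ((Polynomial.continuous _).intervalIntegrable _ _)] at h3
  linarith

/-- Iterated integration by parts on `[-1, 1]`. The divisibility hypothesis makes all boundary terms
vanish. -/
lemma integral_iterate_derivative_mul {A B : ℝ[X]} (n : ℕ)
    (h : ∀ j < n, (X ^ 2 - 1 : ℝ[X]) ∣ derivative^[n - 1 - j] A * derivative^[j] B) :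
    ∀ j ≤ n, ∫ y in (-1 : ℝ)..1, (derivative^[n] A * B).eval y
      = (-1) ^ j * ∫ y in (-1 : ℝ)..1, (derivative^[n - j] A * derivative^[j] B).eval y := by
  intro j
  induction j with
  | zero => intro _; simp
  | succ j ih =>
    intro hj
    rw [ih (by omega)]
    have e1 : n - j = (n - 1 - j) + 1 := by omega
    have e2 : n - (j + 1) = n - 1 - j := by omega
    obtain ⟨S, hS⟩ := h j (by omega)
    rw [e1, e2, Function.iterate_succ_apply', integral_derivative_mul (by simp [hS]) (by simp [hS]),
      Function.iterate_succ_apply']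
    ring

lemma natDegree_X_sq_sub_one_pow (n : ℕ) : ((X ^ 2 - 1 : ℝ[X]) ^ n).natDegree = 2 * n := by
  have h : (X ^ 2 - 1 : ℝ[X]) = X ^ 2 - C 1 := by simp
  rw [natDegree_pow, h, natDegree_X_pow_sub_C, mul_comm]

/-- The polynomial factor of the associated Legendre function. -/
def legendreFactor (ℓ m : ℕ) : ℝ[X] := derivative^[ℓ + m] ((X ^ 2 - 1 : ℝ[X]) ^ ℓ)

lemma legendreFactor_ne_zero {ℓ m : ℕ} (h : m ≤ ℓ) : legendreFactor ℓ m ≠ 0 := by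
  intro h0
  have h1 := congrArg (fun P : ℝ[X] => P.coeff (ℓ - m)) h0
  simp only [legendreFactor, coeff_iterate_derivative, coeff_zero] at h1
  have e1 : ℓ - m + (ℓ + m) = 2 * ℓ := by omega
  have hmon : ((X ^ 2 - 1 : ℝ[X]) ^ ℓ).Monic := by
    have h : (X ^ 2 - 1 : ℝ[X]) = X ^ 2 - C 1 := by simp
    rw [h]
    exact (monic_X_pow_sub_C _ two_ne_zero).pow ℓ
  have e2 := hmon.coeff_natDegree
  rw [natDegree_X_sq_sub_one_pow] at e2
  rw [e1, e2, nsmul_eq_mul, mul_one, Nat.cast_eq_zero, Nat.descFactorial_eq_zero_iff_lt] at h1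
  omega

lemma natDegree_legendreFactor_le (ℓ m : ℕ) : (legendreFactor ℓ m).natDegree ≤ ℓ - m := by
  refine (natDegree_iterate_derivative _ _).trans ?_
  rw [natDegree_X_sq_sub_one_pow]
  omega

/-- Orthogonality of the associated Legendre functions of the same order and different degrees: in
the higher degree all derivatives are integrated by parts, and they annihilate the other factor. -/
lemma integral_legendreFactor_mul_of_lt {ℓ ℓ' m : ℕ} (hm : m ≤ ℓ') (h : ℓ' < ℓ) :
    ∫ y in (-1 : ℝ)..1,
      (legendreFactor ℓ m * ((X ^ 2 - 1) ^ m * legendreFactor ℓ' m)).eval y = 0 := by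
  unfold legendreFactor
  set B : ℝ[X] := (X ^ 2 - 1) ^ m * derivative^[ℓ' + m] ((X ^ 2 - 1 : ℝ[X]) ^ ℓ') with hB
  rw [integral_iterate_derivative_mul (ℓ + m) ?_ (ℓ + m) le_rfl]
  · have hdeg : B.natDegree < ℓ + m := by
      refine lt_of_le_of_lt natDegree_mul_le ?_
      have := natDegree_legendreFactor_le ℓ' m
      rw [legendreFactor] at this
      rw [natDegree_X_sq_sub_one_pow]
      omega
    rw [iterate_derivative_eq_zero hdeg]
    simp
  · intro j hj
    -- for `j < m` the factor `(X² - 1)^m` is still divisible, for `j ≥ m` the power `(X² - 1)^ℓ` is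
    by_cases hjm : j < m
    · have h1 : (X ^ 2 - 1 : ℝ[X]) ^ (m - j) ∣ derivative^[j] B :=
        pow_sub_dvd_iterate_derivative_of_pow_dvd j (Dvd.intro _ hB.symm)
      exact ((dvd_pow_self _ (by omega)).trans h1).mul_left _
    · have h1 := pow_sub_dvd_iterate_derivative_pow (X ^ 2 - 1 : ℝ[X]) ℓ (ℓ + m - 1 - j)
      exact ((dvd_pow_self _ (by omega)).trans h1).mul_right _

/-- The constant relating `normLegendre` to `legendreFactor`. -/
def legendreConst (ℓ m : ℕ) : ℝ :=
  √(((ℓ - m).factorial : ℝ) / ((ℓ + m).factorial : ℝ)) * (-1) ^ m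
    * (1 / (2 ^ ℓ * (ℓ.factorial : ℝ)))

lemma normLegendre_eq (ℓ m : ℕ) (y : ℝ) : normLegendre ℓ m y
    = legendreConst ℓ m * (√(1 - y ^ 2) ^ m * (legendreFactor ℓ m).eval y) := by
  unfold normLegendre assocLegendre legendreConst legendreFactor
  ring

lemma continuous_normLegendre (ℓ m : ℕ) : Continuous (normLegendre ℓ m) := by
  have : normLegendre ℓ m = fun y =>
      legendreConst ℓ m * (√(1 - y ^ 2) ^ m * (legendreFactor ℓ m).eval y) := by
    ext y; rw [normLegendre_eq]
  rw [this]
  fun_prop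

lemma legendreConst_ne_zero (ℓ m : ℕ) : legendreConst ℓ m ≠ 0 := by
  unfold legendreConst
  have h1 : √(((ℓ - m).factorial : ℝ) / ((ℓ + m).factorial : ℝ)) ≠ 0 := by positivity
  have h2 : (1 / (2 ^ ℓ * (ℓ.factorial : ℝ))) ≠ 0 := by positivity
  have h3 : ((-1 : ℝ)) ^ m ≠ 0 := pow_ne_zero _ (by norm_num)
  exact mul_ne_zero (mul_ne_zero h1 h3) h2

lemma integral_normLegendre_mul (ℓ ℓ' m : ℕ) :
    ∫ y in Set.Ioo (-1 : ℝ) 1, normLegendre ℓ m y * normLegendre ℓ' m y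
      = legendreConst ℓ m * legendreConst ℓ' m * (-1) ^ m * ∫ y in (-1 : ℝ)..1,
        (legendreFactor ℓ m * ((X ^ 2 - 1) ^ m * legendreFactor ℓ' m)).eval y := by
  rw [intervalIntegral.integral_of_le (by norm_num), integral_Ioc_eq_integral_Ioo,
    ← integral_const_mul]
  refine setIntegral_congr_fun measurableSet_Ioo fun y hy => ?_
  have h0 : 0 ≤ 1 - y ^ 2 := by nlinarith [hy.1, hy.2]
  simp only [normLegendre_eq, eval_mul, eval_pow, eval_sub, eval_X, eval_one]
  have h2 : √(1 - y ^ 2) ^ m * √(1 - y ^ 2) ^ m = (-1) ^ m * (y ^ 2 - 1) ^ m := by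
    rw [← mul_pow, Real.mul_self_sqrt h0, ← mul_pow]
    ring
  calc _ = legendreConst ℓ m * legendreConst ℓ' m * (√(1 - y ^ 2) ^ m * √(1 - y ^ 2) ^ m)
        * ((legendreFactor ℓ m).eval y * (legendreFactor ℓ' m).eval y) := by ring
    _ = _ := by rw [h2]; ring

lemma integral_normLegendre_mul_of_ne {ℓ ℓ' m : ℕ} (h : ℓ ≠ ℓ') (hm : m ≤ ℓ) (hm' : m ≤ ℓ') :
    ∫ y in Set.Ioo (-1 : ℝ) 1, normLegendre ℓ m y * normLegendre ℓ' m y = 0 := by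
  rcases lt_or_gt_of_ne h with h | h
  · simp only [mul_comm (normLegendre ℓ m _)]
    rw [integral_normLegendre_mul, integral_legendreFactor_mul_of_lt hm h, mul_zero]
  · rw [integral_normLegendre_mul, integral_legendreFactor_mul_of_lt hm' h, mul_zero]

lemma integral_normLegendre_mul_self_pos {ℓ m : ℕ} (hm : m ≤ ℓ) :
    0 < ∫ y in Set.Ioo (-1 : ℝ) 1, normLegendre ℓ m y * normLegendre ℓ m y := by
  have hc : Continuous fun y => normLegendre ℓ m y * normLegendre ℓ m y :=
    (continuous_normLegendre ℓ m).mul (continuous_normLegendre ℓ m)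
  rw [setIntegral_pos_iff_support_of_nonneg_ae]
  · have hsub : Set.Ioo (-1 : ℝ) 1 \ ((legendreFactor ℓ m).roots.toFinset : Set ℝ)
        ⊆ Function.support (fun y => normLegendre ℓ m y * normLegendre ℓ m y)
          ∩ Set.Ioo (-1) 1 := by
      rintro y ⟨hy, hyr⟩
      refine ⟨?_, hy⟩
      have h1 : (legendreFactor ℓ m).eval y ≠ 0 := by
        intro h
        apply hyr
        simp [legendreFactor_ne_zero hm, h]
      have h2 : 0 < √(1 - y ^ 2) := Real.sqrt_pos.2 (by nlinarith [hy.1, hy.2])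
      have h3 : normLegendre ℓ m y ≠ 0 := by
        rw [normLegendre_eq]
        exact mul_ne_zero (legendreConst_ne_zero ℓ m) (mul_ne_zero (pow_ne_zero _ h2.ne') h1)
      exact mul_ne_zero h3 h3
    refine lt_of_lt_of_le ?_ (measure_mono hsub)
    rw [measure_sdiff_null (Finset.measure_zero _ _)]
    simp
  · exact Filter.Eventually.of_forall fun y => mul_self_nonneg _
  · exact (hc.integrableOn_Icc (a := -1) (b := 1)).mono_set Set.Ioo_subset_Icc_self

/-! ### Spherical coordinates -/

/-- The change to polar coordinates as an equality of measures. -/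
lemma map_polarCoord_symm :
    Measure.map polarCoord.symm
      (((volume.restrict (Set.Ioi (0 : ℝ))).withDensity fun r => ENNReal.ofReal r).prod
        (volume.restrict (Set.Ioo (-Real.pi) Real.pi))) = volume := by
  have hmeas : Measurable (polarCoord.symm : ℝ × ℝ → ℝ × ℝ) :=
    continuous_polarCoord_symm.measurable
  have h1 : ((volume.restrict (Set.Ioi (0 : ℝ))).withDensity fun r => ENNReal.ofReal r).prod
        (volume.restrict (Set.Ioo (-Real.pi) Real.pi))
      = ((volume : Measure (ℝ × ℝ)).restrict polarCoord.target).withDensity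
        (fun p => ENNReal.ofReal p.1) := by
    rw [prod_withDensity_left (by fun_prop), Measure.prod_restrict, ← Measure.volume_eq_prod,
      polarCoord_target]
  ext s hs
  rw [Measure.map_apply hmeas hs, h1, withDensity_apply _ (hmeas hs),
    ← lintegral_indicator (hmeas hs)]
  have h2 := lintegral_comp_polarCoord_symm (s.indicator 1)
  rw [lintegral_indicator_one hs] at h2
  rw [← h2]
  congr 1
  ext p
  by_cases hp : polarCoord.symm p ∈ s
  · rw [Set.indicator_of_mem (show p ∈ polarCoord.symm ⁻¹' s from hp)]
    rw [Set.indicator_of_mem hp, Pi.one_apply, smul_eq_mul, mul_one]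
  · rw [Set.indicator_of_notMem (show p ∉ polarCoord.symm ⁻¹' s from hp)]
    rw [Set.indicator_of_notMem hp, smul_zero]

lemma integral_sin_mul_comp_cos (A : ℝ → ℝ) :
    ∫ t in Set.Ioo 0 Real.pi, Real.sin t * A (Real.cos t) = ∫ y in Set.Ioo (-1 : ℝ) 1, A y := by
  have himg : Real.cos '' Set.Ioo 0 Real.pi = Set.Ioo (-1) 1 := by
    ext y
    constructor
    · rintro ⟨t, ht, rfl⟩
      constructor
      · rw [← Real.cos_pi]
        exact Real.cos_lt_cos_of_nonneg_of_le_pi ht.1.le le_rfl ht.2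
      · rw [← Real.cos_zero]
        exact Real.cos_lt_cos_of_nonneg_of_le_pi le_rfl ht.2.le ht.1
    · intro hy
      exact ⟨Real.arccos y, ⟨Real.arccos_pos.2 hy.2, Real.arccos_lt_pi.2 hy.1⟩,
        Real.cos_arccos hy.1.le hy.2.le⟩
  rw [← himg, integral_image_eq_integral_abs_deriv_smul measurableSet_Ioo
    (fun t _ => (Real.hasDerivAt_cos t).hasDerivWithinAt)
    (Real.injOn_cos.mono Set.Ioo_subset_Icc_self)]
  refine setIntegral_congr_fun measurableSet_Ioo fun t ht => ?_
  simp [abs_of_pos (Real.sin_pos_of_pos_of_lt_pi ht.1 ht.2)]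

/-- Polar coordinates in the half-plane of points `(z, ρ)`, `ρ > 0`, against the measure `ρ dz dρ`
that comes from cylindrical coordinates. The angle enters through its cosine. -/
lemma integral_halfPlane_polar (R A : ℝ → ℝ) :
    ∫ p : ℝ × ℝ, R (√(p.1 ^ 2 + p.2 ^ 2)) * A (p.1 / √(p.1 ^ 2 + p.2 ^ 2))
      ∂(volume.prod ((volume.restrict (Set.Ioi (0 : ℝ))).withDensity fun r => ENNReal.ofReal r))
    = (∫ r in Set.Ioi (0 : ℝ), r ^ 2 * R r) * ∫ y in Set.Ioo (-1 : ℝ) 1, A y := by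
  have h1 : (volume : Measure ℝ).prod
        ((volume.restrict (Set.Ioi (0 : ℝ))).withDensity fun r => ENNReal.ofReal r)
      = ((volume : Measure (ℝ × ℝ)).restrict (Set.univ ×ˢ Set.Ioi 0)).withDensity
        (fun p => ((Real.toNNReal p.2 : NNReal) : ENNReal)) := by
    rw [prod_withDensity_right (by fun_prop)]
    congr 1
    rw [Measure.volume_eq_prod, ← Measure.prod_restrict, Measure.restrict_univ]
  rw [h1, integral_withDensity_eq_integral_smul (by fun_prop),
    ← integral_indicator (MeasurableSet.univ.prod measurableSet_Ioi),
    ← integral_comp_polarCoord_symm, polarCoord_target]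
  have h2 : ∀ p ∈ Set.Ioi (0 : ℝ) ×ˢ Set.Ioo (-Real.pi) Real.pi,
      p.1 • (Set.univ ×ˢ Set.Ioi (0 : ℝ)).indicator (fun p : ℝ × ℝ => p.2.toNNReal •
        (R (√(p.1 ^ 2 + p.2 ^ 2)) * A (p.1 / √(p.1 ^ 2 + p.2 ^ 2)))) (polarCoord.symm p)
      = (p.1 ^ 2 * R p.1) * ((Set.Ioo 0 Real.pi).indicator
          (fun t => Real.sin t * A (Real.cos t)) p.2) := by
    rintro ⟨r, t⟩ ⟨hr, ht⟩
    have hr : 0 < r := hr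
    have ht : t ∈ Set.Ioo (-Real.pi) Real.pi := ht
    have hrr : √((r * Real.cos t) ^ 2 + (r * Real.sin t) ^ 2) = r := by
      have : (r * Real.cos t) ^ 2 + (r * Real.sin t) ^ 2 = r ^ 2 := by
        nlinarith [Real.sin_sq_add_cos_sq t]
      rw [this, Real.sqrt_sq hr.le]
    rw [polarCoord_symm_apply]
    by_cases h : 0 < t
    · have hs : 0 < Real.sin t := Real.sin_pos_of_pos_of_lt_pi h ht.2
      rw [Set.indicator_of_mem (by simp [hr, hs]),
        Set.indicator_of_mem (show t ∈ Set.Ioo 0 Real.pi from ⟨h, ht.2⟩)]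
      simp only [hrr, NNReal.smul_def, Real.coe_toNNReal _ (mul_pos hr hs).le, smul_eq_mul]
      rw [mul_div_cancel_left₀ _ hr.ne']
      ring
    · have hs : ¬ 0 < Real.sin t := by
        have := Real.sin_nonneg_of_nonneg_of_le_pi (x := -t) (by linarith) (by linarith [ht.1])
        rw [Real.sin_neg] at this
        linarith
      rw [Set.indicator_of_notMem (by simp [hr, hs]),
        Set.indicator_of_notMem (show t ∉ Set.Ioo 0 Real.pi from fun h' => h h'.1)]
      simp
  rw [setIntegral_congr_fun (measurableSet_Ioi.prod measurableSet_Ioo) h2, Measure.volume_eq_prod,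
    setIntegral_prod_mul (fun r => r ^ 2 * R r)]
  congr 1
  rw [setIntegral_indicator measurableSet_Ioo, ← integral_sin_mul_comp_cos A]
  congr 2
  ext t
  constructor
  · exact fun h => h.2
  · exact fun h => ⟨⟨by linarith [h.1, Real.pi_pos], h.2⟩, h⟩

/-- Integration in spherical coordinates of a product of a radial, a polar and an azimuthal factor.
-/
lemma integral_spherical {R A Φ : ℝ → ℝ} (hR : Measurable R) (hA : Measurable A)
    (hΦ : Measurable Φ) :
    ∫ q : Momentum, R ‖q‖ * A (q 2 / ‖q‖) * Φ (Complex.arg ⟨q 0, q 1⟩)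
      = (∫ r in Set.Ioi (0 : ℝ), r ^ 2 * R r) * (∫ y in Set.Ioo (-1 : ℝ) 1, A y)
        * ∫ φ in Set.Ioo (-Real.pi) Real.pi, Φ φ := by
  set lam := (volume.restrict (Set.Ioi (0 : ℝ))).withDensity fun r => ENNReal.ofReal r with hlam
  set mphi := (volume.restrict (Set.Ioo (-Real.pi) Real.pi)) with hmphi
  let F : ℝ × (ℝ × ℝ) → ℝ := fun x => R (√(x.1 ^ 2 + (x.2.1 ^ 2 + x.2.2 ^ 2)))
    * A (x.1 / √(x.1 ^ 2 + (x.2.1 ^ 2 + x.2.2 ^ 2))) * Φ (Complex.arg ⟨x.2.1, x.2.2⟩)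
  have hF : Measurable F := by
    have harg : Measurable fun x : ℝ × (ℝ × ℝ) => Complex.arg ⟨x.2.1, x.2.2⟩ := by
      have : Measurable fun x : ℝ × (ℝ × ℝ) => Complex.equivRealProdCLM.symm x.2 := by fun_prop
      exact Complex.measurable_arg.comp this
    fun_prop
  -- the coordinates `(q₃, (q₁, q₂))`
  let e : Momentum → ℝ × (ℝ × ℝ) := fun q => (q 2, (q 0, q 1))
  have he : MeasurePreserving e := by
    have h1 := EuclideanSpace.volume_preserving_symm_measurableEquiv_toLp (Fin 3)
    have h2 := volume_preserving_piFinSuccAbove (fun _ : Fin 3 => ℝ) 2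
    have h3 := (MeasurePreserving.id (volume : Measure ℝ)).prod (volume_preserving_finTwoArrow ℝ)
    exact h3.comp (h2.comp h1)
  have e1 : ∫ q : Momentum, R ‖q‖ * A (q 2 / ‖q‖) * Φ (Complex.arg ⟨q 0, q 1⟩)
      = ∫ x, F x := by
    rw [← he.map_eq, integral_map he.measurable.aemeasurable (by
      exact hF.aestronglyMeasurable)]
    congr 1
    ext q
    have : ‖q‖ = √(q 2 ^ 2 + (q 0 ^ 2 + q 1 ^ 2)) := by
      rw [EuclideanSpace.norm_eq, Fin.sum_univ_three]
      simp only [Real.norm_eq_abs, sq_abs]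
      congr 1
      ring
    simp only [F, e, this]
  have hmeas : Measurable (polarCoord.symm : ℝ × ℝ → ℝ × ℝ) :=
    continuous_polarCoord_symm.measurable
  have e2 : (volume : Measure (ℝ × (ℝ × ℝ)))
      = Measure.map (Prod.map id polarCoord.symm) (volume.prod (lam.prod mphi)) := by
    rw [← Measure.map_prod_map _ _ measurable_id hmeas, map_polarCoord_symm, Measure.map_id]
    rfl
  have e3 : (volume : Measure ℝ).prod (lam.prod mphi)
      = Measure.map MeasurableEquiv.prodAssoc (((volume : Measure ℝ).prod lam).prod mphi) :=
    Measure.prodAssoc_prod.symm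
  rw [e1, e2, integral_map (measurable_id.prodMap hmeas).aemeasurable hF.aestronglyMeasurable, e3,
    integral_map_equiv, ← integral_halfPlane_polar R A, ← integral_prod_mul]
  refine integral_congr_ae ?_
  have hae : ∀ᵐ x : (ℝ × ℝ) × ℝ ∂(((volume : Measure ℝ).prod lam).prod mphi),
      0 < x.1.2 ∧ x.2 ∈ Set.Ioo (-Real.pi) Real.pi := by
    have a1 : ∀ᵐ r ∂lam, 0 < r := by
      refine (withDensity_absolutelyContinuous _ _).ae_le ?_
      exact ae_restrict_mem measurableSet_Ioi
    have a2 : ∀ᵐ t ∂mphi, t ∈ Set.Ioo (-Real.pi) Real.pi := ae_restrict_mem measurableSet_Ioo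
    have b1 : ∀ᵐ x : ℝ × ℝ ∂((volume : Measure ℝ).prod lam), 0 < x.2 :=
      Measure.quasiMeasurePreserving_snd.ae a1
    exact (Measure.quasiMeasurePreserving_fst.ae b1).and (Measure.quasiMeasurePreserving_snd.ae a2)
  filter_upwards [hae] with x hx
  obtain ⟨⟨z, r⟩, t⟩ := x
  obtain ⟨hr, ht⟩ := hx
  have hrr : (r * Real.cos t) ^ 2 + (r * Real.sin t) ^ 2 = r ^ 2 := by
    nlinarith [Real.sin_sq_add_cos_sq t]
  have harg : Complex.arg ⟨r * Real.cos t, r * Real.sin t⟩ = t := by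
    have : (⟨r * Real.cos t, r * Real.sin t⟩ : ℂ)
        = r * (Complex.cos t + Complex.sin t * Complex.I) := by
      apply Complex.ext <;> simp [Complex.cos_ofReal_re, Complex.sin_ofReal_re]
    rw [this, Complex.arg_mul_cos_add_sin_mul_I hr ⟨ht.1, ht.2.le⟩]
  simp only [F, MeasurableEquiv.prodAssoc, MeasurableEquiv.coe_mk, Equiv.prodAssoc_apply, Prod.map,
    id, polarCoord_symm_apply, hrr, harg]

/-! ### The tetrad -/

lemma minkowski_add_left (a b c : Fin 4 → ℝ) :
    minkowski (a + b) c = minkowski a c + minkowski b c := by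
  simp only [minkowski, Pi.add_apply, Fin.sum_univ_three]
  ring

lemma minkowski_smul_left (r : ℝ) (a c : Fin 4 → ℝ) :
    minkowski (r • a) c = r * minkowski a c := by
  simp only [minkowski, Pi.smul_apply, smul_eq_mul, Fin.sum_univ_three]
  ring

lemma minkowski_comm (a b : Fin 4 → ℝ) : minkowski a b = minkowski b a := by
  simp only [minkowski, Fin.sum_univ_three]
  ring

lemma minkowski_add_right (a b c : Fin 4 → ℝ) :
    minkowski a (b + c) = minkowski a b + minkowski a c := by
  rw [minkowski_comm, minkowski_add_left, minkowski_comm b, minkowski_comm c]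

lemma minkowski_smul_right (r : ℝ) (a c : Fin 4 → ℝ) :
    minkowski a (r • c) = r * minkowski a c := by
  rw [minkowski_comm, minkowski_smul_left, minkowski_comm]

lemma minkowski_sub_right (a b c : Fin 4 → ℝ) :
    minkowski a (b - c) = minkowski a b - minkowski a c := by
  simp only [minkowski, Pi.sub_apply, Fin.sum_univ_three]
  ring

lemma minkowski_sum_right {ι : Type*} (s : Finset ι) (a : Fin 4 → ℝ) (b : ι → Fin 4 → ℝ) :
    minkowski a (∑ i ∈ s, b i) = ∑ i ∈ s, minkowski a (b i) := by
  classical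
  induction s using Finset.induction_on with
  | empty => simp [minkowski]
  | insert i s his ih => rw [Finset.sum_insert his, Finset.sum_insert his, minkowski_add_right, ih]

/-- Two future-directed timelike vectors have a positive product. -/
lemma minkowski_pos {a b : Fin 4 → ℝ} (ha0 : 0 < a 0) (ha : ∑ i : Fin 3, a i.succ ^ 2 < a 0 ^ 2)
    (hb0 : 0 < b 0) (hb : ∑ i : Fin 3, b i.succ ^ 2 < b 0 ^ 2) : 0 < minkowski a b := by
  have h1 := Finset.sum_mul_sq_le_sq_mul_sq Finset.univ (fun i : Fin 3 => a i.succ)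
    (fun i => b i.succ)
  have h2 : (∑ i : Fin 3, a i.succ * b i.succ) ^ 2 < (a 0 * b 0) ^ 2 := by
    refine lt_of_le_of_lt h1 ?_
    rw [mul_pow]
    have hb' : 0 ≤ ∑ i : Fin 3, b i.succ ^ 2 := Finset.sum_nonneg fun i _ => sq_nonneg _
    have : 0 < a 0 ^ 2 := by positivity
    nlinarith
  have h3 := lt_of_pow_lt_pow_left₀ 2 (by positivity) h2
  unfold minkowski
  linarith

section Tetrad

variable {u : EuclideanSpace ℝ (Fin 3)}

lemma one_sub_norm_sq_pos (hu : ‖u‖ < 1) : 0 < 1 - ‖u‖ ^ 2 := by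
  nlinarith [norm_nonneg u]

lemma fourVelocity_zero_pos (hu : ‖u‖ < 1) : 0 < fourVelocity u 0 := by
  have := one_sub_norm_sq_pos hu
  simp only [fourVelocity, Fin.cons_zero]
  positivity

lemma fourVelocity_succ (u : EuclideanSpace ℝ (Fin 3)) (i : Fin 3) :
    fourVelocity u i.succ = fourVelocity u 0 * u i := by
  simp [fourVelocity]

lemma fourVelocity_sq (hu : ‖u‖ < 1) :
    fourVelocity u 0 ^ 2 = 1 + ∑ i : Fin 3, fourVelocity u i.succ ^ 2 := by
  have h := one_sub_norm_sq_pos hu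
  have h1 : fourVelocity u 0 ^ 2 = 1 / (1 - ‖u‖ ^ 2) := by
    simp only [fourVelocity, Fin.cons_zero]
    rw [div_pow, Real.sq_sqrt h.le, one_pow]
  simp only [fourVelocity_succ, mul_pow]
  rw [← Finset.mul_sum, ← EuclideanSpace.real_norm_sq_eq, h1]
  field_simp
  ring

lemma minkowski_fourVelocity_self (hu : ‖u‖ < 1) :
    minkowski (fourVelocity u) (fourVelocity u) = 1 := by
  have := fourVelocity_sq hu
  simp only [minkowski, ← sq]
  linarith

/-- `∑ (Uⁱ)² / (U⁰ + 1) = U⁰ - 1`. -/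
lemma sum_fourVelocity_sq_div (hu : ‖u‖ < 1) :
    (fourVelocity u 1 ^ 2 + fourVelocity u 2 ^ 2 + fourVelocity u 3 ^ 2) / (fourVelocity u 0 + 1)
      = fourVelocity u 0 - 1 := by
  have h := fourVelocity_sq hu
  have h0 := fourVelocity_zero_pos hu
  rw [Fin.sum_univ_three] at h
  rw [div_eq_iff (by positivity)]
  have e1 : (Fin.succ 0 : Fin 4) = 1 := rfl
  have e2 : (Fin.succ 1 : Fin 4) = 2 := rfl
  have e3 : (Fin.succ 2 : Fin 4) = 3 := rfl
  rw [e1, e2, e3] at h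
  linarith

lemma minkowski_fourVelocity_tetrad (hu : ‖u‖ < 1) (i : Fin 3) :
    minkowski (fourVelocity u) (tetrad u i) = 0 := by
  have h := sum_fourVelocity_sq_div hu
  have e1 : (Fin.succ 0 : Fin 4) = 1 := rfl
  have e2 : (Fin.succ 1 : Fin 4) = 2 := rfl
  have e3 : (Fin.succ 2 : Fin 4) = 3 := rfl
  simp only [minkowski, tetrad, Fin.cons_zero, Fin.cons_succ, Fin.sum_univ_three]
  fin_cases i <;>
  · simp only [div_eq_mul_inv, Fin.zero_eta, Fin.mk_one, Fin.reduceFinMk, e1, e2, e3,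
      Fin.isValue, Fin.reduceEq, if_true, if_false, zero_ne_one, one_ne_zero] at h ⊢
    first
    | linear_combination (-fourVelocity u 1) * h
    | linear_combination (-fourVelocity u 2) * h
    | linear_combination (-fourVelocity u 3) * h

/-- The velocity and the tetrad form a basis that is orthonormal for the Minkowski product. -/
lemma minkowski_tetrad_expansion (hu : ‖u‖ < 1) (a : Fin 4 → ℝ) :
    a = minkowski (fourVelocity u) a • fourVelocity u
      - ∑ i : Fin 3, minkowski (tetrad u i) a • tetrad u i := by
  have h := sum_fourVelocity_sq_div hu
  have h0 := fourVelocity_zero_pos hu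
  have h1 : (fourVelocity u 0 + 1) * (fourVelocity u 0 + 1)⁻¹ = 1 :=
    mul_inv_cancel₀ (by positivity)
  have e1 : (Fin.succ 0 : Fin 4) = 1 := rfl
  have e2 : (Fin.succ 1 : Fin 4) = 2 := rfl
  have e3 : (Fin.succ 2 : Fin 4) = 3 := rfl
  have t0 : ∀ i, tetrad u i 0 = fourVelocity u i.succ := fun i => rfl
  have t1 : ∀ i, tetrad u i 1 = fourVelocity u i.succ * fourVelocity u 1 / (fourVelocity u 0 + 1)
      + if i = 0 then 1 else 0 := fun i => rfl
  have t2 : ∀ i, tetrad u i 2 = fourVelocity u i.succ * fourVelocity u 2 / (fourVelocity u 0 + 1)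
      + if i = 1 then 1 else 0 := fun i => rfl
  have t3 : ∀ i, tetrad u i 3 = fourVelocity u i.succ * fourVelocity u 3 / (fourVelocity u 0 + 1)
      + if i = 2 then 1 else 0 := fun i => rfl
  have hq := fourVelocity_sq hu
  rw [Fin.sum_univ_three, e1, e2, e3] at hq
  simp only [minkowski, Fin.sum_univ_three]
  set U := fourVelocity u
  ext α
  fin_cases α
  · simp [t0, t1, t2, t3, e1, e2, e3, div_eq_mul_inv] at h ⊢
    linear_combination (-(a 0)) * hq - (U 1 * a 1 + U 2 * a 2 + U 3 * a 3) * h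
  · simp [t0, t1, t2, t3, e1, e2, e3, div_eq_mul_inv] at h ⊢
    linear_combination (U 1 * a 0) * h - U 1 * (U 1 * a 1 + U 2 * a 2 + U 3 * a 3)
      * ((U 0 + 1)⁻¹ * h + h1)
  · simp [t0, t1, t2, t3, e1, e2, e3, div_eq_mul_inv] at h ⊢
    linear_combination (U 2 * a 0) * h - U 2 * (U 1 * a 1 + U 2 * a 2 + U 3 * a 3)
      * ((U 0 + 1)⁻¹ * h + h1)
  · simp [t0, t1, t2, t3, e1, e2, e3, div_eq_mul_inv] at h ⊢
    linear_combination (U 3 * a 0) * h - U 3 * (U 1 * a 1 + U 2 * a 2 + U 3 * a 3)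
      * ((U 0 + 1)⁻¹ * h + h1)

/-- The Minkowski product in terms of the components in the frame of the fluid. -/
lemma minkowski_eq_tetrad (hu : ‖u‖ < 1) (a b : Fin 4 → ℝ) :
    minkowski a b = minkowski (fourVelocity u) a * minkowski (fourVelocity u) b
      - ∑ i : Fin 3, minkowski (tetrad u i) a * minkowski (tetrad u i) b := by
  conv_lhs => rw [minkowski_tetrad_expansion hu a]
  rw [minkowski_comm, minkowski_sub_right, minkowski_smul_right, minkowski_sum_right,
    minkowski_comm b]
  simp only [minkowski_comm b, minkowski_smul_left]

lemma minkowski_tetrad_tetrad (hu : ‖u‖ < 1) (i j : Fin 3) :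
    minkowski (tetrad u i) (tetrad u j) = if i = j then -1 else 0 := by
  have h := sum_fourVelocity_sq_div hu
  have h0 := fourVelocity_zero_pos hu
  have h1 : (fourVelocity u 0 + 1) * (fourVelocity u 0 + 1)⁻¹ = 1 :=
    mul_inv_cancel₀ (by positivity)
  have e1 : (Fin.succ 0 : Fin 4) = 1 := rfl
  have e2 : (Fin.succ 1 : Fin 4) = 2 := rfl
  have e3 : (Fin.succ 2 : Fin 4) = 3 := rfl
  have key : ∀ δ₁ δ₂ δ₃ ε₁ ε₂ ε₃ a b : ℝ, a = δ₁ * fourVelocity u 1 + δ₂ * fourVelocity u 2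
      + δ₃ * fourVelocity u 3 → b = ε₁ * fourVelocity u 1 + ε₂ * fourVelocity u 2
      + ε₃ * fourVelocity u 3 →
      a * b - ((a * fourVelocity u 1 / (fourVelocity u 0 + 1) + δ₁)
          * (b * fourVelocity u 1 / (fourVelocity u 0 + 1) + ε₁)
        + (a * fourVelocity u 2 / (fourVelocity u 0 + 1) + δ₂)
          * (b * fourVelocity u 2 / (fourVelocity u 0 + 1) + ε₂)
        + (a * fourVelocity u 3 / (fourVelocity u 0 + 1) + δ₃)
          * (b * fourVelocity u 3 / (fourVelocity u 0 + 1) + ε₃))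
        = -(δ₁ * ε₁ + δ₂ * ε₂ + δ₃ * ε₃) := by
    rintro δ₁ δ₂ δ₃ ε₁ ε₂ ε₃ a b ha hb
    simp only [div_eq_mul_inv] at h ⊢
    linear_combination (-(a * b)) * ((fourVelocity u 0 + 1)⁻¹ * h + h1)
      + (fourVelocity u 0 + 1)⁻¹ * (a * hb + b * ha)
  simp only [minkowski, tetrad, Fin.cons_zero, Fin.cons_succ, Fin.sum_univ_three, e1, e2, e3]
  rw [key _ _ _ _ _ _ (fourVelocity u i.succ) (fourVelocity u j.succ)]
  · fin_cases i <;> fin_cases j <;> simp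
  · fin_cases i <;> simp
  · fin_cases j <;> simp

/-! ### The frame of the fluid -/

lemma fourMomentum_zero (p : Momentum) : fourMomentum p 0 = √(1 + ‖p‖ ^ 2) := rfl

lemma fourMomentum_succ (p : Momentum) (i : Fin 3) : fourMomentum p i.succ = p i := rfl

lemma fourMomentum_zero_pos (p : Momentum) : 0 < fourMomentum p 0 := by
  rw [fourMomentum_zero]
  positivity

lemma sum_fourMomentum_sq (p : Momentum) :
    ∑ i : Fin 3, fourMomentum p i.succ ^ 2 = fourMomentum p 0 ^ 2 - 1 := by
  simp only [fourMomentum_succ, fourMomentum_zero]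
  rw [Real.sq_sqrt (by positivity), EuclideanSpace.real_norm_sq_eq]
  ring

lemma minkowski_fourMomentum_self (p : Momentum) :
    minkowski (fourMomentum p) (fourMomentum p) = 1 := by
  have := sum_fourMomentum_sq p
  simp only [minkowski, ← sq]
  linarith

/-- The Lorentz boost into the frame of the fluid, as a map of the momentum space. -/
def boost (u : EuclideanSpace ℝ (Fin 3)) (p : Momentum) : Momentum :=
  WithLp.toLp 2 (fluidMomentum u p)

lemma boost_apply (u : EuclideanSpace ℝ (Fin 3)) (p : Momentum) (i : Fin 3) :
    boost u p i = fluidMomentum u p i := rfl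

lemma fluidEnergy_pos (hu : ‖u‖ < 1) (p : Momentum) : 0 < fluidEnergy u p := by
  refine minkowski_pos (fourVelocity_zero_pos hu) ?_ (fourMomentum_zero_pos p) ?_
  · rw [fourVelocity_sq hu]; linarith
  · rw [sum_fourMomentum_sq]; linarith

lemma fluidEnergy_sq (hu : ‖u‖ < 1) (p : Momentum) :
    fluidEnergy u p ^ 2 = 1 + ‖boost u p‖ ^ 2 := by
  have h := minkowski_eq_tetrad hu (fourMomentum p) (fourMomentum p)
  rw [minkowski_fourMomentum_self] at h
  rw [EuclideanSpace.real_norm_sq_eq]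
  simp only [boost_apply, fluidMomentum, fluidEnergy, sq, neg_mul_neg]
  linarith

lemma fluidEnergy_eq_sqrt (hu : ‖u‖ < 1) (p : Momentum) :
    fluidEnergy u p = √(1 + ‖boost u p‖ ^ 2) := by
  rw [← fluidEnergy_sq hu, Real.sqrt_sq (fluidEnergy_pos hu p).le]

lemma sqrt_fluidEnergy_sq_sub_one (hu : ‖u‖ < 1) (p : Momentum) :
    √(fluidEnergy u p ^ 2 - 1) = ‖boost u p‖ := by
  rw [fluidEnergy_sq hu, add_sub_cancel_left, Real.sqrt_sq (norm_nonneg _)]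

lemma fourMomentum_eq (hu : ‖u‖ < 1) (p : Momentum) :
    fourMomentum p = fluidEnergy u p • fourVelocity u
      + ∑ i : Fin 3, fluidMomentum u p i • tetrad u i := by
  conv_lhs => rw [minkowski_tetrad_expansion hu (fourMomentum p)]
  simp only [fluidEnergy, fluidMomentum, neg_smul, Finset.sum_neg_distrib, sub_eq_add_neg]

lemma boost_injective (hu : ‖u‖ < 1) : Function.Injective (boost u) := by
  intro p p' h
  have h1 : fluidMomentum u p = fluidMomentum u p' := congrArg WithLp.ofLp h
  have h2 : fourMomentum p = fourMomentum p' := by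
    rw [fourMomentum_eq hu p, fourMomentum_eq hu p', fluidEnergy_eq_sqrt hu, fluidEnergy_eq_sqrt hu,
      h, h1]
  ext i
  exact congrFun h2 i.succ

lemma boost_surjective (hu : ‖u‖ < 1) : Function.Surjective (boost u) := by
  intro q
  set a : Fin 4 → ℝ := √(1 + ‖q‖ ^ 2) • fourVelocity u + ∑ i : Fin 3, q i • tetrad u i with ha
  have h1 : minkowski (fourVelocity u) a = √(1 + ‖q‖ ^ 2) := by
    rw [ha, minkowski_add_right, minkowski_smul_right, minkowski_sum_right,
      minkowski_fourVelocity_self hu]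
    simp [minkowski_smul_right, minkowski_fourVelocity_tetrad hu]
  have h2 : ∀ j, minkowski (tetrad u j) a = -q j := by
    intro j
    rw [ha, minkowski_add_right, minkowski_smul_right, minkowski_sum_right,
      minkowski_comm _ (fourVelocity u), minkowski_fourVelocity_tetrad hu]
    simp [minkowski_smul_right, minkowski_tetrad_tetrad hu]
  have h3 : minkowski a a = 1 := by
    rw [minkowski_eq_tetrad hu, h1]
    simp only [h2, ← sq, neg_sq]
    rw [Real.sq_sqrt (by positivity), EuclideanSpace.real_norm_sq_eq]
    ring
  have h4 : 0 < a 0 := by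
    have := minkowski_pos (a := fourMomentum q)
      (b := Fin.cons (fourVelocity u 0) fun i : Fin 3 => -fourVelocity u i.succ)
      (fourMomentum_zero_pos q) (by rw [sum_fourMomentum_sq]; linarith)
      (fourVelocity_zero_pos hu) (by
        simp only [Fin.cons_succ, Fin.cons_zero, neg_sq]
        rw [fourVelocity_sq hu]; linarith)
    simp only [minkowski, Fin.cons_zero, Fin.cons_succ, fourMomentum_zero, fourMomentum_succ,
      mul_neg, Finset.sum_neg_distrib, sub_neg_eq_add] at this
    simpa [ha, tetrad] using this
  have h5 : fourMomentum (WithLp.toLp 2 fun i : Fin 3 => a i.succ) = a := by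
    have h6 : √(1 + ‖(WithLp.toLp 2 fun i : Fin 3 => a i.succ : Momentum)‖ ^ 2) = a 0 := by
      rw [EuclideanSpace.real_norm_sq_eq]
      simp only [minkowski, ← sq] at h3
      simp only
      rw [← h3, sub_add_cancel, Real.sqrt_sq h4.le]
    ext α
    refine Fin.cases ?_ (fun i => ?_) α
    · exact h6
    · rfl
  refine ⟨WithLp.toLp 2 fun i : Fin 3 => a i.succ, ?_⟩
  ext i
  rw [boost_apply, fluidMomentum, h5, h2, neg_neg]

/-! ### Lorentz invariance of `d³p / p⁰` -/

/-- The spatial part of the four-velocity. -/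
def spatialVelocity (u : EuclideanSpace ℝ (Fin 3)) : EuclideanSpace ℝ (Fin 3) :=
  fourVelocity u 0 • u

lemma boost_eq (u : EuclideanSpace ℝ (Fin 3)) (p : Momentum) :
    boost u p = p + ((fourVelocity u 0 + 1)⁻¹ * inner ℝ (spatialVelocity u) p - √(1 + ‖p‖ ^ 2))
      • spatialVelocity u := by
  ext i
  simp only [boost_apply, fluidMomentum, minkowski, tetrad, Fin.cons_zero, Fin.cons_succ,
    fourMomentum_zero, fourMomentum_succ, spatialVelocity, fourVelocity_succ, inner_smul_left,
    PiLp.inner_apply, PiLp.add_apply, PiLp.smul_apply, smul_eq_mul, add_mul, Finset.sum_add_distrib,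
    ite_mul, one_mul, zero_mul, Finset.sum_ite_eq, Finset.mem_univ, if_true, Fin.sum_univ_three,
    RCLike.inner_apply, conj_trivial]
  ring

lemma hasFDerivAt_boost (u : EuclideanSpace ℝ (Fin 3)) (p : Momentum) :
    HasFDerivAt (boost u) (ContinuousLinearMap.id ℝ Momentum
      + ((fourVelocity u 0 + 1)⁻¹ • innerSL ℝ (spatialVelocity u)
        - (1 / √(1 + ‖p‖ ^ 2)) • innerSL ℝ p).smulRight (spatialVelocity u)) p := by
  have h0 : boost u = fun p => p + ((fourVelocity u 0 + 1)⁻¹ * inner ℝ (spatialVelocity u) p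
      - √(1 + ‖p‖ ^ 2)) • spatialVelocity u := by
    ext1 p; exact boost_eq u p
  rw [h0]
  have h1 : HasFDerivAt (fun p : Momentum => √(1 + ‖p‖ ^ 2))
      ((1 / √(1 + ‖p‖ ^ 2)) • innerSL ℝ p) p := by
    have h2 := ((hasStrictFDerivAt_norm_sq p).hasFDerivAt.const_add 1).sqrt
      (by positivity : (1 + ‖p‖ ^ 2) ≠ 0)
    refine h2.congr_fderiv ?_
    ext v
    simp
    field_simp
  have h3 : HasFDerivAt (fun p : Momentum => (fourVelocity u 0 + 1)⁻¹
      * inner ℝ (spatialVelocity u) p)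
      ((fourVelocity u 0 + 1)⁻¹ • innerSL ℝ (spatialVelocity u)) p :=
    ((innerSL ℝ (spatialVelocity u)).hasFDerivAt).const_mul _
  exact (hasFDerivAt_id p).add ((h3.sub h1).smul_const _)

/-- The Jacobian of the boost. The derivative is the identity plus a map of rank one `v ↦ f v • w`,
so its determinant is `1 + f w`. -/
lemma det_fderiv_boost (hu : ‖u‖ < 1) (p : Momentum) :
    (ContinuousLinearMap.id ℝ Momentum
      + ((fourVelocity u 0 + 1)⁻¹ • innerSL ℝ (spatialVelocity u)
        - (1 / √(1 + ‖p‖ ^ 2)) • innerSL ℝ p).smulRight (spatialVelocity u)).det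
      = fluidEnergy u p / √(1 + ‖p‖ ^ 2) := by
  set f := (fourVelocity u 0 + 1)⁻¹ • innerSL ℝ (spatialVelocity u)
        - (1 / √(1 + ‖p‖ ^ 2)) • innerSL ℝ p with hf
  have h1 : ((ContinuousLinearMap.id ℝ Momentum + f.smulRight (spatialVelocity u)
      : Momentum →L[ℝ] Momentum) : Momentum →ₗ[ℝ] Momentum)
      = LinearMap.transvection (f : Momentum →ₗ[ℝ] ℝ) (spatialVelocity u) := by
    ext1 v
    rfl
  rw [ContinuousLinearMap.det, h1, LinearMap.transvection.det]
  have h2 := sum_fourVelocity_sq_div hu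
  have h3 := fourVelocity_zero_pos hu
  have h4 : ‖spatialVelocity u‖ ^ 2 / (fourVelocity u 0 + 1) = fourVelocity u 0 - 1 := by
    rw [← h2, EuclideanSpace.real_norm_sq_eq, Fin.sum_univ_three]
    simp only [spatialVelocity, PiLp.smul_apply, smul_eq_mul, ← fourVelocity_succ]
    rfl
  have h5 : fluidEnergy u p
      = fourVelocity u 0 * √(1 + ‖p‖ ^ 2) - inner ℝ p (spatialVelocity u) := by
    simp only [fluidEnergy, minkowski, fourMomentum_zero, fourMomentum_succ, spatialVelocity,
      PiLp.inner_apply, PiLp.smul_apply, smul_eq_mul, fourVelocity_succ, RCLike.inner_apply,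
      conj_trivial]
  have h6 : 0 < √(1 + ‖p‖ ^ 2) := by positivity
  rw [ContinuousLinearMap.coe_coe, hf, h5]
  simp only [sub_apply, smul_apply, innerSL_apply_apply,
    real_inner_self_eq_norm_sq, smul_eq_mul]
  rw [inv_mul_eq_div, h4]
  field_simp
  ring

/-- The Lorentz invariant measure `d³p / p⁰`. -/
def invMeasure : Measure Momentum :=
  volume.withDensity fun p => ((Real.toNNReal (1 / √(1 + ‖p‖ ^ 2)) : NNReal) : ENNReal)

lemma integral_invMeasure (f : Momentum → ℝ) :
    ∫ p, f p ∂invMeasure = ∫ p, f p / √(1 + ‖p‖ ^ 2) := by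
  unfold invMeasure
  rw [integral_withDensity_eq_integral_smul (by fun_prop)]
  congr 1
  ext p
  rw [NNReal.smul_def, Real.coe_toNNReal _ (by positivity), smul_eq_mul]
  ring

lemma integrable_invMeasure_iff {f : Momentum → ℝ} :
    Integrable f invMeasure ↔ Integrable fun p => f p / √(1 + ‖p‖ ^ 2) := by
  unfold invMeasure
  rw [integrable_withDensity_iff_integrable_smul (by fun_prop)]
  have : (fun p => (1 / √(1 + ‖p‖ ^ 2)).toNNReal • f p) = fun p => f p / √(1 + ‖p‖ ^ 2) := by
    ext p
    rw [NNReal.smul_def, Real.coe_toNNReal _ (by positivity), smul_eq_mul]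
    ring
  rw [this]

/-- The measure `d³p / p⁰` is invariant under the boost to the rest frame: the Jacobian of the
boost is the ratio of the energies. -/
lemma integral_comp_boost (hu : ‖u‖ < 1) (F : Momentum → ℝ) :
    ∫ p, F (boost u p) ∂invMeasure = ∫ q, F q ∂invMeasure := by
  have h := integral_image_eq_integral_abs_det_fderiv_smul volume MeasurableSet.univ
    (fun p _ => (hasFDerivAt_boost u p).hasFDerivWithinAt) (boost_injective hu).injOn
    (fun q => F q / √(1 + ‖q‖ ^ 2))
  rw [Set.image_univ, (boost_surjective hu).range_eq] at h
  simp only [Measure.restrict_univ] at h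
  rw [integral_invMeasure, integral_invMeasure, h]
  congr 1
  ext p
  have hE := fluidEnergy_pos hu p
  rw [det_fderiv_boost hu, ← fluidEnergy_eq_sqrt hu, abs_of_pos (by positivity), smul_eq_mul]
  field_simp

end Tetrad

/-! ### Polynomials in the four-momentum -/

/-- Functions of the momentum that are polynomials in the components of the four-momentum. -/
def momentumPolynomials : Subalgebra ℝ (Momentum → ℝ) :=
  Algebra.adjoin ℝ (Set.range fun (α : Fin 4) (p : Momentum) => fourMomentum p α)

lemma fourMomentum_mem (α : Fin 4) : (fun p => fourMomentum p α) ∈ momentumPolynomials :=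
  Algebra.subset_adjoin ⟨α, rfl⟩

lemma const_mem_momentumPolynomials (c : ℝ) : (fun _ => c) ∈ momentumPolynomials :=
  momentumPolynomials.algebraMap_mem c

lemma minkowski_mem (a : Fin 4 → ℝ) :
    (fun p => minkowski a (fourMomentum p)) ∈ momentumPolynomials := by
  have : (fun p => minkowski a (fourMomentum p)) = (fun p : Momentum => a 0 * fourMomentum p 0
      - ∑ i : Fin 3, a i.succ * fourMomentum p i.succ) := rfl
  rw [this]
  have h : ∀ α, (fun p => a α * fourMomentum p α) ∈ momentumPolynomials := fun α =>
    momentumPolynomials.mul_mem (const_mem_momentumPolynomials _) (fourMomentum_mem α)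
  have h2 := momentumPolynomials.sub_mem (h 0)
    (momentumPolynomials.sum_mem (t := Finset.univ) fun (i : Fin 3) _ => h i.succ)
  convert h2 using 1
  ext p
  simp

lemma continuous_fourMomentum (α : Fin 4) : Continuous fun p : Momentum => fourMomentum p α := by
  refine Fin.cases ?_ (fun i => ?_) α
  · simp only [fourMomentum_zero]; fun_prop
  · simp only [fourMomentum_succ]; fun_prop

lemma abs_fourMomentum_le (p : Momentum) (α : Fin 4) : |fourMomentum p α| ≤ fourMomentum p 0 := by
  refine Fin.cases ?_ (fun i => ?_) α
  · rw [abs_of_pos (fourMomentum_zero_pos p)]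
  · rw [fourMomentum_succ, fourMomentum_zero]
    apply Real.le_sqrt_of_sq_le
    have := PiLp.norm_apply_le p i
    rw [Real.norm_eq_abs] at this
    nlinarith [abs_nonneg (p i)]

lemma one_le_fourMomentum_zero (p : Momentum) : 1 ≤ fourMomentum p 0 := by
  rw [fourMomentum_zero, Real.one_le_sqrt]
  nlinarith [sq_nonneg ‖p‖]

/-- A polynomial in the four-momentum is continuous and grows at most like a power of the energy. -/
lemma momentumPolynomials_bound {f : Momentum → ℝ} (hf : f ∈ momentumPolynomials) :
    Continuous f ∧ ∃ (C : ℝ) (N : ℕ), 0 ≤ C ∧ ∀ p, |f p| ≤ C * fourMomentum p 0 ^ N := by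
  induction hf using Algebra.adjoin_induction with
  | mem f hf =>
    obtain ⟨α, rfl⟩ := hf
    exact ⟨continuous_fourMomentum α, 1, 1, zero_le_one, fun p => by
      simpa using abs_fourMomentum_le p α⟩
  | algebraMap c =>
    exact ⟨continuous_const, |c|, 0, abs_nonneg c, fun p => by
      rw [pow_zero, mul_one]; exact le_refl |c|⟩
  | add f g _ _ hf hg =>
    obtain ⟨hfc, C, N, hC, hfb⟩ := hf
    obtain ⟨hgc, C', N', hC', hgb⟩ := hg
    refine ⟨hfc.add hgc, C + C', N + N', add_nonneg hC hC', fun p => ?_⟩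
    have h1 := one_le_fourMomentum_zero p
    calc |f p + g p| ≤ |f p| + |g p| := abs_add_le _ _
      _ ≤ C * fourMomentum p 0 ^ N + C' * fourMomentum p 0 ^ N' := add_le_add (hfb p) (hgb p)
      _ ≤ C * fourMomentum p 0 ^ (N + N') + C' * fourMomentum p 0 ^ (N + N') := by
          gcongr <;> first | exact h1 | omega
      _ = _ := by ring
  | mul f g _ _ hf hg =>
    obtain ⟨hfc, C, N, hC, hfb⟩ := hf
    obtain ⟨hgc, C', N', hC', hgb⟩ := hg
    refine ⟨hfc.mul hgc, C * C', N + N', mul_nonneg hC hC', fun p => ?_⟩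
    have h0 := (fourMomentum_zero_pos p).le
    calc |f p * g p| = |f p| * |g p| := abs_mul _ _
      _ ≤ (C * fourMomentum p 0 ^ N) * (C' * fourMomentum p 0 ^ N') :=
          mul_le_mul (hfb p) (hgb p) (abs_nonneg _) (by positivity)
      _ = _ := by ring

lemma integrable_pow_mul_exp_neg (N : ℕ) {c : ℝ} (hc : 0 < c) :
    Integrable (fun p => fourMomentum p 0 ^ N * Real.exp (-(c * fourMomentum p 0))) invMeasure := by
  rw [integrable_invMeasure_iff]
  have hcont := continuous_fourMomentum 0
  -- `(c p⁰)^{N + 4} / (N + 4)! ≤ e^{c p⁰}`, and `(1 + |p|)^{-4}` is integrable on `ℝ³`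
  set K : ℝ := ((N + 4).factorial : ℝ) / c ^ (N + 4) * 2 ^ 4 with hK
  have h1 : Integrable fun p : Momentum => K * (1 + ‖p‖) ^ (-(4 : ℝ)) :=
    (integrable_one_add_norm (by simp; norm_num)).const_mul _
  refine h1.mono' ?_ (Filter.Eventually.of_forall fun p => ?_)
  · have hc2 : Continuous fun p : Momentum =>
        fourMomentum p 0 ^ N * Real.exp (-(c * fourMomentum p 0))
        / √(1 + ‖p‖ ^ 2) := by
      refine Continuous.div (by fun_prop) (by fun_prop) fun p => ?_
      positivity
    exact hc2.aestronglyMeasurable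
  · rw [← fourMomentum_zero]
    set x := fourMomentum p 0 with hx
    have hx1 : 1 ≤ x := one_le_fourMomentum_zero p
    have hx0 : 0 < x := fourMomentum_zero_pos p
    have hn : 1 + ‖p‖ ≤ 2 * x := by
      have : ‖p‖ ≤ x := by
        rw [hx, fourMomentum_zero]
        exact Real.le_sqrt_of_sq_le (by linarith)
      linarith
    have hexp : (c * x) ^ (N + 4) / ((N + 4).factorial : ℝ) ≤ Real.exp (c * x) :=
      Real.pow_div_factorial_le_exp (c * x) (by positivity) (N + 4)
    rw [Real.norm_of_nonneg (by positivity), Real.exp_neg, Real.rpow_neg (by positivity),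
      show (4 : ℝ) = ((4 : ℕ) : ℝ) by norm_num, Real.rpow_natCast]
    have hE : 0 < Real.exp (c * x) := Real.exp_pos _
    have h2 : x ^ N * (Real.exp (c * x))⁻¹ ≤ ((N + 4).factorial : ℝ) / c ^ (N + 4) * (x ^ 4)⁻¹ := by
      rw [div_le_iff₀ (by positivity), mul_pow] at hexp
      rw [← div_eq_mul_inv, ← div_eq_mul_inv, div_div, div_le_div_iff₀ hE (by positivity)]
      calc x ^ N * (c ^ (N + 4) * x ^ 4) = c ^ (N + 4) * x ^ (N + 4) := by ring
        _ ≤ _ := by linarith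
    calc x ^ N * (Real.exp (c * x))⁻¹ / x ≤ x ^ N * (Real.exp (c * x))⁻¹ :=
          div_le_self (by positivity) hx1
      _ ≤ ((N + 4).factorial : ℝ) / c ^ (N + 4) * (x ^ 4)⁻¹ := h2
      _ = K * ((2 * x) ^ 4)⁻¹ := by rw [hK, mul_pow]; field_simp
      _ ≤ K * ((1 + ‖p‖) ^ 4)⁻¹ := by gcongr

lemma integrable_mul_exp_neg_energy {f : Momentum → ℝ} (hf : f ∈ momentumPolynomials) {c : ℝ}
    (hc : 0 < c) :
    Integrable (fun p => f p * Real.exp (-(c * fourMomentum p 0))) invMeasure := by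
  obtain ⟨hcont, C, N, hC, hb⟩ := momentumPolynomials_bound hf
  have h0 := continuous_fourMomentum 0
  refine ((integrable_pow_mul_exp_neg N hc).const_mul C).mono'
    (Continuous.aestronglyMeasurable (by fun_prop)) (Filter.Eventually.of_forall fun p => ?_)
  rw [norm_mul, Real.norm_of_nonneg (Real.exp_pos _).le, ← mul_assoc]
  gcongr
  exact hb p

/-- The interior of the dual of the future light cone: four-vectors `β` with `β_α p^α ≥ c p⁰` for
some `c > 0`. These are the `β` for which `e^{-β p}` is integrable against polynomials. -/
def FutureTimelike (β : Fin 4 → ℝ) : Prop :=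
  ∃ c : ℝ, 0 < c ∧ ∀ p, c * fourMomentum p 0 ≤ minkowski β (fourMomentum p)

lemma FutureTimelike.smul {β : Fin 4 → ℝ} (h : FutureTimelike β) {r : ℝ} (hr : 0 < r) :
    FutureTimelike (r • β) := by
  obtain ⟨c, hc, h⟩ := h
  refine ⟨r * c, mul_pos hr hc, fun p => ?_⟩
  rw [minkowski_smul_left, mul_assoc]
  exact mul_le_mul_of_nonneg_left (h p) hr.le

lemma futureTimelike_fourVelocity {u : EuclideanSpace ℝ (Fin 3)} (hu : ‖u‖ < 1) :
    FutureTimelike (fourVelocity u) := by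
  have h0 := fourVelocity_zero_pos hu
  refine ⟨fourVelocity u 0 * (1 - ‖u‖), mul_pos h0 (by linarith), fun p => ?_⟩
  have h1 : minkowski (fourVelocity u) (fourMomentum p)
      = fourVelocity u 0 * (fourMomentum p 0 - inner ℝ p u) := by
    simp only [minkowski, fourVelocity_succ, fourMomentum_succ, PiLp.inner_apply,
      RCLike.inner_apply, conj_trivial, mul_sub, Finset.mul_sum, mul_assoc]
  have h2 : inner ℝ p u ≤ fourMomentum p 0 * ‖u‖ := by
    refine (real_inner_le_norm p u).trans ?_
    gcongr
    rw [fourMomentum_zero]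
    exact Real.le_sqrt_of_sq_le (by linarith)
  rw [h1, mul_assoc]
  gcongr
  linarith

lemma continuous_minkowski_fourMomentum (β : Fin 4 → ℝ) :
    Continuous fun p => minkowski β (fourMomentum p) :=
  (momentumPolynomials_bound (minkowski_mem β)).1

lemma integrable_mul_exp_neg_minkowski {f : Momentum → ℝ} (hf : f ∈ momentumPolynomials)
    {β : Fin 4 → ℝ} (hβ : FutureTimelike β) :
    Integrable (fun p => f p * Real.exp (-(minkowski β (fourMomentum p)))) invMeasure := by
  obtain ⟨c, hc, h⟩ := hβ
  have hcont := (momentumPolynomials_bound hf).1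
  have h0 := continuous_minkowski_fourMomentum β
  refine (integrable_mul_exp_neg_energy hf hc).mono
    (Continuous.aestronglyMeasurable (by fun_prop)) (Filter.Eventually.of_forall fun p => ?_)
  rw [norm_mul, norm_mul, Real.norm_of_nonneg (Real.exp_pos _).le,
    Real.norm_of_nonneg (Real.exp_pos _).le]
  gcongr
  exact h p

/-- The linear form `β ↦ β_α p^α`. -/
def minkowskiForm (p : Momentum) : (Fin 4 → ℝ) →L[ℝ] ℝ :=
  fourMomentum p 0 • ContinuousLinearMap.proj 0
    - ∑ i : Fin 3, fourMomentum p i.succ • ContinuousLinearMap.proj i.succ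

lemma minkowskiForm_apply (p : Momentum) (β : Fin 4 → ℝ) :
    minkowskiForm p β = minkowski β (fourMomentum p) := by
  simp [minkowskiForm, minkowski, Fin.sum_univ_three, mul_comm]

/-- The exponential integrals `∫ f e^{-β p} d³p / p⁰` are differentiable with respect to `β`. -/
lemma hasFDerivAt_integral_exp_neg_minkowski {f : Momentum → ℝ} (hf : f ∈ momentumPolynomials)
    {β : Fin 4 → ℝ} (hβ : FutureTimelike β) :
    ∃ J : (Fin 4 → ℝ) →L[ℝ] ℝ,
      HasFDerivAt (fun b => ∫ p, f p * Real.exp (-(minkowski b (fourMomentum p))) ∂invMeasure) J β ∧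
      ∀ v, J v = ∫ p, -(minkowski v (fourMomentum p)) *
        (f p * Real.exp (-(minkowski β (fourMomentum p)))) ∂invMeasure := by
  have hcont := (momentumPolynomials_bound hf).1
  have hL : Continuous minkowskiForm := by
    have := continuous_fourMomentum
    unfold minkowskiForm
    fun_prop
  have hnorm : ∀ p, ‖minkowskiForm p‖ ≤ 4 * fourMomentum p 0 := by
    intro p
    refine ContinuousLinearMap.opNorm_le_bound _ (by have := fourMomentum_zero_pos p; positivity)
      fun v => ?_
    rw [minkowskiForm_apply, minkowski, Fin.sum_univ_three, Real.norm_eq_abs]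
    have hb : ∀ α, |v α * fourMomentum p α| ≤ ‖v‖ * fourMomentum p 0 := by
      intro α
      rw [abs_mul]
      exact mul_le_mul (norm_le_pi_norm v α) (abs_fourMomentum_le p α) (abs_nonneg _)
        (norm_nonneg _)
    have b0 := abs_le.1 (hb 0)
    have b1 := abs_le.1 (hb (Fin.succ 0))
    have b2 := abs_le.1 (hb (Fin.succ 1))
    have b3 := abs_le.1 (hb (Fin.succ 2))
    rw [abs_le]
    constructor <;> linarith [b0.1, b0.2, b1.1, b1.2, b2.1, b2.2, b3.1, b3.2]
  obtain ⟨c, hc, h⟩ := id hβ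
  have key := hasFDerivAt_integral_mul_exp_neg (ν := invMeasure) (f := f)
    (X := fun p => 4 * fourMomentum p 0) (L := minkowskiForm) (β := β) (c := c / 4)
    (by positivity) hcont.aestronglyMeasurable hL.aestronglyMeasurable
    (Filter.Eventually.of_forall fun p => by have := fourMomentum_zero_pos p; positivity)
    (Filter.Eventually.of_forall hnorm)
    (Filter.Eventually.of_forall fun p => by
      rw [minkowskiForm_apply]
      have := h p
      linarith)
    (fun ε hε => by
      have := integrable_mul_exp_neg_energy hf (c := ε * 4) (by positivity)
      simpa only [mul_assoc] using this)
  simp only [minkowskiForm_apply] at key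
  refine ⟨_, key, fun v => ?_⟩
  rw [ContinuousLinearMap.integral_apply]
  · refine integral_congr_ae (Filter.Eventually.of_forall fun p => ?_)
    simp only [smul_apply, minkowskiForm_apply, smul_eq_mul]
    ring
  · obtain ⟨C, N, hC, hb⟩ := (momentumPolynomials_bound hf).2
    have h0 := continuous_minkowski_fourMomentum β
    have hi := integrable_mul_exp_neg_minkowski (momentumPolynomials.mul_mem hf
      (momentumPolynomials.mul_mem (const_mem_momentumPolynomials 4) (fourMomentum_mem 0))) hβ
    refine hi.mono (Continuous.aestronglyMeasurable (by fun_prop))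
      (Filter.Eventually.of_forall fun p => ?_)
    rw [norm_smul, norm_neg]
    simp only [Pi.mul_apply, norm_mul]
    have h1 := hnorm p
    have h2 := fourMomentum_zero_pos p
    rw [Real.norm_of_nonneg h2.le, Real.norm_of_nonneg (show (0 : ℝ) ≤ 4 by norm_num)]
    calc ‖f p‖ * ‖Real.exp (-(minkowski β (fourMomentum p)))‖ * ‖minkowskiForm p‖
        ≤ ‖f p‖ * ‖Real.exp (-(minkowski β (fourMomentum p)))‖ * (4 * fourMomentum p 0) := by gcongr
      _ = _ := by ring

/-- A function vanishes almost everywhere if the integral of its square against a positive weight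
vanishes. -/
lemma ae_eq_zero_of_integral_sq_eq_zero {f w : Momentum → ℝ} (hw : ∀ p, 0 < w p)
    (hint : Integrable (fun p => w p * f p ^ 2) invMeasure)
    (h : ∫ p, w p * f p ^ 2 ∂invMeasure = 0) : ∀ᵐ p ∂invMeasure, f p = 0 := by
  rw [integral_eq_zero_iff_of_nonneg (fun p => mul_nonneg (hw p).le (sq_nonneg _)) hint] at h
  filter_upwards [h] with p hp
  have := (mul_eq_zero.1 hp).resolve_left (hw p).ne'
  exact pow_eq_zero_iff two_ne_zero |>.1 this

/-! ### Solid harmonics are polynomials -/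

/-- Parity of the derivatives of `(X² - 1)^ℓ`. It makes the solid harmonics polynomials: only even
powers of `|q|` appear in their homogenization. -/
lemma legendreFactor_coeff_eq_zero {ℓ m j : ℕ} (h : ¬ 2 ∣ j + (ℓ + m)) :
    (legendreFactor ℓ m).coeff j = 0 := by
  have h1 : ((X ^ 2 - 1 : ℝ[X]) ^ ℓ) = expand ℝ 2 ((X - 1) ^ ℓ) := by simp
  rw [legendreFactor, coeff_iterate_derivative, h1, coeff_expand two_pos, if_neg h, smul_zero]

/-- The homogeneous polynomial `ρ^k cos (k φ)` or `ρ^k sin (k φ)`, `k = |m|`, that corresponds to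
the azimuthal factor. -/
def azimuthalPoly (m : ℤ) (x y : ℝ) : ℝ :=
  if m < 0 then √2 * ((⟨x, y⟩ : ℂ) ^ m.natAbs).im
  else if m = 0 then 1
  else √2 * ((⟨x, y⟩ : ℂ) ^ m.natAbs).re

lemma norm_pow_mul_azimuthal_arg (m : ℤ) (x y : ℝ) :
    √(x ^ 2 + y ^ 2) ^ m.natAbs * azimuthal m (Complex.arg ⟨x, y⟩) = azimuthalPoly m x y := by
  set z : ℂ := ⟨x, y⟩ with hz
  have hn : √(x ^ 2 + y ^ 2) = ‖z‖ := by
    rw [Complex.norm_def, Complex.normSq_apply]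
    simp [hz, sq]
  have hpow : ∀ k : ℕ, z ^ k = ((‖z‖ ^ k * Real.cos (k * z.arg) : ℝ) : ℂ)
      + ((‖z‖ ^ k * Real.sin (k * z.arg) : ℝ) : ℂ) * Complex.I := by
    intro k
    conv_lhs => rw [← Complex.norm_mul_exp_arg_mul_I z, mul_pow, ← Complex.exp_nat_mul, ← mul_assoc,
      Complex.exp_mul_I]
    push_cast
    ring
  have hre : ∀ k : ℕ, (z ^ k).re = ‖z‖ ^ k * Real.cos (k * z.arg) := by
    intro k
    rw [hpow k, Complex.add_re, Complex.mul_re, Complex.I_re, Complex.I_im, Complex.ofReal_im,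
      Complex.ofReal_re]
    ring
  have him : ∀ k : ℕ, (z ^ k).im = ‖z‖ ^ k * Real.sin (k * z.arg) := by
    intro k
    rw [hpow k, Complex.add_im, Complex.mul_im, Complex.I_re, Complex.I_im, Complex.ofReal_im,
      Complex.ofReal_re]
    ring
  rw [hn]
  unfold azimuthal azimuthalPoly
  split_ifs with h1 h2
  · rw [him]; ring
  · simp [h2]
  · rw [hre]; ring

lemma solidHarmonic_eq_boost {u : EuclideanSpace ℝ (Fin 3)} (hu : ‖u‖ < 1) (ℓ : ℕ) (m : ℤ)
    (p : Momentum) : solidHarmonic ℓ m u p = ‖boost u p‖ ^ ℓ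
      * (normLegendre ℓ m.natAbs (boost u p 2 / ‖boost u p‖)
        * azimuthal m (Complex.arg ⟨boost u p 0, boost u p 1⟩)) := by
  unfold solidHarmonic
  rw [sqrt_fluidEnergy_sq_sub_one hu, realSphericalHarmonic_eq]
  rfl

/-- The solid harmonics are homogeneous polynomials in the components of the spatial momentum: only
even powers of its length occur, by the parity of the Legendre functions. -/
lemma solidHarmonic_eq_poly {u : EuclideanSpace ℝ (Fin 3)} (hu : ‖u‖ < 1) {ℓ : ℕ} {m : ℤ}
    (hm : m.natAbs ≤ ℓ) (p : Momentum) :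
    solidHarmonic ℓ m u p = legendreConst ℓ m.natAbs
      * azimuthalPoly m (fluidMomentum u p 0) (fluidMomentum u p 1)
      * ∑ j ∈ Finset.range (ℓ - m.natAbs + 1), (legendreFactor ℓ m.natAbs).coeff j
          * (fluidMomentum u p 2 ^ j * (fluidEnergy u p ^ 2 - 1) ^ ((ℓ - m.natAbs - j) / 2)) := by
  rw [solidHarmonic_eq_boost hu]
  set q := boost u p with hq
  have hE : fluidEnergy u p ^ 2 - 1 = ‖q‖ ^ 2 := by rw [fluidEnergy_sq hu]; ring
  have hq0 : fluidMomentum u p 0 = q 0 := rfl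
  have hq1 : fluidMomentum u p 1 = q 1 := rfl
  have hq2 : fluidMomentum u p 2 = q 2 := rfl
  rw [hE, hq0, hq1, hq2]
  set k := m.natAbs with hk
  have hnorm : ‖q‖ ^ 2 = q 0 ^ 2 + q 1 ^ 2 + q 2 ^ 2 := by
    rw [EuclideanSpace.real_norm_sq_eq, Fin.sum_univ_three]
  have h1 : ‖q‖ * √(1 - (q 2 / ‖q‖) ^ 2) = √(q 0 ^ 2 + q 1 ^ 2) := by
    by_cases h0 : ‖q‖ = 0
    · have : q = 0 := norm_eq_zero.1 h0
      simp [this]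
    · have hpos : 0 < ‖q‖ := lt_of_le_of_ne (norm_nonneg _) (Ne.symm h0)
      rw [eq_comm, Real.sqrt_eq_iff_mul_self_eq (by positivity) (by positivity)]
      have h2 : 0 ≤ 1 - (q 2 / ‖q‖) ^ 2 := by
        rw [div_pow, sub_nonneg, div_le_one (by positivity), hnorm]
        nlinarith [sq_nonneg (q 0), sq_nonneg (q 1)]
      symm
      calc ‖q‖ * √(1 - (q 2 / ‖q‖) ^ 2) * (‖q‖ * √(1 - (q 2 / ‖q‖) ^ 2))
          = ‖q‖ ^ 2 * (√(1 - (q 2 / ‖q‖) ^ 2) * √(1 - (q 2 / ‖q‖) ^ 2)) := by ring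
        _ = ‖q‖ ^ 2 - q 2 ^ 2 := by rw [Real.mul_self_sqrt h2]; field_simp
        _ = _ := by rw [hnorm]; ring
  have h2 : ‖q‖ * (q 2 / ‖q‖) = q 2 := by
    by_cases h0 : ‖q‖ = 0
    · have : q = 0 := norm_eq_zero.1 h0
      simp [this]
    · field_simp
  have hlt : (legendreFactor ℓ k).natDegree < ℓ - k + 1 :=
    Nat.lt_succ_of_le (natDegree_legendreFactor_le ℓ k)
  rw [normLegendre_eq, eval_eq_sum_range' hlt, ← norm_pow_mul_azimuthal_arg, ← hk, ← h1]
  have hsum : ‖q‖ ^ (ℓ - k) * ∑ j ∈ Finset.range (ℓ - k + 1), (legendreFactor ℓ k).coeff j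
        * (q 2 / ‖q‖) ^ j
      = ∑ j ∈ Finset.range (ℓ - k + 1), (legendreFactor ℓ k).coeff j
          * (q 2 ^ j * (‖q‖ ^ 2) ^ ((ℓ - k - j) / 2)) := by
    rw [Finset.mul_sum]
    refine Finset.sum_congr rfl fun j hj => ?_
    rw [Finset.mem_range] at hj
    by_cases hpar : 2 ∣ j + (ℓ + k)
    · have e1 : 2 * ((ℓ - k - j) / 2) = ℓ - k - j := by omega
      rw [← pow_mul, e1, ← h2, mul_pow, h2]
      conv_lhs => rw [show ℓ - k = j + (ℓ - k - j) by omega, pow_add]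
      ring
    · rw [legendreFactor_coeff_eq_zero hpar]; ring
  rw [← hsum, mul_pow, show ‖q‖ ^ ℓ = ‖q‖ ^ k * ‖q‖ ^ (ℓ - k) by rw [← pow_add]; congr 1; omega]
  ring

/-! ### Families of polynomials with differentiable coefficients -/

section Families

open Filter Topology

variable {V : Type*} [NormedAddCommGroup V] [NormedSpace ℝ V] {w₀ : V}

/-- Near `w₀`, the functions `G w` are polynomials in the four-momentum whose coefficients are
functions of `w` that are differentiable at `w₀`. -/
def IsPolyFamily (w₀ : V) (G : V → Momentum → ℝ) : Prop :=
  ∃ (ι : Type) (_ : Fintype ι) (a : ι → V → ℝ) (f : ι → Momentum → ℝ),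
    (∀ i, DifferentiableAt ℝ (a i) w₀) ∧ (∀ i, f i ∈ momentumPolynomials) ∧
    ∀ᶠ w in 𝓝 w₀, ∀ p, G w p = ∑ i, a i w * f i p

namespace IsPolyFamily

lemma congr {G H : V → Momentum → ℝ} (h : IsPolyFamily w₀ G)
    (hGH : ∀ᶠ w in 𝓝 w₀, ∀ p, H w p = G w p) : IsPolyFamily w₀ H := by
  obtain ⟨ι, _, a, f, ha, hf, h⟩ := h
  refine ⟨ι, inferInstance, a, f, ha, hf, ?_⟩
  filter_upwards [h, hGH] with w h1 h2 p
  rw [h2, h1]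

lemma coeff_mul {a : V → ℝ} (ha : DifferentiableAt ℝ a w₀) {f : Momentum → ℝ}
    (hf : f ∈ momentumPolynomials) : IsPolyFamily w₀ fun w p => a w * f p :=
  ⟨Unit, inferInstance, fun _ => a, fun _ => f, fun _ => ha, fun _ => hf,
    Eventually.of_forall fun w p => by simp⟩

lemma of_coeff {a : V → ℝ} (ha : DifferentiableAt ℝ a w₀) : IsPolyFamily w₀ fun w _ => a w :=
  (coeff_mul ha (const_mem_momentumPolynomials 1)).congr (Eventually.of_forall fun w p => by simp)

lemma const (c : ℝ) : IsPolyFamily w₀ fun _ _ => c := of_coeff (differentiableAt_const c)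

lemma add {G H : V → Momentum → ℝ} (hG : IsPolyFamily w₀ G) (hH : IsPolyFamily w₀ H) :
    IsPolyFamily w₀ fun w p => G w p + H w p := by
  obtain ⟨ι, _, a, f, ha, hf, hG⟩ := hG
  obtain ⟨κ, _, b, g, hb, hg, hH⟩ := hH
  refine ⟨ι ⊕ κ, inferInstance, Sum.elim a b, Sum.elim f g, ?_, ?_, ?_⟩
  · rintro (i | i)
    · exact ha i
    · exact hb i
  · rintro (i | i)
    · exact hf i
    · exact hg i
  · filter_upwards [hG, hH] with w h1 h2 p
    simp [h1, h2, Fintype.sum_sum_type]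

lemma mul {G H : V → Momentum → ℝ} (hG : IsPolyFamily w₀ G) (hH : IsPolyFamily w₀ H) :
    IsPolyFamily w₀ fun w p => G w p * H w p := by
  obtain ⟨ι, _, a, f, ha, hf, hG⟩ := hG
  obtain ⟨κ, _, b, g, hb, hg, hH⟩ := hH
  refine ⟨ι × κ, inferInstance, fun i w => a i.1 w * b i.2 w, fun i p => f i.1 p * g i.2 p,
    fun i => (ha i.1).mul (hb i.2), fun i => momentumPolynomials.mul_mem (hf i.1) (hg i.2), ?_⟩
  filter_upwards [hG, hH] with w h1 h2 p
  rw [h1, h2, Fintype.sum_mul_sum, Fintype.sum_prod_type]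
  refine Finset.sum_congr rfl fun i _ => Finset.sum_congr rfl fun j _ => by ring

lemma sum {κ : Type*} (s : Finset κ) {G : κ → V → Momentum → ℝ}
    (hG : ∀ i ∈ s, IsPolyFamily w₀ (G i)) : IsPolyFamily w₀ fun w p => ∑ i ∈ s, G i w p := by
  classical
  induction s using Finset.induction_on with
  | empty => exact const 0
  | insert i s his ih =>
    refine ((hG i (Finset.mem_insert_self i s)).add
      (ih fun j hj => hG j (Finset.mem_insert_of_mem hj))).congr
      (Eventually.of_forall fun w p => ?_)
    rw [Finset.sum_insert his]

lemma pow {G : V → Momentum → ℝ} (hG : IsPolyFamily w₀ G) (n : ℕ) :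
    IsPolyFamily w₀ fun w p => G w p ^ n := by
  induction n with
  | zero => simpa using const (V := V) (w₀ := w₀) 1
  | succ n ih => simpa only [pow_succ] using ih.mul hG

lemma mem {G : V → Momentum → ℝ} (hG : IsPolyFamily w₀ G) : G w₀ ∈ momentumPolynomials := by
  obtain ⟨ι, _, a, f, -, hf, h⟩ := hG
  have h1 := h.self_of_nhds
  have h2 : G w₀ = ∑ i, a i w₀ • f i := by
    ext p
    simp [h1 p]
  rw [h2]
  exact momentumPolynomials.sum_mem fun i _ => momentumPolynomials.smul_mem (hf i) _

lemma minkowski {b : V → Fin 4 → ℝ} (hb : ∀ α, DifferentiableAt ℝ (fun w => b w α) w₀) :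
    IsPolyFamily w₀ fun w p => minkowski (b w) (fourMomentum p) := by
  have h : ∀ α, IsPolyFamily w₀ fun w p => b w α * fourMomentum p α := fun α =>
    coeff_mul (hb α) (fourMomentum_mem α)
  refine ((h 0).add ((sum Finset.univ fun (i : Fin 3) _ => h i.succ).mul (const (-1)))).congr
    (Eventually.of_forall fun w p => ?_)
  simp only [RelMoment.minkowski]
  ring

end IsPolyFamily

variable {u : V → EuclideanSpace ℝ (Fin 3)} {ζ : V → ℝ}

lemma differentiableAt_fourVelocity (hu : ‖u w₀‖ < 1) (hdu : DifferentiableAt ℝ u w₀) (α : Fin 4) :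
    DifferentiableAt ℝ (fun w => fourVelocity (u w) α) w₀ := by
  have h := one_sub_norm_sq_pos hu
  have h0 : DifferentiableAt ℝ (fun w => fourVelocity (u w) 0) w₀ := by
    simp only [fourVelocity, Fin.cons_zero]
    have h1 : DifferentiableAt ℝ (fun w => √(1 - ‖u w‖ ^ 2)) w₀ :=
      ((differentiableAt_const _).sub (hdu.norm_sq ℝ)).sqrt h.ne'
    simp only [one_div]
    exact h1.fun_inv (Real.sqrt_pos.2 h).ne'
  refine Fin.cases h0 (fun i => ?_) α
  simp only [fourVelocity_succ]
  exact h0.mul ((EuclideanSpace.proj (𝕜 := ℝ) i).differentiableAt.comp w₀ hdu)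

lemma differentiableAt_tetrad (hu : ‖u w₀‖ < 1) (hdu : DifferentiableAt ℝ u w₀) (i : Fin 3)
    (α : Fin 4) : DifferentiableAt ℝ (fun w => tetrad (u w) i α) w₀ := by
  have h := differentiableAt_fourVelocity hu hdu
  have h0 := fourVelocity_zero_pos hu
  refine Fin.cases ?_ (fun j => ?_) α
  · simpa only [tetrad, Fin.cons_zero] using h i.succ
  · simp only [tetrad, Fin.cons_succ]
    have h1 : DifferentiableAt ℝ (fun w => fourVelocity (u w) 0 + 1) w₀ := (h 0).add_const _
    have h2 : fourVelocity (u w₀) 0 + 1 ≠ 0 := by positivity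
    simp only [div_eq_mul_inv]
    exact (((h i.succ).mul (h j.succ)).mul (h1.fun_inv h2)).add_const _

lemma isPolyFamily_fluidEnergy (hu : ‖u w₀‖ < 1) (hdu : DifferentiableAt ℝ u w₀) :
    IsPolyFamily w₀ fun w p => fluidEnergy (u w) p :=
  IsPolyFamily.minkowski (differentiableAt_fourVelocity hu hdu)

lemma isPolyFamily_fluidMomentum (hu : ‖u w₀‖ < 1) (hdu : DifferentiableAt ℝ u w₀) (i : Fin 3) :
    IsPolyFamily w₀ fun w p => fluidMomentum (u w) p i :=
  ((IsPolyFamily.minkowski (differentiableAt_tetrad hu hdu i)).mul (IsPolyFamily.const (-1))).congr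
    (Eventually.of_forall fun w p => by rw [fluidMomentum]; ring)

lemma isPolyFamily_azimuthalPoly {G H : V → Momentum → ℝ} (hG : IsPolyFamily w₀ G)
    (hH : IsPolyFamily w₀ H) (m : ℤ) :
    IsPolyFamily w₀ fun w p => azimuthalPoly m (G w p) (H w p) := by
  have key : ∀ k : ℕ, IsPolyFamily w₀ (fun w p => ((⟨G w p, H w p⟩ : ℂ) ^ k).re) ∧
      IsPolyFamily w₀ (fun w p => ((⟨G w p, H w p⟩ : ℂ) ^ k).im) := by
    intro k
    induction k with
    | zero => simpa using ⟨IsPolyFamily.const (w₀ := w₀) 1, IsPolyFamily.const (w₀ := w₀) 0⟩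
    | succ k ih =>
      constructor
      · refine ((ih.1.mul hG).add ((ih.2.mul hH).mul (IsPolyFamily.const (-1)))).congr
          (Eventually.of_forall fun w p => ?_)
        rw [pow_succ, Complex.mul_re]
        ring
      · refine ((ih.1.mul hH).add (ih.2.mul hG)).congr (Eventually.of_forall fun w p => ?_)
        rw [pow_succ, Complex.mul_im]
  unfold azimuthalPoly
  split_ifs
  · exact (IsPolyFamily.const _).mul (key _).2
  · exact IsPolyFamily.const 1
  · exact (IsPolyFamily.const _).mul (key _).1

lemma eventually_norm_lt_one (hu : ‖u w₀‖ < 1) (hdu : DifferentiableAt ℝ u w₀) :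
    ∀ᶠ w in 𝓝 w₀, ‖u w‖ < 1 :=
  hdu.continuousAt.norm.eventually (gt_mem_nhds hu)

lemma isPolyFamily_solidHarmonic (hu : ‖u w₀‖ < 1) (hdu : DifferentiableAt ℝ u w₀) {ℓ : ℕ} {m : ℤ}
    (hm : m.natAbs ≤ ℓ) : IsPolyFamily w₀ fun w p => solidHarmonic ℓ m (u w) p := by
  have hE := isPolyFamily_fluidEnergy hu hdu
  have hq := isPolyFamily_fluidMomentum hu hdu
  refine IsPolyFamily.congr ?_ ((eventually_norm_lt_one hu hdu).mono fun w hw p =>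
    solidHarmonic_eq_poly hw hm p)
  refine ((IsPolyFamily.const _).mul (isPolyFamily_azimuthalPoly (hq 0) (hq 1) m)).mul
    (IsPolyFamily.sum _ fun j _ => (IsPolyFamily.const _).mul
      (((hq 2).pow j).mul (IsPolyFamily.pow ?_ _)))
  exact (hE.pow 2).add (IsPolyFamily.const (-1)) |>.congr
    (Eventually.of_forall fun w p => sub_eq_add_neg _ _)

lemma isPolyFamily_orthPoly (hu : ‖u w₀‖ < 1) (hdu : DifferentiableAt ℝ u w₀) (hζ : 0 < ζ w₀)
    (hdζ : DifferentiableAt ℝ ζ w₀) (ℓ k : ℕ) :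
    IsPolyFamily w₀ fun w p => (orthPoly ℓ (ζ w) k).eval (fluidEnergy (u w) p) := by
  have hE := isPolyFamily_fluidEnergy hu hdu
  refine (IsPolyFamily.sum (Finset.range (k + 1)) fun n _ =>
    (IsPolyFamily.of_coeff (a := fun w => (orthPoly ℓ (ζ w) k).coeff n) ?_).mul (hE.pow n)).congr
    (Eventually.of_forall fun w p => ?_)
  · exact (differentiableAt_orthPoly_coeff ℓ hζ k n).comp w₀ hdζ
  · rw [eval_eq_sum_range' (Nat.lt_succ_of_le (orthPoly_natDegree_le ℓ (ζ w) k))]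

/-- A family `e^{-β(w) p} G(w, p)` with polynomial `G` is differentiable with respect to `w`, its
derivative has the same form, and integrals against polynomials can be differentiated under the
integral sign. -/
lemma expFamily_hasFDerivAt {β : V → Fin 4 → ℝ} {G F : V → Momentum → ℝ}
    (hβ : DifferentiableAt ℝ β w₀) (hft : ∀ᶠ w in 𝓝 w₀, FutureTimelike (β w))
    (hG : IsPolyFamily w₀ G)
    (hF : ∀ᶠ w in 𝓝 w₀, ∀ p, F w p = Real.exp (-(minkowski (β w) (fourMomentum p))) * G w p) :
    ∃ H : V → Momentum → ℝ,
      (∀ v, H v ∈ momentumPolynomials) ∧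
      (∀ v p, H v p = fderiv ℝ (fun w => G w p) w₀ v
        - minkowski (fderiv ℝ β w₀ v) (fourMomentum p) * G w₀ p) ∧
      (∀ p, DifferentiableAt ℝ (fun w => F w p) w₀ ∧ ∀ v, fderiv ℝ (fun w => F w p) w₀ v
        = Real.exp (-(minkowski (β w₀) (fourMomentum p))) * H v p) ∧
      ∀ f ∈ momentumPolynomials,
        DifferentiableAt ℝ (fun w => ∫ p, f p * F w p ∂invMeasure) w₀ ∧
        ∀ v, fderiv ℝ (fun w => ∫ p, f p * F w p ∂invMeasure) w₀ v
          = ∫ p, f p * (Real.exp (-(minkowski (β w₀) (fourMomentum p))) * H v p) ∂invMeasure := by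
  obtain ⟨ι, _, a, g, ha, hg, hrep⟩ := id hG
  have hft0 := hft.self_of_nhds
  have hG0 := hG.mem
  have hGrep := hrep.self_of_nhds
  have hlin : ∀ v, (fun p => ∑ i, fderiv ℝ (a i) w₀ v * g i p) ∈ momentumPolynomials := fun v => by
    have : (fun p => ∑ i, fderiv ℝ (a i) w₀ v * g i p) = ∑ i, fderiv ℝ (a i) w₀ v • g i := by
      ext p; simp
    rw [this]
    exact momentumPolynomials.sum_mem fun i _ => momentumPolynomials.smul_mem (hg i) _
  let H : V → Momentum → ℝ := fun v p => (∑ i, fderiv ℝ (a i) w₀ v * g i p)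
    - minkowski (fderiv ℝ β w₀ v) (fourMomentum p) * G w₀ p
  have hHmem : ∀ v, H v ∈ momentumPolynomials := fun v =>
    momentumPolynomials.sub_mem (hlin v)
      (momentumPolynomials.mul_mem (minkowski_mem _) hG0)
  have hsum : ∀ p, HasFDerivAt (fun w => ∑ i, a i w * g i p)
      (∑ i, g i p • fderiv ℝ (a i) w₀) w₀ := fun p =>
    HasFDerivAt.fun_sum fun i _ => (ha i).hasFDerivAt.mul_const _
  refine ⟨H, hHmem, fun v p => ?_, fun p => ?_, fun f hf => ?_⟩
  · rw [((hsum p).congr_of_eventuallyEq (hrep.mono fun w h => h p)).fderiv]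
    simp only [H, sum_apply, smul_apply, smul_eq_mul, mul_comm (g _ p)]
  · have hexp : HasFDerivAt (fun w => Real.exp (-(minkowski (β w) (fourMomentum p))))
        (Real.exp (-(minkowski (β w₀) (fourMomentum p)))
          • -((minkowskiForm p).comp (fderiv ℝ β w₀))) w₀ := by
      have h1 : HasFDerivAt (fun w => minkowskiForm p (β w))
          ((minkowskiForm p).comp (fderiv ℝ β w₀)) w₀ :=
        (minkowskiForm p).hasFDerivAt.comp w₀ hβ.hasFDerivAt
      simp only [minkowskiForm_apply] at h1
      exact h1.neg.exp
    have heq : (fun w => F w p) =ᶠ[𝓝 w₀] fun w =>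
        Real.exp (-(minkowski (β w) (fourMomentum p))) * ∑ i, a i w * g i p := by
      filter_upwards [hF, hrep] with w h1 h2
      rw [h1, h2]
    have hd := (hexp.mul (hsum p)).congr_of_eventuallyEq heq
    refine ⟨hd.differentiableAt, fun v => ?_⟩
    rw [hd.fderiv, ← hGrep]
    simp only [add_apply, smul_apply, neg_apply, sum_apply, smul_eq_mul,
      ContinuousLinearMap.comp_apply, minkowskiForm_apply, H]
    simp only [mul_comm (g _ p)]
    ring
  · have hfg : ∀ i, (fun p => f p * g i p) ∈ momentumPolynomials := fun i =>
      momentumPolynomials.mul_mem hf (hg i)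
    choose J hJ hJv using fun i => hasFDerivAt_integral_exp_neg_minkowski (hfg i) hft0
    have heq : (fun w => ∫ p, f p * F w p ∂invMeasure) =ᶠ[𝓝 w₀] fun w => ∑ i, a i w *
        ∫ p, f p * g i p * Real.exp (-(minkowski (β w) (fourMomentum p))) ∂invMeasure := by
      filter_upwards [hF, hrep, hft] with w h1 h2 h3
      simp only [← integral_const_mul]
      rw [← integral_finsetSum _ fun i _ =>
        (integrable_mul_exp_neg_minkowski (hfg i) h3).const_mul (a i w)]
      refine integral_congr_ae (Eventually.of_forall fun p => ?_)
      simp only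
      rw [h1, h2, Finset.mul_sum, Finset.mul_sum]
      refine Finset.sum_congr rfl fun i _ => by ring
    have hd : HasFDerivAt (fun w => ∑ i, a i w *
        ∫ p, f p * g i p * Real.exp (-(minkowski (β w) (fourMomentum p))) ∂invMeasure)
        (∑ i, (a i w₀ • (J i).comp (fderiv ℝ β w₀)
          + (∫ p, f p * g i p * Real.exp (-(minkowski (β w₀) (fourMomentum p))) ∂invMeasure)
            • fderiv ℝ (a i) w₀)) w₀ :=
      HasFDerivAt.fun_sum fun i _ => (ha i).hasFDerivAt.mul ((hJ i).comp w₀ hβ.hasFDerivAt)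
    have hd' := hd.congr_of_eventuallyEq heq
    refine ⟨hd'.differentiableAt, fun v => ?_⟩
    rw [hd'.fderiv]
    simp only [sum_apply, add_apply, smul_apply, smul_eq_mul, ContinuousLinearMap.comp_apply, hJv]
    have hi1 : ∀ i, Integrable (fun p => a i w₀ * (-(minkowski (fderiv ℝ β w₀ v) (fourMomentum p)) *
        (f p * g i p * Real.exp (-(minkowski (β w₀) (fourMomentum p)))))) invMeasure := fun i => by
      have := (integrable_mul_exp_neg_minkowski (momentumPolynomials.mul_mem
        (minkowski_mem (fderiv ℝ β w₀ v)) (hfg i)) hft0).neg.const_mul (a i w₀)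
      refine this.congr (Eventually.of_forall fun p => ?_)
      simp only [Pi.neg_apply, Pi.mul_apply]
      ring
    have hi2 : ∀ i, Integrable (fun p => f p * g i p
        * Real.exp (-(minkowski (β w₀) (fourMomentum p))) * fderiv ℝ (a i) w₀ v) invMeasure :=
      fun i => (integrable_mul_exp_neg_minkowski (hfg i) hft0).mul_const _
    simp only [← integral_const_mul, ← integral_mul_const]
    rw [Finset.sum_congr rfl fun i _ => (integral_add (hi1 i) (hi2 i)).symm]
    refine (integral_finsetSum _ fun i _ => (hi1 i).add (hi2 i)).symm.trans ?_
    refine integral_congr_ae (Eventually.of_forall fun p => ?_)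
    simp only [H]
    rw [hGrep, Finset.mul_sum, ← Finset.sum_sub_distrib, Finset.mul_sum, Finset.mul_sum]
    refine Finset.sum_congr rfl fun i _ => ?_
    simp only [Pi.add_apply]
    ring

end Families

/-! ### Orthogonality of the basis -/

/-- The squared norm of a spherical harmonic on the sphere. -/
def harmonicNormSq (ℓ : ℕ) (m : ℤ) : ℝ :=
  (∫ y in Set.Ioo (-1 : ℝ) 1, normLegendre ℓ m.natAbs y * normLegendre ℓ m.natAbs y)
    * (2 * Real.pi)

lemma harmonicNormSq_pos {ℓ : ℕ} {m : ℤ} (hm : m.natAbs ≤ ℓ) : 0 < harmonicNormSq ℓ m :=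
  mul_pos (integral_normLegendre_mul_self_pos hm) (by positivity)

/-- The substitution `x = √(1 + r²)` in the radial integral. -/
lemma integral_radial (ℓ : ℕ) (ζ : ℝ) (P : ℝ[X]) :
    ∫ r in Set.Ioi (0 : ℝ), r ^ 2 * (Real.exp (-(ζ * √(1 + r ^ 2))) * P.eval √(1 + r ^ 2)
      * r ^ (ℓ + ℓ) / √(1 + r ^ 2)) = weightIntegral ℓ ζ P := by
  have himg : (fun x : ℝ => √(x ^ 2 - 1)) '' Set.Ioi 1 = Set.Ioi 0 := by
    ext r
    constructor
    · rintro ⟨x, hx, rfl⟩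
      have hx : 1 < x := hx
      exact Real.sqrt_pos.2 (by nlinarith)
    · intro hr
      have hr : 0 < r := hr
      refine ⟨√(1 + r ^ 2), ?_, ?_⟩
      · exact (Real.lt_sqrt zero_le_one).2 (by nlinarith)
      · simp only
        rw [Real.sq_sqrt (by positivity), add_sub_cancel_left, Real.sqrt_sq hr.le]
  have hder : ∀ x ∈ Set.Ioi (1 : ℝ), HasDerivWithinAt (fun x : ℝ => √(x ^ 2 - 1))
      (x / √(x ^ 2 - 1)) (Set.Ioi 1) x := by
    intro x hx
    have hx : 1 < x := hx
    have h1 : x ^ 2 - 1 ≠ 0 := by nlinarith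
    have h2 := (((hasDerivAt_pow 2 x).sub_const 1).sqrt h1).hasDerivWithinAt (s := Set.Ioi 1)
    refine h2.congr_deriv ?_
    rw [show ((2 : ℕ) : ℝ) * x ^ (2 - 1) = 2 * x by norm_num, mul_div_mul_left _ _ two_ne_zero]
  have hinj : Set.InjOn (fun x : ℝ => √(x ^ 2 - 1)) (Set.Ioi 1) := by
    intro x hx y hy hxy
    have hx : 1 < x := hx
    have hy : 1 < y := hy
    have h1 := (Real.sqrt_inj (by nlinarith) (by nlinarith)).1 hxy
    nlinarith
  rw [← himg, integral_image_eq_integral_abs_deriv_smul measurableSet_Ioi hder hinj]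
  unfold weightIntegral
  refine setIntegral_congr_fun measurableSet_Ioi fun x hx => ?_
  have hx : 1 < x := hx
  have h0 : 0 < x ^ 2 - 1 := by nlinarith
  have hs : 0 < √(x ^ 2 - 1) := Real.sqrt_pos.2 h0
  have hsq : √(x ^ 2 - 1) ^ 2 = x ^ 2 - 1 := Real.sq_sqrt h0.le
  have hx2 : √(1 + √(x ^ 2 - 1) ^ 2) = x := by
    rw [hsq, add_sub_cancel, Real.sqrt_sq (by linarith)]
  have hpow : (x ^ 2 - 1) ^ ((ℓ : ℝ) + 1 / 2) = √(x ^ 2 - 1) ^ (ℓ + ℓ) * √(x ^ 2 - 1) := by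
    rw [Real.rpow_add h0, ← Real.sqrt_eq_rpow, Real.rpow_natCast, ← two_mul, pow_mul, hsq]
  simp only [smul_eq_mul, hx2, hpow]
  rw [abs_of_pos (by positivity)]
  field_simp

/-- Orthogonality in the rest frame and Lorentz invariance: products of polynomials in the fluid
energy with solid harmonics, integrated against the equilibrium exponential. -/
lemma integral_solidHarmonic_mul {u : EuclideanSpace ℝ (Fin 3)} (hu : ‖u‖ < 1) (ζ : ℝ)
    {ℓ ℓ' : ℕ} {m m' : ℤ} (hm : m.natAbs ≤ ℓ) (hm' : m'.natAbs ≤ ℓ') (A B : ℝ[X]) :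
    ∫ p, Real.exp (-(ζ * fluidEnergy u p)) * ((A.eval (fluidEnergy u p) * solidHarmonic ℓ m u p)
        * (B.eval (fluidEnergy u p) * solidHarmonic ℓ' m' u p)) ∂invMeasure
      = if ℓ = ℓ' ∧ m = m' then harmonicNormSq ℓ m * weightIntegral ℓ ζ (A * B) else 0 := by
  let R : ℝ → ℝ := fun r => Real.exp (-(ζ * √(1 + r ^ 2))) * (A * B).eval √(1 + r ^ 2)
      * r ^ (ℓ + ℓ') / √(1 + r ^ 2)
  let Y : ℝ → ℝ := fun y => normLegendre ℓ m.natAbs y * normLegendre ℓ' m'.natAbs y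
  let Φ : ℝ → ℝ := fun φ => azimuthal m φ * azimuthal m' φ
  have hR : Measurable R := by
    have := (Polynomial.continuous (A * B)).measurable
    fun_prop
  have hY : Measurable Y :=
    ((continuous_normLegendre _ _).mul (continuous_normLegendre _ _)).measurable
  have hΦ : Measurable Φ := ((continuous_azimuthal m).mul (continuous_azimuthal m')).measurable
  have h1 : ∀ p, Real.exp (-(ζ * fluidEnergy u p)) * ((A.eval (fluidEnergy u p)
        * solidHarmonic ℓ m u p) * (B.eval (fluidEnergy u p) * solidHarmonic ℓ' m' u p))
      = (fun q : Momentum => √(1 + ‖q‖ ^ 2) * (R ‖q‖ * Y (q 2 / ‖q‖)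
        * Φ (Complex.arg ⟨q 0, q 1⟩))) (boost u p) := by
    intro p
    have h0 : √(1 + ‖boost u p‖ ^ 2) ≠ 0 := by positivity
    simp only [R, Y, Φ, solidHarmonic_eq_boost hu, fluidEnergy_eq_sqrt hu, eval_mul, pow_add]
    field_simp
  have h2 : ∀ q : Momentum, √(1 + ‖q‖ ^ 2) * (R ‖q‖ * Y (q 2 / ‖q‖)
        * Φ (Complex.arg ⟨q 0, q 1⟩)) / √(1 + ‖q‖ ^ 2)
      = R ‖q‖ * Y (q 2 / ‖q‖) * Φ (Complex.arg ⟨q 0, q 1⟩) := by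
    intro q
    have h0 : √(1 + ‖q‖ ^ 2) ≠ 0 := by positivity
    field_simp
  simp only [h1]
  rw [integral_comp_boost hu (fun q : Momentum => √(1 + ‖q‖ ^ 2) * (R ‖q‖ * Y (q 2 / ‖q‖)
        * Φ (Complex.arg ⟨q 0, q 1⟩))), integral_invMeasure]
  simp only [h2]
  rw [integral_spherical hR hY hΦ, integral_azimuthal_mul]
  by_cases hmm : m = m'
  · subst hmm
    by_cases hl : ℓ = ℓ'
    · subst hl
      rw [if_pos rfl, if_pos ⟨rfl, rfl⟩, integral_radial, harmonicNormSq]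
      ring
    · rw [if_pos rfl, if_neg (fun h => hl h.1), integral_normLegendre_mul_of_ne hl hm hm']
      ring
  · rw [if_neg hmm, if_neg (fun h => hmm h.2), mul_zero]

/-- The normalisation of the Maxwell-Jüttner weight. -/
def juttnerConst (θ : ℝ) : ℝ := weightConst 0 θ⁻¹ / (4 * Real.pi)

lemma juttnerConst_pos {θ : ℝ} (hθ : 0 < θ) : 0 < juttnerConst θ :=
  div_pos (weightConst_pos 0 (inv_pos.2 hθ)) (by positivity)

lemma juttner_eq (u : EuclideanSpace ℝ (Fin 3)) (θ : ℝ) (p : Momentum) :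
    juttner u θ p = juttnerConst θ * Real.exp (-(θ⁻¹ * fluidEnergy u p)) := by
  have h1 : fluidEnergy u p / θ = θ⁻¹ * fluidEnergy u p := by rw [div_eq_inv_mul]
  unfold juttner juttnerConst weightConst
  rw [h1]
  congr 1
  simp
  ring

lemma differentiableAt_juttnerConst {θ : ℝ} (hθ : 0 < θ) : DifferentiableAt ℝ juttnerConst θ := by
  have h1 : DifferentiableAt ℝ (fun z : ℝ => weightConst 0 z⁻¹) θ :=
    DifferentiableAt.comp (g := weightConst 0) θ (differentiableAt_weightConst 0 (inv_pos.2 hθ))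
      (differentiableAt_inv hθ.ne')
  unfold juttnerConst
  simpa only [div_eq_mul_inv] using h1.mul_const _

lemma juttner_pos (u : EuclideanSpace ℝ (Fin 3)) {θ : ℝ} (hθ : 0 < θ) (p : Momentum) :
    0 < juttner u θ p := by
  rw [juttner_eq]
  exact mul_pos (juttnerConst_pos hθ) (Real.exp_pos _)

variable {M : ℕ}

lemma MomentIndex.ext_nat {i j : MomentIndex M} (h1 : (i.1 : ℕ) = j.1) (h2 : (i.2.1 : ℕ) = j.2.1)
    (h3 : (i.2.2 : ℕ) = j.2.2) : i = j := by
  obtain ⟨⟨d, hd⟩, ⟨l, hl⟩, ⟨k, hk⟩⟩ := i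
  obtain ⟨⟨d', hd'⟩, ⟨l', hl'⟩, ⟨k', hk'⟩⟩ := j
  simp only at h1 h2 h3
  subst h1 h2 h3
  rfl

/-- The order `m` of the spherical harmonic with a given index. -/
def MomentIndex.order (i : MomentIndex M) : ℤ := ((i.2.2 : ℕ) : ℤ) - ((i.2.1 : ℕ) : ℤ)

lemma MomentIndex.natAbs_order_le (i : MomentIndex M) : i.order.natAbs ≤ (i.2.1 : ℕ) := by
  have := i.2.2.2
  unfold MomentIndex.order
  omega

/-- The polynomial factor of a basis function. -/
def basisPoly (u : EuclideanSpace ℝ (Fin 3)) (θ : ℝ) (i : MomentIndex M) (p : Momentum) : ℝ :=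
  (orthPoly (i.2.1 : ℕ) θ⁻¹ ((i.1 : ℕ) - (i.2.1 : ℕ))).eval (fluidEnergy u p)
    * solidHarmonic (i.2.1 : ℕ) i.order u p

lemma basisFun_eq (u : EuclideanSpace ℝ (Fin 3)) (θ : ℝ) (i : MomentIndex M) (p : Momentum) :
    basisFun u θ i p = juttner u θ p * basisPoly u θ i p := by
  unfold basisFun basisPoly MomentIndex.order
  ring

lemma weightedInner_basisFun (u : EuclideanSpace ℝ (Fin 3)) {θ : ℝ} (hθ : 0 < θ) (f : Momentum → ℝ)
    (i : MomentIndex M) :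
    weightedInner u θ f (basisFun u θ i) = ∫ p, f p * basisPoly u θ i p ∂invMeasure := by
  rw [integral_invMeasure]
  unfold weightedInner
  congr 1
  ext p
  rw [basisFun_eq, fourMomentum_zero]
  have := (juttner_pos u hθ p).ne'
  field_simp

lemma solidHarmonic_mem {u : EuclideanSpace ℝ (Fin 3)} (hu : ‖u‖ < 1) {ℓ : ℕ} {m : ℤ}
    (hm : m.natAbs ≤ ℓ) : solidHarmonic ℓ m u ∈ momentumPolynomials :=
  (isPolyFamily_solidHarmonic (V := ℝ) (w₀ := 0) (u := fun _ => u) hu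
    (differentiableAt_const _) hm).mem

lemma eval_fluidEnergy_mem (u : EuclideanSpace ℝ (Fin 3)) (A : ℝ[X]) :
    (fun p => A.eval (fluidEnergy u p)) ∈ momentumPolynomials := by
  have hE : fluidEnergy u ∈ momentumPolynomials := minkowski_mem _
  have h : (fun p => A.eval (fluidEnergy u p))
      = ∑ n ∈ Finset.range (A.natDegree + 1), A.coeff n • fluidEnergy u ^ n := by
    ext p
    rw [eval_eq_sum_range, Finset.sum_apply]
    simp
  rw [h]
  exact momentumPolynomials.sum_mem fun n _ =>
    momentumPolynomials.smul_mem (momentumPolynomials.pow_mem hE n) _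

lemma basisPoly_mem {u : EuclideanSpace ℝ (Fin 3)} (hu : ‖u‖ < 1) (θ : ℝ) (i : MomentIndex M) :
    basisPoly u θ i ∈ momentumPolynomials :=
  momentumPolynomials.mul_mem (eval_fluidEnergy_mem u _) (solidHarmonic_mem hu i.natAbs_order_le)

lemma integrable_juttner_mul {u : EuclideanSpace ℝ (Fin 3)} (hu : ‖u‖ < 1) {θ : ℝ} (hθ : 0 < θ)
    {f : Momentum → ℝ} (hf : f ∈ momentumPolynomials) :
    Integrable (fun p => juttner u θ p * f p) invMeasure := by
  refine ((integrable_mul_exp_neg_minkowski hf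
    ((futureTimelike_fourVelocity hu).smul (inv_pos.2 hθ))).const_mul (juttnerConst θ)).congr
    (Filter.Eventually.of_forall fun p => ?_)
  simp only [minkowski_smul_left, juttner_eq, fluidEnergy]
  ring

/-- Inner product of a basis function with a product of the same type. -/
lemma integral_basisFun_mul {u : EuclideanSpace ℝ (Fin 3)} (hu : ‖u‖ < 1) {θ : ℝ} (hθ : 0 < θ)
    (i : MomentIndex M) {ℓ : ℕ} {m : ℤ} (hm : m.natAbs ≤ ℓ) (A : ℝ[X]) :
    ∫ p, basisFun u θ i p * (A.eval (fluidEnergy u p) * solidHarmonic ℓ m u p) ∂invMeasure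
      = if (i.2.1 : ℕ) = ℓ ∧ i.order = m then
          juttnerConst θ * harmonicNormSq ℓ m / weightConst ℓ θ⁻¹
            * polyInner ℓ θ⁻¹ A (orthPoly ℓ θ⁻¹ ((i.1 : ℕ) - ℓ))
        else 0 := by
  have h1 : ∀ p, basisFun u θ i p * (A.eval (fluidEnergy u p) * solidHarmonic ℓ m u p)
      = juttnerConst θ * (Real.exp (-(θ⁻¹ * fluidEnergy u p))
        * (((orthPoly (i.2.1 : ℕ) θ⁻¹ ((i.1 : ℕ) - (i.2.1 : ℕ))).eval (fluidEnergy u p)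
          * solidHarmonic (i.2.1 : ℕ) i.order u p)
          * (A.eval (fluidEnergy u p) * solidHarmonic ℓ m u p))) := by
    intro p
    rw [basisFun_eq, juttner_eq, basisPoly]
    ring
  simp only [h1]
  rw [integral_const_mul, integral_solidHarmonic_mul hu _ i.natAbs_order_le hm]
  by_cases h : (i.2.1 : ℕ) = ℓ ∧ i.order = m
  · rw [if_pos h, if_pos h, polyInner_eq, h.1, h.2, mul_comm A]
    have h2 := (weightConst_pos ℓ (inv_pos.2 hθ)).ne'
    generalize weightConst ℓ θ⁻¹ = w at h2 ⊢
    field_simp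
  · rw [if_neg h, if_neg h, mul_zero]

/-- The basis is orthogonal. The value of the norms does not matter for the argument, only that they
are positive (`basisNormSq_pos`). -/
lemma integral_basisFun_mul_basisPoly {u : EuclideanSpace ℝ (Fin 3)} (hu : ‖u‖ < 1) {θ : ℝ}
    (hθ : 0 < θ) (i j : MomentIndex M) :
    ∫ p, basisFun u θ i p * basisPoly u θ j p ∂invMeasure
      = if i = j then juttnerConst θ * harmonicNormSq (j.2.1 : ℕ) j.order
          / weightConst (j.2.1 : ℕ) θ⁻¹ else 0 := by
  have h := integral_basisFun_mul hu hθ i j.natAbs_order_le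
    (orthPoly (j.2.1 : ℕ) θ⁻¹ ((j.1 : ℕ) - (j.2.1 : ℕ)))
  unfold basisPoly
  rw [h, polyInner_orthPoly _ (inv_pos.2 hθ)]
  by_cases hij : i = j
  · subst hij
    simp
  · rw [if_neg hij]
    split_ifs with h1 h2
    · exfalso
      apply hij
      have hi := i.2.1.2
      have hj := j.2.1.2
      have h3 := h1.2
      unfold MomentIndex.order at h3
      refine MomentIndex.ext_nat ?_ h1.1 ?_
      · have := h1.1; omega
      · have := h1.1; omega
    · rw [mul_zero]
    · rfl

lemma basisNormSq_pos {θ : ℝ} (hθ : 0 < θ) (j : MomentIndex M) :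
    0 < juttnerConst θ * harmonicNormSq (j.2.1 : ℕ) j.order / weightConst (j.2.1 : ℕ) θ⁻¹ :=
  div_pos (mul_pos (juttnerConst_pos hθ) (harmonicNormSq_pos j.natAbs_order_le))
    (weightConst_pos _ (inv_pos.2 hθ))

lemma integrable_mul_basisFun_mul_basisPoly {u : EuclideanSpace ℝ (Fin 3)} (hu : ‖u‖ < 1) {θ : ℝ}
    (hθ : 0 < θ) {f : Momentum → ℝ} (hf : f ∈ momentumPolynomials) (i j : MomentIndex M) :
    Integrable (fun p => f p * basisFun u θ i p * basisPoly u θ j p) invMeasure := by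
  refine (integrable_juttner_mul hu hθ (momentumPolynomials.mul_mem hf
    (momentumPolynomials.mul_mem (basisPoly_mem hu θ i) (basisPoly_mem hu θ j)))).congr
    (Filter.Eventually.of_forall fun p => ?_)
  simp only [basisFun_eq, Pi.mul_apply]
  ring

lemma integral_sum_basisFun_mul_basisPoly {u : EuclideanSpace ℝ (Fin 3)} (hu : ‖u‖ < 1) {θ : ℝ}
    (hθ : 0 < θ) (x : MomentIndex M → ℝ) (j : MomentIndex M) :
    ∫ p, (∑ i, x i * basisFun u θ i p) * basisPoly u θ j p ∂invMeasure
      = x j * (juttnerConst θ * harmonicNormSq (j.2.1 : ℕ) j.order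
        / weightConst (j.2.1 : ℕ) θ⁻¹) := by
  have hi : ∀ i : MomentIndex M,
      Integrable (fun p => basisFun u θ i p * basisPoly u θ j p) invMeasure := fun i => by
    simpa using integrable_mul_basisFun_mul_basisPoly hu hθ (const_mem_momentumPolynomials 1) i j
  have h1 : ∀ p, (∑ i, x i * basisFun u θ i p) * basisPoly u θ j p
      = ∑ i, x i * (basisFun u θ i p * basisPoly u θ j p) := fun p => by
    rw [Finset.sum_mul]
    exact Finset.sum_congr rfl fun i _ => by ring
  simp only [h1]
  rw [integral_finsetSum _ fun i _ => (hi i).const_mul (x i)]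
  simp only [integral_const_mul, integral_basisFun_mul_basisPoly hu hθ]
  simp

/-- The basis is linearly independent, so the projections of two functions agree only if all their
inner products with the basis do. -/
lemma momentProj_eq_iff {u : EuclideanSpace ℝ (Fin 3)} (hu : ‖u‖ < 1) {θ : ℝ} (hθ : 0 < θ)
    (f h : Momentum → ℝ) : momentProj M u θ f = momentProj M u θ h ↔
      ∀ i : MomentIndex M,
        weightedInner u θ f (basisFun u θ i) = weightedInner u θ h (basisFun u θ i) := by
  constructor
  · intro hfh i
    have h1 := integral_sum_basisFun_mul_basisPoly hu hθ
      (fun i : MomentIndex M => weightedInner u θ f (basisFun u θ i)) i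
    have h2 := integral_sum_basisFun_mul_basisPoly hu hθ
      (fun i : MomentIndex M => weightedInner u θ h (basisFun u θ i)) i
    have h3 : ∀ p, ∑ i : MomentIndex M, weightedInner u θ f (basisFun u θ i) * basisFun u θ i p
        = ∑ i : MomentIndex M, weightedInner u θ h (basisFun u θ i) * basisFun u θ i p :=
      fun p => congrFun hfh p
    simp only [h3] at h1
    rw [h2] at h1
    exact (mul_right_cancel₀ (basisNormSq_pos hθ i).ne' h1).symm
  · intro h1
    ext p
    unfold momentProj
    simp only [h1]

/-! ### The flux matrices -/

/-- The Gram matrix of the basis with respect to the inner product weighted by `f`, that is, the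
matrix of the inner products of `f` times one basis function with another. -/
def fluxMatrix (u : EuclideanSpace ℝ (Fin 3)) (θ : ℝ) (f : Momentum → ℝ) :
    Matrix (MomentIndex M) (MomentIndex M) ℝ :=
  Matrix.of fun i k => ∫ p, f p * basisFun u θ k p * basisPoly u θ i p ∂invMeasure

lemma fluxMatrix_isHermitian (u : EuclideanSpace ℝ (Fin 3)) (θ : ℝ) (f : Momentum → ℝ) :
    (fluxMatrix u θ f : Matrix (MomentIndex M) (MomentIndex M) ℝ).IsHermitian := by
  ext i k
  simp only [Matrix.conjTranspose_apply, fluxMatrix, Matrix.of_apply, star_trivial, basisFun_eq]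
  congr 1
  ext p
  ring

lemma fluxMatrix_add {u : EuclideanSpace ℝ (Fin 3)} (hu : ‖u‖ < 1) {θ : ℝ} (hθ : 0 < θ)
    {f h : Momentum → ℝ} (hf : f ∈ momentumPolynomials) (hh : h ∈ momentumPolynomials) :
    (fluxMatrix u θ (f + h) : Matrix (MomentIndex M) (MomentIndex M) ℝ)
      = fluxMatrix u θ f + fluxMatrix u θ h := by
  ext i k
  simp only [fluxMatrix, Matrix.of_apply, Matrix.add_apply, Pi.add_apply]
  rw [← integral_add (integrable_mul_basisFun_mul_basisPoly hu hθ hf k i)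
    (integrable_mul_basisFun_mul_basisPoly hu hθ hh k i)]
  congr 1
  ext p
  ring

lemma fluxMatrix_smul (u : EuclideanSpace ℝ (Fin 3)) (θ c : ℝ) (f : Momentum → ℝ) :
    (fluxMatrix u θ (c • f) : Matrix (MomentIndex M) (MomentIndex M) ℝ) = c • fluxMatrix u θ f := by
  ext i k
  simp only [fluxMatrix, Matrix.of_apply, Matrix.smul_apply, Pi.smul_apply, smul_eq_mul]
  rw [← integral_const_mul]
  congr 1
  ext p
  ring

/-- The Gram matrix for a positive weight is positive definite, since the basis is linearly
independent almost everywhere. -/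
lemma fluxMatrix_posDef {u : EuclideanSpace ℝ (Fin 3)} (hu : ‖u‖ < 1) {θ : ℝ} (hθ : 0 < θ)
    {f : Momentum → ℝ} (hf : f ∈ momentumPolynomials) (hpos : ∀ p, 0 < f p) :
    (fluxMatrix u θ f : Matrix (MomentIndex M) (MomentIndex M) ℝ).PosDef := by
  refine Matrix.PosDef.of_dotProduct_mulVec_pos (fluxMatrix_isHermitian u θ f) fun x hx => ?_
  set y : Momentum → ℝ := fun p => ∑ i, x i * basisPoly u θ i p with hy
  have hymem : y ∈ momentumPolynomials := by
    have : y = ∑ i, x i • basisPoly u θ i := by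
      ext p; simp [hy]
    rw [this]
    exact momentumPolynomials.sum_mem fun i _ =>
      momentumPolynomials.smul_mem (basisPoly_mem hu θ i) _
  have h1 : star x ⬝ᵥ (fluxMatrix u θ f : Matrix (MomentIndex M) (MomentIndex M) ℝ).mulVec x
      = ∫ p, f p * juttner u θ p * y p ^ 2 ∂invMeasure := by
    have h2 : ∀ p, f p * juttner u θ p * y p ^ 2
        = ∑ i, ∑ k, x i * x k * (f p * basisFun u θ k p * basisPoly u θ i p) := by
      intro p
      rw [hy]
      simp only [sq]
      rw [Finset.sum_mul_sum, Finset.mul_sum]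
      refine Finset.sum_congr rfl fun i _ => ?_
      rw [Finset.mul_sum]
      refine Finset.sum_congr rfl fun k _ => ?_
      rw [basisFun_eq]
      ring
    simp only [h2]
    rw [integral_finsetSum _ fun i _ => integrable_finsetSum _ fun k _ =>
      (integrable_mul_basisFun_mul_basisPoly hu hθ hf k i).const_mul _]
    simp only [dotProduct, Matrix.mulVec, star_trivial, Finset.mul_sum]
    refine Finset.sum_congr rfl fun i _ => ?_
    rw [integral_finsetSum _ fun k _ =>
      (integrable_mul_basisFun_mul_basisPoly hu hθ hf k i).const_mul _]
    refine Finset.sum_congr rfl fun k _ => ?_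
    rw [integral_const_mul, fluxMatrix, Matrix.of_apply]
    ring
  rw [h1]
  have hw : ∀ p, 0 < f p * juttner u θ p := fun p => mul_pos (hpos p) (juttner_pos u hθ p)
  have hint : Integrable (fun p => f p * juttner u θ p * y p ^ 2) invMeasure := by
    refine (integrable_juttner_mul hu hθ (momentumPolynomials.mul_mem hf
      (momentumPolynomials.pow_mem hymem 2))).congr (Filter.Eventually.of_forall fun p => ?_)
    simp only [Pi.mul_apply, Pi.pow_apply]
    ring
  refine lt_of_le_of_ne (integral_nonneg fun p => mul_nonneg (hw p).le (sq_nonneg _)) fun h0 => ?_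
  have hae := ae_eq_zero_of_integral_sq_eq_zero hw hint h0.symm
  apply hx
  ext j
  have h3 := integral_sum_basisFun_mul_basisPoly hu hθ x j
  have h4 : ∫ p, (∑ i, x i * basisFun u θ i p) * basisPoly u θ j p ∂invMeasure = 0 := by
    refine integral_eq_zero_of_ae ?_
    filter_upwards [hae] with p hp
    have : ∑ i, x i * basisFun u θ i p = juttner u θ p * y p := by
      rw [hy, Finset.mul_sum]
      refine Finset.sum_congr rfl fun i _ => ?_
      rw [basisFun_eq]
      ring
    rw [this, hp]
    simp
  rw [h4] at h3
  exact (mul_eq_zero.1 h3.symm).resolve_right (basisNormSq_pos hθ j).ne'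

/-- The matrix of the derivatives of the projected distribution with respect to the unknowns, tested
against the basis. -/
def transitionMatrix (W : MomentIndex M → ℝ) : Matrix (MomentIndex M) (MomentIndex M) ℝ :=
  Matrix.of fun k j => weightedInner (velocity W) (temperature W) (distributionDeriv W j)
    (basisFun (velocity W) (temperature W) k)

lemma weightedInner_mul_sum_basisFun {u : EuclideanSpace ℝ (Fin 3)} (hu : ‖u‖ < 1) {θ : ℝ}
    (hθ : 0 < θ) {f : Momentum → ℝ} (hf : f ∈ momentumPolynomials) (x : MomentIndex M → ℝ)
    (i : MomentIndex M) :
    weightedInner u θ (fun p => f p * ∑ k, x k * basisFun u θ k p) (basisFun u θ i)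
      = (fluxMatrix u θ f).mulVec x i := by
  rw [weightedInner_basisFun u hθ]
  have h1 : ∀ p, f p * (∑ k, x k * basisFun u θ k p) * basisPoly u θ i p
      = ∑ k, x k * (f p * basisFun u θ k p * basisPoly u θ i p) := fun p => by
    rw [Finset.mul_sum, Finset.sum_mul]
    exact Finset.sum_congr rfl fun i _ => by ring
  simp only [h1]
  rw [integral_finsetSum _ fun k _ =>
    (integrable_mul_basisFun_mul_basisPoly hu hθ hf k i).const_mul _]
  simp only [integral_const_mul, Matrix.mulVec, dotProduct, fluxMatrix, Matrix.of_apply]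
  exact Finset.sum_congr rfl fun k _ => mul_comm _ _

/-- The coefficient matrices of the moment system share their right factor, the transition matrix
from the entries of the state to the coefficients in the basis. Their left factors are symmetric.
-/
lemma momentMatrix_eq {W : MomentIndex M → ℝ} (hu : ‖velocity W‖ < 1) (hθ : 0 < temperature W)
    (α : Fin 4) : momentMatrix α W
      = fluxMatrix (velocity W) (temperature W) (fun p => fourMomentum p α)
        * transitionMatrix W := by
  ext i j
  simp only [momentMatrix, Matrix.of_apply, momentProj]
  rw [weightedInner_mul_sum_basisFun hu hθ (fourMomentum_mem α)]
  rfl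

/-! ### The distribution as a function of the state -/

open Filter Topology

lemma coord_add (W c : MomentIndex M → ℝ) (d ℓ j : ℕ) :
    coord (W + c) d ℓ j = coord W d ℓ j + coord c d ℓ j := by
  unfold coord
  split_ifs <;> simp

lemma coord_smul (r : ℝ) (W : MomentIndex M → ℝ) (d ℓ j : ℕ) :
    coord (r • W) d ℓ j = r * coord W d ℓ j := by
  unfold coord
  split_ifs <;> simp

/-- `coord` as a continuous linear map of the state. -/
def coordCLM (M d ℓ j : ℕ) : (MomentIndex M → ℝ) →L[ℝ] ℝ :=
  LinearMap.toContinuousLinearMap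
    { toFun := fun W => coord W d ℓ j
      map_add' := fun W c => coord_add W c d ℓ j
      map_smul' := fun r W => coord_smul r W d ℓ j }

lemma differentiable_coord (d ℓ j : ℕ) :
    Differentiable ℝ fun W : MomentIndex M → ℝ => coord W d ℓ j :=
  (coordCLM M d ℓ j).differentiable

lemma coord_apply (W : MomentIndex M → ℝ) (i : MomentIndex M) :
    coord W (i.1 : ℕ) (i.2.1 : ℕ) (i.2.2 : ℕ) = W i := by
  unfold coord
  rw [dif_pos ⟨i.1.2, i.2.1.2, i.2.2.2⟩]

lemma velocity_add_smul (W c : MomentIndex M → ℝ) (t : ℝ) :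
    velocity (W + t • c) = velocity W + t • velocity c := by
  ext i
  fin_cases i <;> simp [velocity, coord_add, coord_smul]

/-- `velocity` as a continuous linear map of the state. -/
def velocityCLM (M : ℕ) : (MomentIndex M → ℝ) →L[ℝ] EuclideanSpace ℝ (Fin 3) :=
  LinearMap.toContinuousLinearMap
    { toFun := velocity
      map_add' := fun W c => by simpa using velocity_add_smul W c 1
      map_smul' := fun r W => by
        ext i
        fin_cases i <;> simp [velocity, coord_smul] }

lemma differentiable_velocity : Differentiable ℝ (velocity : (MomentIndex M → ℝ) → _) :=
  (velocityCLM M).differentiable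

lemma temperature_add_smul (W c : MomentIndex M → ℝ) (t : ℝ) :
    temperature (W + t • c) = temperature W + t * temperature c := by
  simp only [temperature, coord_add, coord_smul]

lemma differentiable_temperature : Differentiable ℝ (temperature : (MomentIndex M → ℝ) → ℝ) :=
  differentiable_coord 1 1 2

/-- The expansion coefficients with the temperature as a separate argument: for fixed temperature
they are linear functions of the state. -/
def expansionCoeffAt (ζ : ℝ) (W : MomentIndex M → ℝ) (i : MomentIndex M) : ℝ :=
  if (i.1 : ℕ) = 0 then
    density W / (orthPoly 0 ζ 0).leadingCoeff - 3 * bulkPressure W * (orthPoly 0 ζ 0).eval 0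
  else if (i.1 : ℕ) ≤ 2 ∧ (i.2.1 : ℕ) = 0 then
    -3 * bulkPressure W * (orthPoly 0 ζ (i.1 : ℕ)).eval 0
  else if (i.1 : ℕ) ≤ 2 ∧ (i.2.1 : ℕ) = 1 then
    diffusion W (i.2.2 : ℕ) * (orthPoly 1 ζ ((i.1 : ℕ) - 1)).eval 0
  else W i

lemma expansionCoeff_eq (W : MomentIndex M → ℝ) (i : MomentIndex M) :
    expansionCoeff W i = expansionCoeffAt (temperature W)⁻¹ W i := rfl

lemma expansionCoeffAt_add_smul (ζ : ℝ) (W c : MomentIndex M → ℝ) (t : ℝ) (i : MomentIndex M) :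
    expansionCoeffAt ζ (W + t • c) i = expansionCoeffAt ζ W i + t * expansionCoeffAt ζ c i := by
  unfold expansionCoeffAt density bulkPressure diffusion
  simp only [coord_add, coord_smul, Pi.add_apply, Pi.smul_apply, smul_eq_mul]
  split_ifs <;> ring

lemma differentiableAt_expansionCoeff {W : MomentIndex M → ℝ} (hθ : 0 < temperature W)
    (i : MomentIndex M) : DifferentiableAt ℝ (fun W => expansionCoeff W i) W := by
  have hζ : 0 < (temperature W)⁻¹ := inv_pos.2 hθ
  have hdζ : DifferentiableAt ℝ (fun W : MomentIndex M → ℝ => (temperature W)⁻¹) W :=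
    (differentiable_temperature W).fun_inv hθ.ne'
  have hev : ∀ ℓ k, DifferentiableAt ℝ
      (fun W : MomentIndex M → ℝ => (orthPoly ℓ (temperature W)⁻¹ k).eval 0) W := fun ℓ k =>
    DifferentiableAt.comp (g := fun z : ℝ => (orthPoly ℓ z k).eval 0) W
      (differentiableAt_orthPoly_eval ℓ hζ k 0) hdζ
  have hlc : DifferentiableAt ℝ
      (fun W : MomentIndex M → ℝ => ((orthPoly 0 (temperature W)⁻¹ 0).leadingCoeff)⁻¹) W := by
    have h1 : (fun W : MomentIndex M → ℝ => (orthPoly 0 (temperature W)⁻¹ 0).leadingCoeff)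
        = fun W => (orthPoly 0 (temperature W)⁻¹ 0).coeff 0 := by
      ext W
      rw [leadingCoeff, Nat.le_zero.1 (orthPoly_natDegree_le 0 (temperature W)⁻¹ 0)]
    have h2 : DifferentiableAt ℝ
        (fun W : MomentIndex M → ℝ => (orthPoly 0 (temperature W)⁻¹ 0).leadingCoeff) W := by
      rw [h1]
      exact (differentiableAt_orthPoly_coeff 0 hζ 0 0).comp W hdζ
    exact h2.fun_inv (orthPoly_leadingCoeff_pos 0 hζ 0).ne'
  have hc := fun d ℓ j => differentiable_coord (M := M) d ℓ j W
  unfold expansionCoeff density bulkPressure diffusion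
  simp only [div_eq_mul_inv]
  split_ifs
  · exact ((hc 0 0 0).mul hlc).sub (((hc 2 0 0).const_mul 3).mul (hev _ _))
  · exact ((hc 2 0 0).const_mul (-3)).mul (hev _ _)
  · exact (hc 2 1 _).mul (hev _ _)
  · exact differentiableAt_apply i W

/-- The four-vector `U / θ`. -/
def inverseTemperatureVector (W : MomentIndex M → ℝ) : Fin 4 → ℝ :=
  (temperature W)⁻¹ • fourVelocity (velocity W)

/-- The polynomial factor of the distribution. -/
def distributionPoly (W : MomentIndex M → ℝ) (p : Momentum) : ℝ :=
  ∑ i : MomentIndex M, juttnerConst (temperature W) * expansionCoeff W i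
    * basisPoly (velocity W) (temperature W) i p

lemma distribution_eq (W : MomentIndex M → ℝ) (p : Momentum) : distribution W p
    = Real.exp (-(minkowski (inverseTemperatureVector W) (fourMomentum p)))
      * distributionPoly W p := by
  unfold distribution distributionPoly inverseTemperatureVector
  rw [Finset.mul_sum]
  refine Finset.sum_congr rfl fun i _ => ?_
  rw [basisFun_eq, juttner_eq, minkowski_smul_left, fluidEnergy]
  ring

variable {W : MomentIndex M → ℝ}

lemma differentiableAt_fourVelocity_velocity (hu : ‖velocity W‖ < 1) :
    DifferentiableAt ℝ (fun W : MomentIndex M → ℝ => fourVelocity (velocity W)) W :=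
  differentiableAt_pi.2 fun α => differentiableAt_fourVelocity hu (differentiable_velocity W) α

lemma differentiableAt_inverseTemperature (hθ : 0 < temperature W) :
    DifferentiableAt ℝ (fun W : MomentIndex M → ℝ => (temperature W)⁻¹) W :=
  (differentiable_temperature W).fun_inv hθ.ne'

lemma eventually_physical (hu : ‖velocity W‖ < 1) (hθ : 0 < temperature W) :
    ∀ᶠ w in 𝓝 W, ‖velocity w‖ < 1 ∧ 0 < temperature w :=
  (eventually_norm_lt_one hu (differentiable_velocity W)).and
    ((differentiable_temperature W).continuousAt.eventually (lt_mem_nhds hθ))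

lemma futureTimelike_inverseTemperatureVector (hu : ‖velocity W‖ < 1) (hθ : 0 < temperature W) :
    FutureTimelike (inverseTemperatureVector W) :=
  (futureTimelike_fourVelocity hu).smul (inv_pos.2 hθ)

lemma isPolyFamily_distributionPoly (hu : ‖velocity W‖ < 1) (hθ : 0 < temperature W) :
    IsPolyFamily W (distributionPoly : (MomentIndex M → ℝ) → _) := by
  have hζ : 0 < (temperature W)⁻¹ := inv_pos.2 hθ
  have hdζ := differentiableAt_inverseTemperature hθ
  have hK : DifferentiableAt ℝ (fun W : MomentIndex M → ℝ => juttnerConst (temperature W)) W :=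
    DifferentiableAt.comp (g := juttnerConst) W (differentiableAt_juttnerConst hθ)
      (differentiable_temperature W)
  refine IsPolyFamily.sum _ fun i _ => (IsPolyFamily.of_coeff
    (hK.mul (differentiableAt_expansionCoeff hθ i))).mul ?_
  exact (isPolyFamily_orthPoly hu (differentiable_velocity W) hζ hdζ _ _).mul
    (isPolyFamily_solidHarmonic hu (differentiable_velocity W) i.natAbs_order_le)

/-- The derivative of the distribution in the direction `c`. -/
def distributionVariation (W c : MomentIndex M → ℝ) (p : Momentum) : ℝ :=
  fderiv ℝ (fun w => distribution w p) W c

/-- The distribution is a differentiable function of the state, its derivative is the equilibrium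
exponential times a polynomial, and its moments can be differentiated under the integral sign. -/
lemma distribution_hasFDerivAt (hu : ‖velocity W‖ < 1) (hθ : 0 < temperature W) :
    ∃ H : (MomentIndex M → ℝ) → Momentum → ℝ,
      (∀ c, H c ∈ momentumPolynomials) ∧
      (∀ c p, H c p = fderiv ℝ (fun w => distributionPoly w p) W c
        - minkowski (fderiv ℝ inverseTemperatureVector W c) (fourMomentum p)
          * distributionPoly W p) ∧
      (∀ p, DifferentiableAt ℝ (fun w => distribution w p) W) ∧
      (∀ c p, distributionVariation W c p
        = Real.exp (-(minkowski (inverseTemperatureVector W) (fourMomentum p))) * H c p) ∧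
      ∀ f ∈ momentumPolynomials,
        DifferentiableAt ℝ (fun w => ∫ p, f p * distribution w p ∂invMeasure) W ∧
        ∀ c, fderiv ℝ (fun w => ∫ p, f p * distribution w p ∂invMeasure) W c
          = ∫ p, f p * distributionVariation W c p ∂invMeasure := by
  have hβ : DifferentiableAt ℝ (inverseTemperatureVector : (MomentIndex M → ℝ) → _) W :=
    (differentiableAt_inverseTemperature hθ).smul (differentiableAt_fourVelocity_velocity hu)
  obtain ⟨H, h1, h2, h3, h4⟩ := expFamily_hasFDerivAt hβ
    ((eventually_physical hu hθ).mono fun w hw =>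
      futureTimelike_inverseTemperatureVector hw.1 hw.2)
    (isPolyFamily_distributionPoly hu hθ)
    (Eventually.of_forall fun w p => distribution_eq w p)
  refine ⟨H, h1, h2, fun p => (h3 p).1, fun c p => (h3 p).2 c, fun f hf =>
    ⟨(h4 f hf).1, fun c => ?_⟩⟩
  rw [(h4 f hf).2 c]
  congr 1
  ext p
  rw [distributionVariation, (h3 p).2 c]

lemma integrable_mul_distributionVariation (hu : ‖velocity W‖ < 1) (hθ : 0 < temperature W)
    (c : MomentIndex M → ℝ) {f : Momentum → ℝ} (hf : f ∈ momentumPolynomials) :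
    Integrable (fun p => f p * distributionVariation W c p) invMeasure := by
  obtain ⟨H, h1, -, -, h4, -⟩ := distribution_hasFDerivAt hu hθ
  refine (integrable_mul_exp_neg_minkowski (momentumPolynomials.mul_mem hf (h1 c))
    (futureTimelike_inverseTemperatureVector hu hθ)).congr (Eventually.of_forall fun p => ?_)
  simp only [h4, Pi.mul_apply]
  ring

lemma integrable_mul_distribution (hu : ‖velocity W‖ < 1) (hθ : 0 < temperature W)
    {f : Momentum → ℝ} (hf : f ∈ momentumPolynomials) :
    Integrable (fun p => f p * distribution W p) invMeasure := by
  refine (integrable_mul_exp_neg_minkowski (momentumPolynomials.mul_mem hf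
    (isPolyFamily_distributionPoly hu hθ).mem)
    (futureTimelike_inverseTemperatureVector hu hθ)).congr (Eventually.of_forall fun p => ?_)
  simp only [distribution_eq, Pi.mul_apply]
  ring

lemma distributionDeriv_eq (hu : ‖velocity W‖ < 1) (hθ : 0 < temperature W) (j : MomentIndex M)
    (p : Momentum) : distributionDeriv W j p = distributionVariation W (Pi.single j 1) p := by
  obtain ⟨H, -, -, h3, -⟩ := distribution_hasFDerivAt hu hθ
  have h1 : HasFDerivAt (fun w => distribution w p) (fderiv ℝ (fun w => distribution w p) W)
      (Function.update W j (W j)) := by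
    rw [Function.update_eq_self]
    exact (h3 p).hasFDerivAt
  exact (h1.comp_hasDerivAt (W j) (hasDerivAt_update W j (W j))).deriv

lemma transitionMatrix_mulVec (hu : ‖velocity W‖ < 1) (hθ : 0 < temperature W)
    (c : MomentIndex M → ℝ) (k : MomentIndex M) :
    (transitionMatrix W).mulVec c k
      = ∫ p, basisPoly (velocity W) (temperature W) k p * distributionVariation W c p
          ∂invMeasure := by
  have hk := basisPoly_mem hu (temperature W) k
  have h1 : ∀ p, basisPoly (velocity W) (temperature W) k p * distributionVariation W c p
      = ∑ j, c j * (basisPoly (velocity W) (temperature W) k p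
        * distributionVariation W (Pi.single j 1) p) := by
    intro p
    have h2 : c = ∑ j, c j • (Pi.single j 1 : MomentIndex M → ℝ) := by
      ext i
      simp [Finset.sum_apply, Pi.single_apply]
    conv_lhs => rw [h2]
    unfold distributionVariation
    rw [map_sum, Finset.mul_sum]
    refine Finset.sum_congr rfl fun j _ => ?_
    rw [map_smul, smul_eq_mul]
    ring
  simp only [h1]
  rw [integral_finsetSum _ fun j _ =>
    (integrable_mul_distributionVariation hu hθ (Pi.single j 1) hk).const_mul _]
  simp only [Matrix.mulVec, dotProduct, transitionMatrix, Matrix.of_apply, integral_const_mul]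
  refine Finset.sum_congr rfl fun j _ => ?_
  rw [weightedInner_basisFun _ hθ, mul_comm]
  simp only [distributionDeriv_eq hu hθ, mul_comm (basisPoly _ _ _ _)]

/-- The projected kinetic equation is the moment system, since the basis is linearly independent. -/
lemma projectedEquationAt_iff (Q : (Momentum → ℝ) → Momentum → ℝ)
    {W : (Fin 4 → ℝ) → MomentIndex M → ℝ} {x : Fin 4 → ℝ} (hW : DifferentiableAt ℝ W x)
    (hu : ‖velocity (W x)‖ < 1) (hθ : 0 < temperature (W x)) :
    ProjectedEquationAt Q W x ↔ MomentSystemAt Q W x := by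
  unfold ProjectedEquationAt MomentSystemAt
  rw [momentProj_eq_iff hu hθ, funext_iff]
  refine forall_congr' fun i => ?_
  have hR : weightedInner (velocity (W x)) (temperature (W x)) (Q (distribution (W x)))
      (basisFun (velocity (W x)) (temperature (W x)) i) = momentSource Q (W x) i := rfl
  rw [hR]
  obtain ⟨H, -, -, h3, -⟩ := distribution_hasFDerivAt hu hθ
  have hchain : ∀ (α : Fin 4) (p : Momentum),
      fderiv ℝ (fun y => distribution (W y) p) x (Pi.single α 1)
        = distributionVariation (W x) (fderiv ℝ W x (Pi.single α 1)) p := by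
    intro α p
    have := ((h3 p).hasFDerivAt.comp x hW.hasFDerivAt).fderiv
    have e : (fun y => distribution (W y) p) = (fun w => distribution w p) ∘ W := rfl
    rw [e, this]
    rfl
  have hproj : ∀ α : Fin 4, momentProj M (velocity (W x)) (temperature (W x))
      (fun p' => fderiv ℝ (fun y => distribution (W y) p') x (Pi.single α 1))
      = fun p => ∑ k, (transitionMatrix (W x)).mulVec (fderiv ℝ W x (Pi.single α 1)) k
        * basisFun (velocity (W x)) (temperature (W x)) k p := by
    intro α
    ext p
    unfold momentProj
    refine Finset.sum_congr rfl fun k _ => ?_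
    rw [transitionMatrix_mulVec hu hθ, weightedInner_basisFun _ hθ]
    simp only [hchain, mul_comm (basisPoly _ _ _ _)]
  have hL : weightedInner (velocity (W x)) (temperature (W x))
      (fun p => ∑ α : Fin 4, fourMomentum p α
        * momentProj M (velocity (W x)) (temperature (W x))
            (fun p' => fderiv ℝ (fun y => distribution (W y) p') x (Pi.single α 1)) p)
      (basisFun (velocity (W x)) (temperature (W x)) i)
      = (∑ α : Fin 4, (momentMatrix α (W x)).mulVec (fderiv ℝ W x (Pi.single α 1))) i := by
    simp only [hproj]
    rw [weightedInner_basisFun _ hθ, Finset.sum_apply]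
    have h1 : ∀ (α : Fin 4), (momentMatrix α (W x)).mulVec (fderiv ℝ W x (Pi.single α 1)) i
        = ∫ p, fourMomentum p α * (∑ k, (transitionMatrix (W x)).mulVec
            (fderiv ℝ W x (Pi.single α 1)) k * basisFun (velocity (W x)) (temperature (W x)) k p)
            * basisPoly (velocity (W x)) (temperature (W x)) i p ∂invMeasure := by
      intro α
      rw [momentMatrix_eq hu hθ, ← Matrix.mulVec_mulVec,
        ← weightedInner_mul_sum_basisFun hu hθ (fourMomentum_mem α), weightedInner_basisFun _ hθ]
    simp only [h1]
    rw [← integral_finsetSum]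
    · simp only [Finset.sum_mul]
    · intro α _
      simp only [Finset.mul_sum, Finset.sum_mul]
      refine integrable_finsetSum _ fun k _ => ?_
      refine ((integrable_mul_basisFun_mul_basisPoly hu hθ (fourMomentum_mem α) k i).const_mul
        ((transitionMatrix (W x)).mulVec (fderiv ℝ W x (Pi.single α 1)) k)).congr
        (Eventually.of_forall fun p => ?_)
      simp only
      ring
  rw [hL]

/-! ### The Landau-Lifshitz frame -/

lemma solidHarmonic_zero_zero (u : EuclideanSpace ℝ (Fin 3)) (p : Momentum) :
    solidHarmonic 0 0 u p = 1 := by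
  simp [solidHarmonic, realSphericalHarmonic, normLegendre, assocLegendre]

/-- The solid harmonics of degree one are multiples of the components of the fluid momentum. -/
lemma exists_solidHarmonic_one_eq {u : EuclideanSpace ℝ (Fin 3)} (hu : ‖u‖ < 1) (i : Fin 3) :
    ∃ (m : ℤ) (r : ℝ), m.natAbs ≤ 1 ∧ ∀ p, fluidMomentum u p i = r * solidHarmonic 1 m u p := by
  have h11 : (legendreFactor 1 1).coeff 0 = 2 := by
    norm_num [legendreFactor]
  have h10 : (legendreFactor 1 0).coeff 0 = 0 := by
    simp [legendreFactor]
  have h10' : (legendreFactor 1 0).coeff 1 = 2 := by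
    norm_num [legendreFactor]
  have hc := legendreConst_ne_zero 1 1
  have hc' := legendreConst_ne_zero 1 0
  have h2 : √(2 : ℝ) ≠ 0 := by positivity
  fin_cases i
  · refine ⟨1, 1 / (legendreConst 1 1 * √2 * 2), by simp, fun p => ?_⟩
    rw [solidHarmonic_eq_poly hu (by simp)]
    simp [azimuthalPoly, h11]
    field_simp
  · refine ⟨-1, 1 / (legendreConst 1 1 * √2 * 2), by simp, fun p => ?_⟩
    rw [solidHarmonic_eq_poly hu (by simp)]
    simp [azimuthalPoly, h11]
    field_simp
  · refine ⟨0, 1 / (legendreConst 1 0 * 2), by simp, fun p => ?_⟩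
    rw [solidHarmonic_eq_poly hu (by simp)]
    simp [azimuthalPoly, h10, h10', Finset.sum_range_succ]
    field_simp

/-- Only the basis functions with the same spherical harmonic contribute to a moment. -/
lemma integral_sum_basisFun_mul_solidHarmonic {u : EuclideanSpace ℝ (Fin 3)} (hu : ‖u‖ < 1) {θ : ℝ}
    (hθ : 0 < θ) (x : MomentIndex M → ℝ) {ℓ : ℕ} {m : ℤ} (hm : m.natAbs ≤ ℓ) (A : ℝ[X]) :
    ∫ p, (∑ i, x i * basisFun u θ i p) * (A.eval (fluidEnergy u p) * solidHarmonic ℓ m u p)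
        ∂invMeasure
      = juttnerConst θ * harmonicNormSq ℓ m / weightConst ℓ θ⁻¹
        * ∑ k ∈ Finset.range (M + 1 - ℓ), coord x (k + ℓ) ℓ (m + ℓ).toNat
          * polyInner ℓ θ⁻¹ A (orthPoly ℓ θ⁻¹ k) := by
  have hf : (fun p => A.eval (fluidEnergy u p) * solidHarmonic ℓ m u p) ∈ momentumPolynomials :=
    momentumPolynomials.mul_mem (eval_fluidEnergy_mem u A) (solidHarmonic_mem hu hm)
  have hint : ∀ i : MomentIndex M, Integrable (fun p => basisFun u θ i p
      * (A.eval (fluidEnergy u p) * solidHarmonic ℓ m u p)) invMeasure := fun i => by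
    refine (integrable_juttner_mul hu hθ (momentumPolynomials.mul_mem (basisPoly_mem hu θ i)
      hf)).congr (Eventually.of_forall fun p => ?_)
    simp only [basisFun_eq, Pi.mul_apply]
    ring
  simp only [Finset.sum_mul, mul_assoc (x _)]
  rw [integral_finsetSum _ fun i _ => (hint i).const_mul (x i)]
  simp only [integral_const_mul, integral_basisFun_mul hu hθ _ hm, mul_ite, mul_zero]
  rw [← Finset.sum_filter, Finset.mul_sum]
  refine Finset.sum_bij' (fun i _ => (i.1 : ℕ) - ℓ)
    (fun k hk => ⟨⟨k + ℓ, by have := Finset.mem_range.1 hk; omega⟩, ⟨ℓ, by simp⟩,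
      ⟨(m + ℓ).toNat, by simp only; omega⟩⟩) ?_ ?_ ?_ ?_ ?_
  · intro i hi
    obtain ⟨h1, h2⟩ := (Finset.mem_filter.1 hi).2
    have h3 := i.1.2
    have h4 := i.2.1.2
    simp only [Finset.mem_range]
    omega
  · intro k hk
    rw [Finset.mem_filter]
    refine ⟨Finset.mem_univ _, rfl, ?_⟩
    simp only [MomentIndex.order]
    omega
  · intro i hi
    obtain ⟨h1, h2⟩ := (Finset.mem_filter.1 hi).2
    have h4 := i.2.1.2
    unfold MomentIndex.order at h2
    refine MomentIndex.ext_nat ?_ ?_ ?_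
    · simp only; omega
    · simp only; omega
    · simp only; omega
  · intro k hk
    simp only
    omega
  · intro i hi
    obtain ⟨h1, h2⟩ := (Finset.mem_filter.1 hi).2
    have h4 := i.2.1.2
    unfold MomentIndex.order at h2
    have e1 : (i.1 : ℕ) - ℓ + ℓ = i.1 := by omega
    have e2 : (m + ℓ).toNat = (i.2.2 : ℕ) := by omega
    have e3 : coord x (i.1 : ℕ) ℓ (i.2.2 : ℕ) = x i := by
      conv_rhs => rw [← coord_apply x i]
      rw [← h1]
    rw [e1, e2, e3]
    ring

lemma coord_expansionCoeffAt_zero (ζ : ℝ) (W : MomentIndex M → ℝ) {k : ℕ} (hk : k ≤ M)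
    (hk2 : k ≤ 2) : coord (expansionCoeffAt ζ W) k 0 0
      = (if k = 0 then density W / (orthPoly 0 ζ 0).leadingCoeff else 0)
        - 3 * bulkPressure W * (orthPoly 0 ζ k).eval 0 := by
  unfold coord
  rw [dif_pos ⟨by omega, by omega, by omega⟩]
  unfold expansionCoeffAt
  by_cases h : k = 0
  · subst h
    simp
  · simp [h, hk2]

lemma coord_expansionCoeffAt_one (ζ : ℝ) (W : MomentIndex M → ℝ) {k j : ℕ} (hk : k + 1 ≤ M)
    (hk2 : k ≤ 1) (hj : j < 3) : coord (expansionCoeffAt ζ W) (k + 1) 1 j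
      = diffusion W j * (orthPoly 1 ζ k).eval 0 := by
  unfold coord
  rw [dif_pos ⟨by omega, by omega, by omega⟩]
  unfold expansionCoeffAt
  have : k + 1 ≤ 2 := by omega
  simp [this]

lemma bulkPressure_eq_zero (W : MomentIndex M → ℝ) (hM : M < 2) : bulkPressure W = 0 := by
  unfold bulkPressure coord
  rw [dif_neg (by omega)]

lemma diffusion_eq_zero (W : MomentIndex M → ℝ) (hM : M < 2) (j : ℕ) : diffusion W j = 0 := by
  unfold diffusion coord
  rw [dif_neg (by omega)]

/-- `P ↦ ∑ₖ ⟨P, Pₖ⟩ Pₖ(0)` is the evaluation at zero on polynomials of low degree. -/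
lemma sum_polyInner_mul_eval_zero (ℓ : ℕ) {ζ : ℝ} (hζ : 0 < ζ) {n a : ℕ} (ha : 0 < a) (h : a < n) :
    ∑ k ∈ Finset.range n, (orthPoly ℓ ζ k).eval 0 * polyInner ℓ ζ (X ^ a) (orthPoly ℓ ζ k) = 0 := by
  have h1 := congrArg (eval 0) (sum_polyInner_mul_orthPoly ℓ hζ n (X ^ a) (by simpa using h))
  rw [eval_finsetSum] at h1
  simp only [eval_mul, eval_C, eval_pow, eval_X, zero_pow ha.ne'] at h1
  exact (Finset.sum_congr rfl fun k _ => mul_comm _ _).trans h1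

/-- The factor of the Landau moments that depends only on the density and the temperature. -/
def landauFactor (W : MomentIndex M → ℝ) : ℝ :=
  juttnerConst (temperature W) * harmonicNormSq 0 0 * density W

/-- The bulk viscous pressure does not contribute to the first two moments with respect to the fluid
energy: they are those of the local equilibrium. -/
lemma integral_fluidEnergy_pow_mul_distribution (hu : ‖velocity W‖ < 1) (hθ : 0 < temperature W)
    {a : ℕ} (ha : 0 < a) (ha2 : a ≤ 2) :
    ∫ p, fluidEnergy (velocity W) p ^ a * distribution W p ∂invMeasure
      = landauFactor W * weightIntegral 0 (temperature W)⁻¹ (X ^ a) := by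
  have hζ : 0 < (temperature W)⁻¹ := inv_pos.2 hθ
  set ζ := (temperature W)⁻¹ with hζdef
  have h := integral_sum_basisFun_mul_solidHarmonic hu hθ (expansionCoeffAt ζ W) (ℓ := 0) (m := 0)
    (by simp) (X ^ a)
  rw [← hζdef] at h
  have h1 : ∀ p, fluidEnergy (velocity W) p ^ a * distribution W p
      = (∑ i, expansionCoeffAt ζ W i * basisFun (velocity W) (temperature W) i p)
        * ((X ^ a : ℝ[X]).eval (fluidEnergy (velocity W) p)
          * solidHarmonic 0 0 (velocity W) p) := by
    intro p
    rw [solidHarmonic_zero_zero, eval_pow, eval_X, mul_one, mul_comm]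
    rfl
  simp only [h1]
  rw [h]
  have h2 : ∀ k ∈ Finset.range (M + 1 - 0),
      coord (expansionCoeffAt ζ W) (k + 0) 0 ((0 : ℤ) + (0 : ℕ)).toNat
          * polyInner 0 ζ (X ^ a) (orthPoly 0 ζ k)
        = (if k = 0 then density W / (orthPoly 0 ζ 0).leadingCoeff
            * polyInner 0 ζ (X ^ a) (orthPoly 0 ζ 0) else 0)
          - 3 * bulkPressure W
            * ((orthPoly 0 ζ k).eval 0 * polyInner 0 ζ (X ^ a) (orthPoly 0 ζ k)) := by
    intro k hk
    have hk := Finset.mem_range.1 hk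
    by_cases hk2 : k ≤ 2
    · have := coord_expansionCoeffAt_zero ζ W (k := k) (by omega) hk2
      simp only [add_zero, Nat.cast_zero, Int.toNat_zero]
      rw [this]
      split_ifs with h0
      · subst h0; ring
      · ring
    · rw [polyInner_X_pow_orthPoly_of_lt 0 hζ (by omega : a < k), if_neg (by omega)]
      ring
  rw [Finset.sum_congr rfl h2, Finset.sum_sub_distrib, ← Finset.mul_sum, Finset.sum_ite_eq',
    if_pos (by simp)]
  have h3 : bulkPressure W * ∑ k ∈ Finset.range (M + 1 - 0), (orthPoly 0 ζ k).eval 0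
      * polyInner 0 ζ (X ^ a) (orthPoly 0 ζ k) = 0 := by
    by_cases hM : M < 2
    · rw [bulkPressure_eq_zero W hM, zero_mul]
    · rw [sum_polyInner_mul_eval_zero 0 hζ ha (by omega), mul_zero]
  rw [mul_assoc 3, h3, mul_zero, sub_zero]
  have hlc := (orthPoly_leadingCoeff_pos 0 hζ 0).ne'
  have hw := (weightConst_pos 0 hζ).ne'
  rw [orthPoly_zero_eq 0 hζ, ← mul_one (C _), polyInner_C_mul_right, polyInner_eq, mul_one, mul_one,
    leadingCoeff_C, landauFactor]
  field_simp

/-- There is no energy flux in the frame of the fluid. -/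
lemma integral_fluidEnergy_mul_fluidMomentum_mul_distribution (hu : ‖velocity W‖ < 1)
    (hθ : 0 < temperature W) (i : Fin 3) :
    ∫ p, fluidEnergy (velocity W) p * fluidMomentum (velocity W) p i * distribution W p ∂invMeasure
      = 0 := by
  have hζ : 0 < (temperature W)⁻¹ := inv_pos.2 hθ
  set ζ := (temperature W)⁻¹ with hζdef
  obtain ⟨m, r, hm, hr⟩ := exists_solidHarmonic_one_eq hu i
  have h := integral_sum_basisFun_mul_solidHarmonic hu hθ (expansionCoeffAt ζ W) hm (X ^ 1)
  have h1 : ∀ p, fluidEnergy (velocity W) p * fluidMomentum (velocity W) p i * distribution W p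
      = r * ((∑ i, expansionCoeffAt ζ W i * basisFun (velocity W) (temperature W) i p)
        * ((X ^ 1 : ℝ[X]).eval (fluidEnergy (velocity W) p)
          * solidHarmonic 1 m (velocity W) p)) := by
    intro p
    rw [hr, eval_pow, eval_X, pow_one]
    have : distribution W p
      = ∑ i, expansionCoeffAt ζ W i * basisFun (velocity W) (temperature W) i p := rfl
    rw [this]
    ring
  simp only [h1]
  rw [integral_const_mul, h]
  have h2 : ∀ k ∈ Finset.range (M + 1 - 1),
      coord (expansionCoeffAt ζ W) (k + 1) 1 (m + (1 : ℕ)).toNat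
          * polyInner 1 ζ (X ^ 1) (orthPoly 1 ζ k)
        = diffusion W (m + (1 : ℕ)).toNat
            * ((orthPoly 1 ζ k).eval 0 * polyInner 1 ζ (X ^ 1) (orthPoly 1 ζ k)) := by
    intro k hk
    have hk := Finset.mem_range.1 hk
    by_cases hk2 : k ≤ 1
    · rw [coord_expansionCoeffAt_one ζ W (by omega) hk2 (by omega)]
      ring
    · rw [polyInner_X_pow_orthPoly_of_lt 1 hζ (by omega : 1 < k)]
      ring
  rw [Finset.sum_congr rfl h2, ← Finset.mul_sum]
  by_cases hM : M < 2
  · rw [diffusion_eq_zero W hM, zero_mul, mul_zero, mul_zero]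
  · rw [sum_polyInner_mul_eval_zero 1 hζ one_pos (by omega), mul_zero, mul_zero, mul_zero]

lemma fluidEnergy_mem (u : EuclideanSpace ℝ (Fin 3)) : fluidEnergy u ∈ momentumPolynomials :=
  minkowski_mem _

lemma fluidMomentum_mem (u : EuclideanSpace ℝ (Fin 3)) (i : Fin 3) :
    (fun p => fluidMomentum u p i) ∈ momentumPolynomials :=
  momentumPolynomials.neg_mem (minkowski_mem _)

/-- Expansion of the moments of `E p^α` in the frame of the fluid. -/
lemma integral_fluidEnergy_mul_fourMomentum_mul {u : EuclideanSpace ℝ (Fin 3)} (hu : ‖u‖ < 1)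
    {h : Momentum → ℝ} (hh : ∀ f ∈ momentumPolynomials, Integrable (fun p => f p * h p) invMeasure)
    (α : Fin 4) :
    ∫ p, fluidEnergy u p * fourMomentum p α * h p ∂invMeasure
      = (∫ p, fluidEnergy u p ^ 2 * h p ∂invMeasure) * fourVelocity u α
        + ∑ i : Fin 3, (∫ p, fluidEnergy u p * fluidMomentum u p i * h p ∂invMeasure)
          * tetrad u i α := by
  have h1 : ∀ p, fluidEnergy u p * fourMomentum p α * h p
      = fluidEnergy u p ^ 2 * h p * fourVelocity u α
        + ∑ i : Fin 3, fluidEnergy u p * fluidMomentum u p i * h p * tetrad u i α := by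
    intro p
    have := congrFun (fourMomentum_eq hu p) α
    simp only [Pi.add_apply, Pi.smul_apply, smul_eq_mul, Finset.sum_apply] at this
    rw [this, mul_add, add_mul, Finset.mul_sum, Finset.sum_mul]
    congr 1
    · ring
    · exact Finset.sum_congr rfl fun i _ => by ring
  have h2 : ∀ i : Fin 3, Integrable (fun p => fluidEnergy u p * fluidMomentum u p i * h p
      * tetrad u i α) invMeasure := fun i =>
    (hh _ (momentumPolynomials.mul_mem (fluidEnergy_mem u) (fluidMomentum_mem u i))).mul_const _
  simp only [h1]
  have h3 : Integrable (fun p => fluidEnergy u p ^ 2 * h p * fourVelocity u α) invMeasure :=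
    (hh _ (momentumPolynomials.pow_mem (fluidEnergy_mem u) 2)).mul_const _
  rw [integral_add h3 (integrable_finsetSum _ fun i _ => h2 i),
    integral_finsetSum _ fun i _ => h2 i]
  simp only [integral_mul_const]

/-- The Landau condition: the fluid velocity is an eigenvector of the energy-momentum tensor. -/
lemma integral_fluidEnergy_mul_fourMomentum_mul_distribution (hu : ‖velocity W‖ < 1)
    (hθ : 0 < temperature W) (α : Fin 4) :
    ∫ p, fluidEnergy (velocity W) p * fourMomentum p α * distribution W p ∂invMeasure
      = landauFactor W * weightIntegral 0 (temperature W)⁻¹ (X ^ 2)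
        * fourVelocity (velocity W) α := by
  rw [integral_fluidEnergy_mul_fourMomentum_mul hu
    (fun f hf => integrable_mul_distribution hu hθ hf) α,
    integral_fluidEnergy_pow_mul_distribution hu hθ two_pos le_rfl]
  simp only [integral_fluidEnergy_mul_fluidMomentum_mul_distribution hu hθ, zero_mul,
    Finset.sum_const_zero, add_zero]

/-! ### Injectivity of the transition matrix -/

variable {c : MomentIndex M → ℝ}

/-- A function that is orthogonal to the basis is orthogonal to all products of low degree of a
polynomial in the fluid energy with a solid harmonic. -/
lemma integral_solidHarmonic_mul_eq_zero {u : EuclideanSpace ℝ (Fin 3)} {θ : ℝ}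
    (hθ : 0 < θ) (hu : ‖u‖ < 1) {h : Momentum → ℝ}
    (hh : ∀ f ∈ momentumPolynomials, Integrable (fun p => f p * h p) invMeasure)
    (h0 : ∀ k : MomentIndex M, ∫ p, basisPoly u θ k p * h p ∂invMeasure = 0)
    {ℓ : ℕ} {m : ℤ} (hm : m.natAbs ≤ ℓ) {A : ℝ[X]} (hA : A.natDegree + ℓ ≤ M) :
    ∫ p, A.eval (fluidEnergy u p) * solidHarmonic ℓ m u p * h p ∂invMeasure = 0 := by
  have hζ : 0 < θ⁻¹ := inv_pos.2 hθ
  have hsum := sum_polyInner_mul_orthPoly ℓ hζ (M + 1 - ℓ) A (by omega)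
  have h1 : ∀ p, A.eval (fluidEnergy u p) * solidHarmonic ℓ m u p * h p
      = ∑ k ∈ Finset.range (M + 1 - ℓ), polyInner ℓ θ⁻¹ A (orthPoly ℓ θ⁻¹ k)
        * (((orthPoly ℓ θ⁻¹ k).eval (fluidEnergy u p) * solidHarmonic ℓ m u p) * h p) := by
    intro p
    conv_lhs => rw [← hsum]
    rw [eval_finsetSum, Finset.sum_mul, Finset.sum_mul]
    refine Finset.sum_congr rfl fun k _ => ?_
    rw [eval_mul, eval_C]
    ring
  simp only [h1]
  rw [integral_finsetSum]
  · refine Finset.sum_eq_zero fun k hk => ?_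
    have hk := Finset.mem_range.1 hk
    have h2 := h0 ⟨⟨k + ℓ, by omega⟩, ⟨ℓ, by simp⟩, ⟨(m + ℓ).toNat, by simp only; omega⟩⟩
    have e1 : ((m + ℓ).toNat : ℤ) - ℓ = m := by omega
    simp only [basisPoly, MomentIndex.order, e1, Nat.add_sub_cancel] at h2
    rw [integral_const_mul, h2, mul_zero]
  · intro k _
    exact (hh _ (momentumPolynomials.mul_mem (eval_fluidEnergy_mem u (orthPoly ℓ θ⁻¹ k))
      (solidHarmonic_mem hu hm))).const_mul _

/-- For `M = 1` the polynomial factor of the distribution does not depend on the momentum. -/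
lemma distributionPoly_eq_of_lt_two (hM : M < 2) (hθ : 0 < temperature W) (p : Momentum) :
    distributionPoly W p = juttnerConst (temperature W) * density W := by
  have hζ : 0 < (temperature W)⁻¹ := inv_pos.2 hθ
  have h1 : ∀ i : MomentIndex M, i.1 ≠ 0 → expansionCoeff W i = 0 := by
    intro i hi
    have hi0 : (i.1 : ℕ) ≠ 0 := fun h => hi (Fin.ext h)
    have hi1 : (i.1 : ℕ) ≤ 2 := by have := i.1.2; omega
    have hl := i.2.1.2
    have hl1 : (i.2.1 : ℕ) = 0 ∨ (i.2.1 : ℕ) = 1 := by have := i.1.2; omega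
    rw [expansionCoeff_eq, expansionCoeffAt, if_neg hi0, bulkPressure_eq_zero W hM,
      diffusion_eq_zero W hM]
    rcases hl1 with h | h <;> simp [h, hi1]
  have hlc := (orthPoly_leadingCoeff_pos 0 hζ 0).ne'
  unfold distributionPoly
  rw [Finset.sum_eq_single (⟨0, 0, 0⟩ : MomentIndex M)]
  · have h2 : basisPoly (velocity W) (temperature W) (⟨0, 0, 0⟩ : MomentIndex M) p
        = (orthPoly 0 (temperature W)⁻¹ 0).leadingCoeff := by
      unfold basisPoly MomentIndex.order
      have h3 := solidHarmonic_zero_zero (velocity W) p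
      simp only [Fin.val_zero, Nat.cast_zero, sub_zero] at h3 ⊢
      rw [h3, orthPoly_zero_eq 0 hζ, eval_C, leadingCoeff_C, mul_one]
    rw [h2, expansionCoeff_eq, expansionCoeffAt,
      if_pos (show ((⟨0, 0, 0⟩ : MomentIndex M).1 : ℕ) = 0 from rfl), bulkPressure_eq_zero W hM]
    rw [mul_zero, zero_mul, sub_zero, mul_assoc, div_mul_cancel₀ _ hlc]
  · intro i _ hi
    rw [h1 i, mul_zero, zero_mul]
    intro h
    refine hi (MomentIndex.ext_nat (by simp [h]) ?_ ?_)
    · have := i.2.1.2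
      simp only [h, Fin.val_zero] at this ⊢
      omega
    · have h4 := i.2.1.2
      have h5 := i.2.2.2
      simp only [h, Fin.val_zero] at h4 h5 ⊢
      omega
  · simp

/-- The moments that enter the Landau conditions do not change along a direction in the kernel of
the transition matrix. For `M ≥ 2` their test functions lie in the span of the basis; for `M = 1`
the variation of the distribution has a polynomial factor in that span, and so vanishes altogether.
-/
lemma integral_landau_mul_distributionVariation_eq_zero (hM : 1 ≤ M) (hu : ‖velocity W‖ < 1)
    (hθ : 0 < temperature W) (hc : (transitionMatrix W).mulVec c = 0) :
    ∫ p, fluidEnergy (velocity W) p * distributionVariation W c p ∂invMeasure = 0 ∧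
    ∀ α, ∫ p, fluidEnergy (velocity W) p * fourMomentum p α * distributionVariation W c p
      ∂invMeasure = 0 := by
  set u := velocity W with hudef
  have hint : ∀ f ∈ momentumPolynomials,
      Integrable (fun p => f p * distributionVariation W c p) invMeasure :=
    fun f hf => integrable_mul_distributionVariation hu hθ c hf
  have h0 : ∀ k : MomentIndex M,
      ∫ p, basisPoly u (temperature W) k p * distributionVariation W c p ∂invMeasure = 0 := by
    intro k
    rw [← transitionMatrix_mulVec hu hθ, hc]
    rfl
  have hE : ∀ a, a ≤ M →
      ∫ p, fluidEnergy u p ^ a * distributionVariation W c p ∂invMeasure = 0 := by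
    intro a ha
    have := integral_solidHarmonic_mul_eq_zero hθ hu hint h0 (ℓ := 0) (m := 0) (by simp)
      (A := X ^ a) (by simpa using ha)
    simpa only [eval_pow, eval_X, solidHarmonic_zero_zero, mul_one] using this
  have hq : ∀ (a : ℕ) (i : Fin 3), a + 1 ≤ M → ∫ p, fluidEnergy u p ^ a * fluidMomentum u p i
      * distributionVariation W c p ∂invMeasure = 0 := by
    intro a i ha
    obtain ⟨m, r, hm, hr⟩ := exists_solidHarmonic_one_eq hu i
    have := integral_solidHarmonic_mul_eq_zero hθ hu hint h0 hm (A := X ^ a) (by simpa using ha)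
    simp only [eval_pow, eval_X] at this
    have e : ∀ p, fluidEnergy u p ^ a * fluidMomentum u p i * distributionVariation W c p
        = r * (fluidEnergy u p ^ a * solidHarmonic 1 m u p * distributionVariation W c p) := by
      intro p
      rw [hr]
      ring
    simp only [e]
    rw [integral_const_mul, this, mul_zero]
  by_cases hM2 : 2 ≤ M
  · refine ⟨by simpa using hE 1 hM, fun α => ?_⟩
    rw [integral_fluidEnergy_mul_fourMomentum_mul hu hint, hE 2 hM2]
    have hq1 : ∀ i, ∫ p, fluidEnergy u p * fluidMomentum u p i
        * distributionVariation W c p ∂invMeasure = 0 := fun i => by simpa using hq 1 i hM2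
    simp [hq1]
  · have hM1 : M < 2 := by omega
    obtain ⟨H, hH1, hH2, -, hH3, -⟩ := distribution_hasFDerivAt hu hθ
    set K := juttnerConst (temperature W) * density W with hK
    set b := fderiv ℝ inverseTemperatureVector W c with hb
    have hH : ∃ d : ℝ, ∀ p, H c p = d - K * minkowski b (fourMomentum p) := by
      refine ⟨fderiv ℝ (fun w : MomentIndex M → ℝ => juttnerConst (temperature w) * density w) W c,
        fun p => ?_⟩
      rw [hH2, distributionPoly_eq_of_lt_two hM1 hθ]
      have : (fun w : MomentIndex M → ℝ => distributionPoly w p)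
          =ᶠ[𝓝 W] fun w => juttnerConst (temperature w) * density w :=
        (eventually_physical hu hθ).mono fun w hw => distributionPoly_eq_of_lt_two hM1 hw.2 p
      rw [this.fderiv_eq]
      ring
    obtain ⟨d, hd⟩ := hH
    have hHH : ∫ p, H c p * distributionVariation W c p ∂invMeasure = 0 := by
      have e : ∀ p, H c p * distributionVariation W c p
          = d * (fluidEnergy u p ^ 0 * distributionVariation W c p)
            - (K * minkowski (fourVelocity u) b
                * (fluidEnergy u p ^ 1 * distributionVariation W c p)
              + ∑ i : Fin 3, K * minkowski (tetrad u i) b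
                * (fluidEnergy u p ^ 0 * fluidMomentum u p i * distributionVariation W c p)) := by
        intro p
        rw [hd, minkowski_eq_tetrad hu b, Fin.sum_univ_three, Fin.sum_univ_three]
        simp only [fluidEnergy, fluidMomentum]
        ring
      have i1 : ∀ a : ℕ, Integrable (fun p => fluidEnergy u p ^ a
          * distributionVariation W c p) invMeasure := fun a =>
        hint _ (momentumPolynomials.pow_mem (fluidEnergy_mem u) a)
      have i2 : ∀ i, Integrable (fun p => fluidEnergy u p ^ 0 * fluidMomentum u p i
          * distributionVariation W c p) invMeasure := fun i =>
        hint _ (momentumPolynomials.mul_mem (momentumPolynomials.pow_mem (fluidEnergy_mem u) 0)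
          (fluidMomentum_mem u i))
      have i3 : Integrable (fun p => ∑ i : Fin 3, K * minkowski (tetrad u i) b
          * (fluidEnergy u p ^ 0 * fluidMomentum u p i * distributionVariation W c p)) invMeasure :=
        integrable_finsetSum _ fun i _ => (i2 i).const_mul _
      have i4 : Integrable (fun p => K * minkowski (fourVelocity u) b
            * (fluidEnergy u p ^ 1 * distributionVariation W c p)
          + ∑ i : Fin 3, K * minkowski (tetrad u i) b
            * (fluidEnergy u p ^ 0 * fluidMomentum u p i * distributionVariation W c p))
          invMeasure := ((i1 1).const_mul _).add i3
      simp only [e]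
      rw [integral_sub ((i1 0).const_mul _) i4,
        integral_add ((i1 1).const_mul _) i3, integral_finsetSum _ fun i _ => (i2 i).const_mul _]
      simp only [integral_const_mul, hE 0 (Nat.zero_le _), hE 1 hM, hq 0 _ hM, mul_zero,
        Finset.sum_const_zero, add_zero, sub_zero]
    have hzero : ∀ᵐ p ∂invMeasure, H c p = 0 := by
      refine ae_eq_zero_of_integral_sq_eq_zero
        (w := fun p => Real.exp (-(minkowski (inverseTemperatureVector W) (fourMomentum p))))
        (fun p => Real.exp_pos _) ((hint _ (hH1 c)).congr (Eventually.of_forall fun p => ?_)) ?_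
      · simp only [hH3]
        ring
      · rw [← hHH]
        congr 1
        ext p
        rw [hH3]
        ring
    have hvar : ∀ᵐ p ∂invMeasure, distributionVariation W c p = 0 :=
      hzero.mono fun p hp => by rw [hH3, hp, mul_zero]
    refine ⟨integral_eq_zero_of_ae (hvar.mono fun p hp => ?_),
      fun α => integral_eq_zero_of_ae (hvar.mono fun p hp => ?_)⟩ <;> simp [hp]

lemma hasDerivAt_minkowski {a b : ℝ → Fin 4 → ℝ} {a' b' : Fin 4 → ℝ} {t : ℝ}
    (ha : HasDerivAt a a' t) (hb : HasDerivAt b b' t) :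
    HasDerivAt (fun s => minkowski (a s) (b s))
      (minkowski a' (b t) + minkowski (a t) b') t := by
  have ha := hasDerivAt_pi.1 ha
  have hb := hasDerivAt_pi.1 hb
  have h := ((ha 0).fun_mul (hb 0)).fun_sub (HasDerivAt.fun_sum (u := Finset.univ)
    fun (i : Fin 3) _ => (ha i.succ).fun_mul (hb i.succ))
  unfold minkowski
  refine h.congr_deriv ?_
  rw [Finset.sum_add_distrib]
  ring

lemma minkowski_integral_fourMomentum_mul (a : Fin 4 → ℝ) {f h : Momentum → ℝ}
    (hh : ∀ α, Integrable (fun p => fourMomentum p α * f p * h p) invMeasure) :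
    minkowski a (fun α => ∫ p, fourMomentum p α * f p * h p ∂invMeasure)
      = ∫ p, minkowski a (fourMomentum p) * f p * h p ∂invMeasure := by
  have h1 : ∀ p, minkowski a (fourMomentum p) * f p * h p
      = a 0 * (fourMomentum p 0 * f p * h p)
        - ∑ i : Fin 3, a i.succ * (fourMomentum p i.succ * f p * h p) := by
    intro p
    simp only [minkowski, sub_mul, Finset.sum_mul]
    congr 1
    · ring
    · exact Finset.sum_congr rfl fun i _ => by ring
  have h2 : ∀ α, Integrable (fun p => a α * (fourMomentum p α * f p * h p)) invMeasure :=
    fun α => (hh α).const_mul _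
  have h3 : Integrable (fun p => ∑ i : Fin 3, a i.succ * (fourMomentum p i.succ * f p * h p))
      invMeasure := integrable_finsetSum _ fun i _ => h2 i.succ
  simp only [h1]
  rw [integral_sub (h2 0) h3, integral_finsetSum _ fun i _ => h2 i.succ]
  simp only [integral_const_mul, minkowski]

/-- The derivative of a moment contracted with the velocity, along a direction in which the
distribution varies by `distributionVariation W c`. -/
lemma hasLineDerivAt_minkowski_moment (hu : ‖velocity W‖ < 1) (hθ : 0 < temperature W)
    (c : MomentIndex M → ℝ) {f : Momentum → ℝ} (hf : f ∈ momentumPolynomials) :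
    HasLineDerivAt ℝ (fun w : MomentIndex M → ℝ => minkowski (fourVelocity (velocity w))
        (fun α => ∫ p, fourMomentum p α * f p * distribution w p ∂invMeasure))
      (minkowski (fderiv ℝ (fun w : MomentIndex M → ℝ => fourVelocity (velocity w)) W c)
          (fun α => ∫ p, fourMomentum p α * f p * distribution W p ∂invMeasure)
        + ∫ p, fluidEnergy (velocity W) p * f p * distributionVariation W c p ∂invMeasure) W c := by
  have hmem : ∀ α, (fun p => fourMomentum p α * f p) ∈ momentumPolynomials := fun α =>
    momentumPolynomials.mul_mem (fourMomentum_mem α) hf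
  obtain ⟨H, -, -, -, -, h4⟩ := distribution_hasFDerivAt hu hθ
  have hU := (differentiableAt_fourVelocity_velocity hu).hasFDerivAt.hasLineDerivAt c
  have hN : HasDerivAt (fun (t : ℝ) α =>
        ∫ p, fourMomentum p α * f p * distribution (W + t • c) p ∂invMeasure)
      (fun α => ∫ p, fourMomentum p α * f p * distributionVariation W c p ∂invMeasure) 0 := by
    refine hasDerivAt_pi.2 fun α => ?_
    have := (h4 _ (hmem α)).1.hasFDerivAt.hasLineDerivAt c
    rw [(h4 _ (hmem α)).2 c] at this
    exact this
  have h := hasDerivAt_minkowski hU hN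
  simp only [zero_smul, add_zero] at h
  rw [minkowski_integral_fourMomentum_mul (fourVelocity (velocity W)) fun α =>
    integrable_mul_distributionVariation hu hθ c (hmem α)] at h
  exact h

lemma hasFDerivAt_temperature (W : MomentIndex M → ℝ) :
    HasFDerivAt temperature (coordCLM M 1 1 2) W :=
  (coordCLM M 1 1 2).hasFDerivAt

/-- The derivative of the Landau factor, as a combination of the variations of the temperature and
of the density. -/
lemma exists_hasFDerivAt_landauFactor (hθ : 0 < temperature W) :
    ∃ (L : (MomentIndex M → ℝ) →L[ℝ] ℝ) (r : ℝ), HasFDerivAt landauFactor L W ∧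
      ∀ c, L c = r * temperature c
        + juttnerConst (temperature W) * harmonicNormSq 0 0 * density c := by
  have h1 := (differentiableAt_juttnerConst hθ).hasDerivAt.comp_hasFDerivAt W
    (hasFDerivAt_temperature W)
  have h2 : HasFDerivAt (density : (MomentIndex M → ℝ) → ℝ) (coordCLM M 0 0 0) W :=
    (coordCLM M 0 0 0).hasFDerivAt
  refine ⟨_, density W * (harmonicNormSq 0 0 * deriv juttnerConst (temperature W)),
    (h1.mul_const (harmonicNormSq 0 0)).mul h2, fun c => ?_⟩
  have e1 : coordCLM M 1 1 2 c = temperature c := rfl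
  have e2 : coordCLM M 0 0 0 c = density c := rfl
  simp only [add_apply, smul_apply, smul_eq_mul, e1, e2,
    Function.comp_apply]
  ring

lemma hasLineDerivAt_landauFactor_mul_weightIntegral (hθ : 0 < temperature W)
    {L : (MomentIndex M → ℝ) →L[ℝ] ℝ} (hL : HasFDerivAt landauFactor L W)
    (c : MomentIndex M → ℝ) (n : ℕ) :
    HasLineDerivAt ℝ (fun w : MomentIndex M → ℝ =>
        landauFactor w * weightIntegral 0 (temperature w)⁻¹ (X ^ n))
      (L c * weightIntegral 0 (temperature W)⁻¹ (X ^ n)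
        + landauFactor W * (weightIntegral 0 (temperature W)⁻¹ (X ^ (n + 1))
          * (temperature c / temperature W ^ 2))) W c := by
  have h1 : HasDerivAt (fun θ : ℝ => weightIntegral 0 θ⁻¹ (X ^ n))
      (-weightIntegral 0 (temperature W)⁻¹ (X ^ (n + 1)) * -(temperature W ^ 2)⁻¹)
      (temperature W) :=
    HasDerivAt.comp (h₂ := fun z => weightIntegral 0 z (X ^ n)) _
      (hasDerivAt_weightIntegral_X_pow 0 n (inv_pos.2 hθ)) (hasDerivAt_inv hθ.ne')
  have h2 := (hL.mul (h1.comp_hasFDerivAt W (hasFDerivAt_temperature W))).hasLineDerivAt c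
  have e1 : coordCLM M 1 1 2 c = temperature c := rfl
  simp only [add_apply, smul_apply, smul_eq_mul, e1,
    Function.comp_apply] at h2
  refine HasDerivAt.congr_deriv h2 ?_
  ring

lemma eventually_physical_line (hu : ‖velocity W‖ < 1) (hθ : 0 < temperature W)
    (c : MomentIndex M → ℝ) :
    ∀ᶠ t : ℝ in 𝓝 0, ‖velocity (W + t • c)‖ < 1 ∧ 0 < temperature (W + t • c) := by
  have h : Tendsto (fun t : ℝ => W + t • c) (𝓝 0) (𝓝 W) := by
    have : Continuous fun t : ℝ => W + t • c := by fun_prop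
    simpa using this.tendsto 0
  exact h.eventually (eventually_physical hu hθ)

/-- The velocity four-vector stays on the unit hyperboloid, so its variation is orthogonal to it. -/
lemma minkowski_fourVelocity_fderiv (hu : ‖velocity W‖ < 1) (hθ : 0 < temperature W)
    (c : MomentIndex M → ℝ) : minkowski (fourVelocity (velocity W))
      (fderiv ℝ (fun w : MomentIndex M → ℝ => fourVelocity (velocity w)) W c) = 0 := by
  have hU := (differentiableAt_fourVelocity_velocity hu).hasFDerivAt.hasLineDerivAt c
  have h := hasDerivAt_minkowski hU hU
  have h1 : (fun t : ℝ => minkowski (fourVelocity (velocity (W + t • c)))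
      (fourVelocity (velocity (W + t • c)))) =ᶠ[𝓝 0] fun _ => 1 :=
    (eventually_physical_line hu hθ c).mono fun t ht => minkowski_fourVelocity_self ht.1
  have h2 := (h.congr_of_eventuallyEq h1.symm).unique (hasDerivAt_const (0 : ℝ) (1 : ℝ))
  simp only [zero_smul, add_zero] at h2
  rw [minkowski_comm] at h2
  linarith

/-- The spatial velocity does not vary if the velocity four-vector does not. -/
lemma velocity_eq_zero_of_fderiv_fourVelocity_eq_zero (hu : ‖velocity W‖ < 1)
    (h : fderiv ℝ (fun w : MomentIndex M → ℝ => fourVelocity (velocity w)) W c = 0) :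
    velocity c = 0 := by
  have hU := (differentiableAt_fourVelocity_velocity hu).hasFDerivAt.hasLineDerivAt c
  rw [h] at hU
  have hU := hasDerivAt_pi.1 hU
  ext i
  have hv : HasDerivAt (fun t : ℝ => velocity (W + t • c) i) (velocity c i) 0 := by
    have : HasDerivAt (fun t : ℝ => velocity W i + t * velocity c i) (velocity c i) 0 := by
      simpa using ((hasDerivAt_id (0 : ℝ)).mul_const (velocity c i)).const_add (velocity W i)
    simpa [velocity_add_smul] using this
  have h1 := (hU 0).fun_mul hv
  have h2 := hU i.succ
  simp only [fourVelocity_succ] at h2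
  have h3 := h1.unique h2
  simp only [zero_smul, add_zero, Pi.zero_apply, zero_mul, zero_add] at h3
  simpa using (mul_eq_zero.1 h3).resolve_left (fourVelocity_zero_pos hu).ne'

lemma energyMomentum_apply (W : MomentIndex M → ℝ) (α β : Fin 4) : energyMomentum W α β
    = ∫ p, fourMomentum p β * fourMomentum p α * distribution W p ∂invMeasure := by
  rw [integral_invMeasure]
  simp only [energyMomentum, Matrix.of_apply, fourMomentum_zero, mul_comm (fourMomentum _ α)]

/-- The density, the velocity and the temperature do not vary along a direction in the kernel of the
transition matrix: the Landau conditions express the variation of `T^{αβ} U_β` by those three, the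
positivity of the energy-momentum tensor excludes a variation of the velocity, and the strict
Cauchy-Schwarz inequality between the moments of the equilibrium excludes the other two. -/
lemma equilibrium_variation_eq_zero (hM : 1 ≤ M) (hW : Admissible W)
    (hc : (transitionMatrix W).mulVec c = 0) :
    density c = 0 ∧ velocity c = 0 ∧ temperature c = 0 := by
  have hu := hW.velocity_lt
  have hθ := hW.temperature_pos
  have hζ : 0 < (temperature W)⁻¹ := inv_pos.2 hθ
  obtain ⟨hv1, hv2⟩ := integral_landau_mul_distributionVariation_eq_zero hM hu hθ hc
  obtain ⟨L, r, hL, hLc⟩ := exists_hasFDerivAt_landauFactor hθ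
  set U := fourVelocity (velocity W) with hU
  set U' := fderiv ℝ (fun w : MomentIndex M → ℝ => fourVelocity (velocity w)) W c with hU'
  set z := temperature c / temperature W ^ 2 with hz
  set S := landauFactor W with hS
  set m : ℕ → ℝ := fun n => weightIntegral 0 (temperature W)⁻¹ (X ^ n) with hm
  have hmpos : ∀ n, 0 < m n := fun n => weightIntegral_pos 0 hζ (pow_ne_zero _ X_ne_zero) (by
    intro x hx
    simp only [eval_pow, eval_X]
    positivity)
  have hSpos : 0 < S := mul_pos (mul_pos (juttnerConst_pos hθ) (harmonicNormSq_pos (by simp)))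
    hW.density_pos
  have hUU' : minkowski U U' = 0 := minkowski_fourVelocity_fderiv hu hθ c
  -- the variation of `N^α U_α`
  have hN : minkowski U' (fun α => ∫ p, fourMomentum p α * 1 * distribution W p ∂invMeasure)
      = L c * m 1 + S * (m 2 * z) := by
    have h1 := hasLineDerivAt_minkowski_moment hu hθ c (const_mem_momentumPolynomials 1)
    have h2 := hasLineDerivAt_landauFactor_mul_weightIntegral hθ hL c 1
    simp only [mul_one, hv1, add_zero] at h1 ⊢
    refine HasDerivAt.unique h1 (HasDerivAt.congr_of_eventuallyEq h2 ?_)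
    filter_upwards [eventually_physical_line hu hθ c] with t ht
    have := minkowski_integral_fourMomentum_mul (fourVelocity (velocity (W + t • c)))
      (f := fun _ => 1) (h := distribution (W + t • c)) fun α =>
        integrable_mul_distribution ht.1 ht.2 (momentumPolynomials.mul_mem (fourMomentum_mem α)
          (const_mem_momentumPolynomials 1))
    simp only [mul_one] at this
    rw [this, ← integral_fluidEnergy_pow_mul_distribution ht.1 ht.2 one_pos one_le_two]
    simp only [pow_one, fluidEnergy]
  -- the variation of `T^{αβ} U_β`
  have hT : ∀ β, minkowski U' (fun α => energyMomentum W β α)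
      = (L c * m 2 + S * (m 3 * z)) * U β + S * m 2 * U' β := by
    intro β
    have h1 := hasLineDerivAt_minkowski_moment hu hθ c (fourMomentum_mem β)
    have h2 := hasLineDerivAt_landauFactor_mul_weightIntegral hθ hL c 2
    have h3 := hasDerivAt_pi.1
      ((differentiableAt_fourVelocity_velocity hu).hasFDerivAt.hasLineDerivAt c) β
    have h4 := HasDerivAt.fun_mul h2 h3
    simp only [hv2, add_zero, zero_smul] at h1 h4
    simp only [energyMomentum_apply]
    refine HasDerivAt.unique h1 (HasDerivAt.congr_of_eventuallyEq h4 ?_)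
    filter_upwards [eventually_physical_line hu hθ c] with t ht
    rw [minkowski_integral_fourMomentum_mul (fourVelocity (velocity (W + t • c)))
      (h := distribution (W + t • c)) fun α => integrable_mul_distribution ht.1 ht.2
        (momentumPolynomials.mul_mem (fourMomentum_mem α) (fourMomentum_mem β))]
    exact integral_fluidEnergy_mul_fourMomentum_mul_distribution ht.1 ht.2 β
  -- contraction with `U'`, which is spacelike, so that its Minkowski square is nonpositive
  have hU'0 : U' = 0 := by
    by_contra hne
    let v : Fin 4 → ℝ := Fin.cons (U' 0) fun i => -U' i.succ
    have hvne : v ≠ 0 := by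
      intro h0
      apply hne
      ext α
      refine Fin.cases ?_ (fun i => ?_) α
      · exact congrFun h0 0
      · have := congrFun h0 i.succ
        simpa [v] using this
    have hpos := hW.energyMomentum_posDef.dotProduct_mulVec_pos hvne
    have hlow : ∀ a : Fin 4 → ℝ, a ⬝ᵥ v = minkowski U' a := by
      intro a
      simp [dotProduct, Fin.sum_univ_succ, v, minkowski]
      ring
    have hmv : (energyMomentum W).mulVec v
        = (L c * m 2 + S * (m 3 * z)) • U + (S * m 2) • U' := by
      ext β
      simp only [Matrix.mulVec, hlow, hT, Pi.add_apply, Pi.smul_apply, smul_eq_mul]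
    rw [star_trivial, dotProduct_comm, hlow, hmv, minkowski_add_right, minkowski_smul_right,
      minkowski_smul_right, minkowski_comm U' U, hUU', mul_zero, zero_add,
      minkowski_eq_tetrad hu U' U', hUU', mul_zero, zero_sub] at hpos
    have hnn : 0 ≤ ∑ i : Fin 3, minkowski (tetrad (velocity W) i) U'
        * minkowski (tetrad (velocity W) i) U' :=
      Finset.sum_nonneg fun i _ => mul_self_nonneg _
    have := mul_nonneg (mul_pos hSpos (hmpos 2)).le hnn
    linarith
  have hU0 := fourVelocity_zero_pos hu
  have hmink0 : ∀ a : Fin 4 → ℝ, minkowski 0 a = 0 := fun a => by simp [minkowski]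
  rw [hU'0, hmink0] at hN
  have hT0 := hT 0
  rw [hU'0, hmink0, Pi.zero_apply, mul_zero, add_zero] at hT0
  have hT1 : L c * m 2 + S * (m 3 * z) = 0 :=
    (mul_eq_zero.1 hT0.symm).resolve_right hU0.ne'
  have hz0 : z = 0 := by
    have h1 : S * (m 1 * m 3 - m 2 ^ 2) * z = 0 := by linear_combination m 1 * hT1 + m 2 * hN
    have h2 : 0 < m 1 * m 3 - m 2 ^ 2 := sub_pos.2 (weightIntegral_sq_lt hζ)
    exact (mul_eq_zero.1 h1).resolve_left (mul_pos hSpos h2).ne'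
  have hθc : temperature c = 0 := by
    rw [hz] at hz0
    exact (div_eq_zero_iff.1 hz0).resolve_right (pow_pos hθ 2).ne'
  refine ⟨?_, velocity_eq_zero_of_fderiv_fourVelocity_eq_zero hu hU'0, hθc⟩
  rw [hz0, mul_zero, mul_zero, add_zero] at hT1
  have hLc0 := (mul_eq_zero.1 hT1).resolve_right (hmpos 2).ne'
  rw [hLc, hθc, mul_zero, zero_add] at hLc0
  exact (mul_eq_zero.1 hLc0).resolve_left
    (mul_pos (juttnerConst_pos hθ) (harmonicNormSq_pos (by simp))).ne'

/-- If the velocity and the temperature do not vary, then the variation of the distribution is that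
of its coefficients. -/
lemma distributionVariation_eq (hu : ‖velocity W‖ < 1) (hθ : 0 < temperature W)
    (hv : velocity c = 0) (ht : temperature c = 0) (p : Momentum) :
    distributionVariation W c p = ∑ i, expansionCoeffAt (temperature W)⁻¹ c i
      * basisFun (velocity W) (temperature W) i p := by
  obtain ⟨H, -, -, h3, -⟩ := distribution_hasFDerivAt hu hθ
  have h1 : HasDerivAt (fun t : ℝ => distribution (W + t • c) p) (distributionVariation W c p) 0 :=
    (h3 p).hasFDerivAt.hasLineDerivAt c
  have h2 : (fun t : ℝ => distribution (W + t • c) p) = fun t => distribution W p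
      + t * ∑ i, expansionCoeffAt (temperature W)⁻¹ c i
        * basisFun (velocity W) (temperature W) i p := by
    ext t
    unfold distribution
    rw [Finset.mul_sum, ← Finset.sum_add_distrib]
    refine Finset.sum_congr rfl fun i _ => ?_
    rw [expansionCoeff_eq, expansionCoeff_eq, velocity_add_smul, temperature_add_smul, hv, ht,
      smul_zero, add_zero, mul_zero, add_zero, expansionCoeffAt_add_smul]
    ring
  rw [h2] at h1
  refine h1.unique ?_
  simpa using ((hasDerivAt_id (0 : ℝ)).mul_const (∑ i, expansionCoeffAt (temperature W)⁻¹ c i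
        * basisFun (velocity W) (temperature W) i p)).const_add (distribution W p)

/-- The transition matrix is invertible at admissible states. -/
lemma isUnit_transitionMatrix (hM : 1 ≤ M) (hW : Admissible W) : IsUnit (transitionMatrix W) := by
  rw [← Matrix.mulVec_injective_iff_isUnit, ← Matrix.coe_mulVecLin, injective_iff_map_eq_zero]
  intro c hc
  rw [Matrix.mulVecLin_apply] at hc
  have hu := hW.velocity_lt
  have hθ := hW.temperature_pos
  have hζ : 0 < (temperature W)⁻¹ := inv_pos.2 hθ
  obtain ⟨hn, hv, ht⟩ := equilibrium_variation_eq_zero hM hW hc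
  have hx : ∀ i, expansionCoeffAt (temperature W)⁻¹ c i = 0 := by
    intro i
    have h1 := transitionMatrix_mulVec hu hθ c i
    rw [hc] at h1
    simp only [distributionVariation_eq hu hθ hv ht, mul_comm (basisPoly _ _ _ _)] at h1
    rw [integral_sum_basisFun_mul_basisPoly hu hθ] at h1
    exact (mul_eq_zero.1 h1.symm).resolve_right (basisNormSq_pos hθ i).ne'
  have heval : ∀ ℓ, (orthPoly ℓ (temperature W)⁻¹ 0).eval 0 ≠ 0 := fun ℓ => by
    rw [orthPoly_zero_eq ℓ hζ, eval_C]
    exact (orthPoly_leadingCoeff_pos ℓ hζ 0).ne'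
  have hb : bulkPressure c = 0 := by
    have h1 := coord_expansionCoeffAt_zero (temperature W)⁻¹ c (Nat.zero_le _) (Nat.zero_le _)
    have h2 : coord (expansionCoeffAt (temperature W)⁻¹ c) 0 0 0 = 0 := by
      unfold coord
      rw [dif_pos ⟨by omega, by omega, by omega⟩, hx]
    rw [h2, if_pos rfl, hn, zero_div, zero_sub, zero_eq_neg, mul_assoc] at h1
    exact (mul_eq_zero.1 ((mul_eq_zero.1 h1).resolve_left three_ne_zero)).resolve_right (heval 0)
  have hd : ∀ j < 3, diffusion c j = 0 := by
    intro j hj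
    have h1 := coord_expansionCoeffAt_one (temperature W)⁻¹ c (k := 0) (by omega) (by omega) hj
    have h2 : coord (expansionCoeffAt (temperature W)⁻¹ c) (0 + 1) 1 j = 0 := by
      unfold coord
      rw [dif_pos ⟨by omega, by omega, by omega⟩, hx]
    rw [h2] at h1
    exact (mul_eq_zero.1 h1.symm).resolve_right (heval 1)
  have hv0 : coord c 1 0 0 = 0 := by simpa [velocity] using congrArg (fun u => u 0) hv
  have hv1 : coord c 1 1 0 = 0 := by simpa [velocity] using congrArg (fun u => u 1) hv
  have hv2 : coord c 1 1 1 = 0 := by simpa [velocity] using congrArg (fun u => u 2) hv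
  ext i
  have hl := i.2.1.2
  have hj := i.2.2.2
  have hi := hx i
  have key : ∀ a b e : ℕ, (i.1 : ℕ) = a → (i.2.1 : ℕ) = b → (i.2.2 : ℕ) = e →
      coord c a b e = 0 → c i = 0 := by
    rintro _ _ _ rfl rfl rfl h
    rwa [coord_apply] at h
  rw [Pi.zero_apply]
  unfold expansionCoeffAt at hi
  by_cases h0 : (i.1 : ℕ) = 0
  · exact key 0 0 0 h0 (by omega) (by omega) hn
  by_cases h1 : (i.1 : ℕ) ≤ 2 ∧ (i.2.1 : ℕ) = 0
  · rcases (by omega : (i.1 : ℕ) = 1 ∨ (i.1 : ℕ) = 2) with h | h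
    · exact key 1 0 0 h h1.2 (by omega) hv0
    · exact key 2 0 0 h h1.2 (by omega) hb
  by_cases h2 : (i.1 : ℕ) ≤ 2 ∧ (i.2.1 : ℕ) = 1
  · rcases (by omega : (i.1 : ℕ) = 1 ∨ (i.1 : ℕ) = 2) with h | h
    · rcases (by omega : (i.2.2 : ℕ) = 0 ∨ (i.2.2 : ℕ) = 1 ∨ (i.2.2 : ℕ) = 2) with h' | h' | h'
      · exact key 1 1 0 h h2.2 h' hv1
      · exact key 1 1 1 h h2.2 h' hv2
      · exact key 1 1 2 h h2.2 h' ht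
    · exact key 2 1 _ h h2.2 rfl (hd _ (by omega))
  rwa [if_neg h0, if_neg h1, if_neg h2] at hi

/-! ### Definiteness and conclusion -/

/-- `|ν · p| < p⁰` for a unit vector `ν`. -/
lemma abs_inner_lt_fourMomentum_zero {ν : EuclideanSpace ℝ (Fin 3)} (hν : ‖ν‖ = 1) (p : Momentum) :
    |∑ i : Fin 3, ν i * fourMomentum p i.succ| < fourMomentum p 0 := by
  have h1 : ∑ i : Fin 3, ν i * fourMomentum p i.succ = inner ℝ p ν := by
    simp [fourMomentum_succ, PiLp.inner_apply]
  rw [h1, fourMomentum_zero]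
  refine lt_of_le_of_lt (abs_real_inner_le_norm p ν) ?_
  rw [hν, mul_one]
  exact Real.lt_sqrt_of_sq_lt (by linarith)

lemma sum_smul_fourMomentum_mem (ν : Fin 3 → ℝ) :
    (fun p => ∑ i : Fin 3, ν i * fourMomentum p i.succ) ∈ momentumPolynomials := by
  have : (fun p : Momentum => ∑ i : Fin 3, ν i * fourMomentum p i.succ)
      = ∑ i : Fin 3, ν i • fun p => fourMomentum p i.succ := by
    ext p
    simp
  rw [this]
  exact momentumPolynomials.sum_mem fun i _ => momentumPolynomials.smul_mem (fourMomentum_mem _) _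

lemma sum_smul_fluxMatrix {u : EuclideanSpace ℝ (Fin 3)} (hu : ‖u‖ < 1) {θ : ℝ} (hθ : 0 < θ)
    (ν : Fin 3 → ℝ) :
    ∑ i : Fin 3, ν i • (fluxMatrix u θ (fun p => fourMomentum p i.succ) :
        Matrix (MomentIndex M) (MomentIndex M) ℝ)
      = fluxMatrix u θ fun p => ∑ i : Fin 3, ν i * fourMomentum p i.succ := by
  have h : (fun p : Momentum => ∑ i : Fin 3, ν i * fourMomentum p i.succ)
      = ν 0 • (fun p => fourMomentum p (Fin.succ 0)) + ν 1 • (fun p => fourMomentum p (Fin.succ 1))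
        + ν 2 • (fun p => fourMomentum p (Fin.succ 2)) := by
    ext p
    simp [Fin.sum_univ_three]
  have hm : ∀ i : Fin 3, ν i • (fun p => fourMomentum p i.succ) ∈ momentumPolynomials := fun i =>
    momentumPolynomials.smul_mem (fourMomentum_mem _) _
  rw [h, fluxMatrix_add hu hθ (momentumPolynomials.add_mem (hm 0) (hm 1)) (hm 2),
    fluxMatrix_add hu hθ (hm 0) (hm 1), fluxMatrix_smul, fluxMatrix_smul, fluxMatrix_smul,
    Fin.sum_univ_three]

lemma isUnit_momentMatrix_zero (hM : 1 ≤ M) (hW : Admissible W) : IsUnit (momentMatrix 0 W) := by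
  rw [momentMatrix_eq hW.velocity_lt hW.temperature_pos]
  exact (fluxMatrix_posDef hW.velocity_lt hW.temperature_pos (fourMomentum_mem 0)
    fourMomentum_zero_pos).isUnit.mul (isUnit_transitionMatrix hM hW)

/-- Hyperbolicity: the matrices `A⁰ ± ν · A` are positive definite, because `|ν · p| < p⁰`. -/
lemma directionalMatrix_hyperbolic (hM : 1 ≤ M) (hW : Admissible W)
    {ν : EuclideanSpace ℝ (Fin 3)} (hν : ‖ν‖ = 1) :
    RealDiagonalizable (directionalMatrix ν W) ∧
      spectralRadius ℂ ((directionalMatrix ν W).map Complex.ofReal) < 1 := by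
  have hu := hW.velocity_lt
  have hθ := hW.temperature_pos
  have hs := sum_smul_fourMomentum_mem ν
  have h0 := fourMomentum_mem 0
  have e : directionalMatrix ν W
      = (fluxMatrix (velocity W) (temperature W) (fun p => fourMomentum p 0) * transitionMatrix W)⁻¹
        * (fluxMatrix (velocity W) (temperature W)
            (fun p => ∑ i : Fin 3, ν i * fourMomentum p i.succ) * transitionMatrix W) := by
    unfold directionalMatrix
    simp only [momentMatrix_eq hu hθ]
    rw [← sum_smul_fluxMatrix hu hθ ν, Finset.sum_mul]
    simp only [Matrix.smul_mul]
  rw [e]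
  refine realDiagonalizable_and_spectralRadius_lt_one
    (fluxMatrix_posDef hu hθ h0 fourMomentum_zero_pos) (fluxMatrix_isHermitian _ _ _) ?_ ?_
    (isUnit_transitionMatrix hM hW)
  · rw [← fluxMatrix_add hu hθ h0 hs]
    refine fluxMatrix_posDef hu hθ (momentumPolynomials.add_mem h0 hs) fun p => ?_
    have := (abs_lt.1 (abs_inner_lt_fourMomentum_zero hν p)).1
    simp only [Pi.add_apply]
    linarith
  · rw [sub_eq_add_neg, ← neg_one_smul ℝ (fluxMatrix _ _ _), ← fluxMatrix_smul,
      ← fluxMatrix_add hu hθ h0 (momentumPolynomials.smul_mem hs _)]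
    refine fluxMatrix_posDef hu hθ (momentumPolynomials.add_mem h0
      (momentumPolynomials.smul_mem hs _)) fun p => ?_
    have := (abs_lt.1 (abs_inner_lt_fourMomentum_zero hν p)).2
    simp only [Pi.add_apply, Pi.smul_apply, smul_eq_mul]
    linarith

end
end RelMoment

theorem mainTheorem1 (M : ℕ) (hM : 1 ≤ M) :
    (∀ (Q : (RelMoment.Momentum → ℝ) → RelMoment.Momentum → ℝ)
        (W : (Fin 4 → ℝ) → RelMoment.MomentIndex M → ℝ) (x : Fin 4 → ℝ),
        DifferentiableAt ℝ W x → RelMoment.Admissible (W x) →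
        (RelMoment.ProjectedEquationAt Q W x ↔ RelMoment.MomentSystemAt Q W x)) ∧
    (∀ W : RelMoment.MomentIndex M → ℝ, RelMoment.Admissible W →
        IsUnit (RelMoment.momentMatrix 0 W) ∧
        ∀ ν : EuclideanSpace ℝ (Fin 3), ‖ν‖ = 1 →
          RelMoment.RealDiagonalizable (RelMoment.directionalMatrix ν W) ∧
          spectralRadius ℂ ((RelMoment.directionalMatrix ν W).map Complex.ofReal) < 1) := by
  refine ⟨fun Q W x hW hadm => RelMoment.projectedEquationAt_iff Q hW hadm.velocity_lt
    hadm.temperature_pos, fun W hW => ⟨RelMoment.isUnit_momentMatrix_zero hM hW, fun ν hν =>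
      RelMoment.directionalMatrix_hyperbolic hM hW hν⟩⟩
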